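/- **Corollary (lower bound for the filamentation length).** For $g\in L^2(\mathbb R^d)$ write $\hat g(\xi)=\int e^{-i\xi\cdot x}g(x)\,dx$ (in the $L^2$ sense), $\|\nabla^{-1}g\|_2^2=\int_{\mathbb R^d}(|\xi|^{-1}|\hat g(\xi)|)^2\,d\xi$, and say that $g$ has decay character $r>-\frac d2$ if $\lim_{\delta\to0^+}\delta^{-2r-d}\int_{|\xi|\le\delta}|\hat g|^2\,d\xi$ exists and lies in $(0,\infty)$. In this case there are $c_1,c_2,\delta_0>0$ with $$c_1\delta^{2r+d}\le\int_{|\xi|\le\delta}|\hat g(\xi)|^2\,d\xi\le c_2\delta^{2r+d}\qquad(0<\delta\le\delta_0).\tag{1}$$ Let $d\in\{2,3\}$, $1-\frac d2<r<1$, $\alpha>\frac r2+\frac12$, and let $m\ge d+2$ be rational. Let $\theta_0\in L^2(\mathbb R^d)$ have $\nabla\theta_0\in L^2$ and decay character $r$, and let (1) hold for $\theta_0$. Let $u$ be a time-dependent divergence-free vector field on $\mathbb R^d\times(0,\infty)$ such that, for some $K>0$ and $\nu\ge0$ and all $t>0$, $$K^{-1}(1+t)^{-\alpha}\le\|u(t)\|_2\le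 K(1+t)^{-\alpha},\qquad K^{-1}(1+t)^{-\nu}\le\|\nabla u(t)\|_\infty\le K(1+t)^{-\nu}.$$ Let $0<\kappa\le\kappa_1$ and let $\theta\in C([0,\infty);L^2)\cap L^2_{\rm loc}([0,\infty);H^1)$ be a weak solution of $\partial_t\theta+u\cdot\nabla\theta-\kappa\Delta\theta=0$ in $\mathbb R^d\times(0,\infty)$ with $\theta(0)=\theta_0$. Put $$f(t)=\kappa^{\frac d4+\frac r2-m-\frac12}\times\begin{cases}e^{\frac{(1+t)^{1-\nu}-1}{1-\nu}},&\nu>1,\\[2pt] 1,&\nu=1,\\[2pt] e^{\frac{(1+t)^{1-\nu}-1}{1-\nu}}(1+t)^{-1},&0\le\nu<1.\end{cases}$$ Then there is a constant $C>0$, depending only on $d,r,\alpha,m,\|\theta_0\|_2,\|\nabla\theta_0\|_2$, on the constants $c_1,c_2,\delta_0$ in (1), on $K$ and on the upper bound $\kappa_1$ (but not on $t$, $\kappa\in(0,\kappa_1]$, $\nu$, or otherwise on $\theta_0$, $u$ and $\theta$), such that the filamentation length $\lambda(t)=\|\nabla^{-1}\theta(t)\|_2/\|\theta(t)\|_2$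 is well defined and satisfies $$\lambda(t)\ge C(1+t)^{\frac12}f(t)^{-1}$$ for every $t>0$ that is large enough in the sense that $$(1+t)^{r-1}\le\kappa^{m+\frac12-\frac d4-r}\ \text{ if }\alpha\ge\tfrac32-\tfrac r2,\qquad (1+t)^{\frac r2-\alpha+\frac12}\le\kappa^{m+\frac12-\frac d4-r}\ \text{ if }\tfrac r2+\tfrac12<\alpha\le\tfrac32-\tfrac r2 .$$ Moreover, for every fixed $\kappa>0$, as $t\to\infty$ the function $(1+t)^{\frac12}f(t)^{-1}$ tends to $\infty$ if $\nu\ge1$ (dispersion) and to $0$ if $0\le\nu<1$ (mixing). -/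

import Mathlib

open MeasureTheory Filter Topology

noncomputable section

namespace AdvDiff

/-- Euclidean space `ℝ^d`. -/
abbrev E (d : ℕ) : Type := EuclideanSpace ℝ (Fin d)

/-- The (possibly vector valued) function `f'` is the weak (distributional) derivative of `f`:
`∫ (∂_v φ) f = - ∫ φ (f' v)` for all smooth compactly supported `φ` and all directions `v`. -/
structure HasWeakDeriv {d : ℕ} {F : Type*} [NormedAddCommGroup F] [NormedSpace ℝ F]
    (f : E d → F) (f' : E d → (E d →L[ℝ] F)) : Prop where
  locallyIntegrable : LocallyIntegrable f volume
  locallyIntegrable_deriv : LocallyIntegrable f' volume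
  integral_eq : ∀ φ : E d → ℝ, ContDiff ℝ (⊤ : ℕ∞) φ → HasCompactSupport φ → ∀ v : E d,
    ∫ x, (fderiv ℝ φ x v) • f x = - ∫ x, φ x • f' x v

/-- `∇ · w = 0` in the sense of distributions. -/
def IsDivFree {d : ℕ} (w : E d → E d) : Prop :=
  ∀ φ : E d → ℝ, ContDiff ℝ (⊤ : ℕ∞) φ → HasCompactSupport φ → ∫ x, fderiv ℝ φ x (w x) = 0

/-- The `L²` norm (used for functions in `L²`). -/
def l2Norm {d : ℕ} {F : Type*} [NormedAddCommGroup F] (f : E d → F) : ℝ :=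
  (eLpNorm f 2 volume).toReal

/-- The `L^∞` norm (used for functions in `L^∞`). -/
def lInfNorm {d : ℕ} {F : Type*} [NormedAddCommGroup F] (f : E d → F) : ℝ :=
  (eLpNorm f ⊤ volume).toReal

/-- `L²` (Plancherel) Fourier transform of a real function on `ℝ^d` with Mathlib's normalisation,
the extension of `η ↦ ∫ exp (-2 π i η · x) f x dx`. -/
def plancherel {d : ℕ} (f : E d → ℝ) : E d → ℂ :=
  open Classical in
  if h : MemLp (fun x => (f x : ℂ)) 2 (volume : Measure (E d)) then
    (FourierTransform.fourier (h.toLp _) : Lp ℂ 2 (volume : Measure (E d)))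
  else 0

/-- `L²` Fourier transform with the normalisation `f̂(ξ) = ∫ exp (-i ξ · x) f x dx`. -/
def fhat {d : ℕ} (f : E d → ℝ) (ξ : E d) : ℂ :=
  plancherel f ((2 * Real.pi)⁻¹ • ξ)

/-- `‖∇⁻¹ f‖₂ = (∫ (|ξ|⁻¹ |f̂(ξ)|)² dξ)^(1/2)`. If the integral diverges the value is the default
`0`, so a positive lower bound for this quantity entails that the integral is finite. -/
def invGradNorm {d : ℕ} (f : E d → ℝ) : ℝ :=
  Real.sqrt (∫ ξ, (‖ξ‖⁻¹ * ‖fhat f ξ‖) ^ 2)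

/-- The filamentation length `‖∇⁻¹ f‖₂ / ‖f‖₂`. A positive lower bound for it entails that
`‖∇⁻¹ f‖₂` is finite and that `f` is not zero. -/
def filamentationLength {d : ℕ} (f : E d → ℝ) : ℝ :=
  invGradNorm f / l2Norm f

/-- `f` has decay character `r`: `r > -d/2` and the limit of `δ^(-2r-d) ∫_{|ξ| ≤ δ} |f̂|²` as
`δ → 0+` exists in `(0, ∞)`. -/
def HasDecayCharacter {d : ℕ} (f : E d → ℝ) (r : ℝ) : Prop :=
  -(d : ℝ) / 2 < r ∧ ∃ L : ℝ, 0 < L ∧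
    Tendsto (fun δ : ℝ => δ ^ (-2 * r - d) * ∫ ξ in Metric.closedBall 0 δ, ‖fhat f ξ‖ ^ 2)
      (𝓝[>] 0) (𝓝 L)

/-- Quantitative form of the decay character. Every `f` in `L²` with decay character `r` satisfies
this for some positive `c₁`, `c₂`, `δ₀`; it serves to express how constants depend on `f`. -/
def LowFreqBounds {d : ℕ} (f : E d → ℝ) (r c₁ c₂ δ₀ : ℝ) : Prop :=
  ∀ δ : ℝ, 0 < δ → δ ≤ δ₀ →
    c₁ * δ ^ (2 * r + d) ≤ ∫ ξ in Metric.closedBall 0 δ, ‖fhat f ξ‖ ^ 2 ∧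
    ∫ ξ in Metric.closedBall 0 δ, ‖fhat f ξ‖ ^ 2 ≤ c₂ * δ ^ (2 * r + d)

/-- `g(t) ∼ (1 + t)^(-a)` for `t > 0`, with comparability constant `K`. -/
def SimPow (K : ℝ) (g : ℝ → ℝ) (a : ℝ) : Prop :=
  ∀ t : ℝ, 0 < t → K⁻¹ * (1 + t) ^ (-a) ≤ g t ∧ g t ≤ K * (1 + t) ^ (-a)

/-- A time dependent divergence-free vector field `u` on `ℝ^d × (0, ∞)`, with `u(t) ∈ L²` and
spatial (weak) gradient `Du(t) ∈ L^∞`. -/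
structure IsVelocityField {d : ℕ} (u : ℝ → E d → E d) (Du : ℝ → E d → (E d →L[ℝ] E d)) :
    Prop where
  aestronglyMeasurable : AEStronglyMeasurable (Function.uncurry u)
    ((volume.restrict (Set.Ioi (0 : ℝ))).prod volume)
  memLp : ∀ t : ℝ, 0 < t → MemLp (u t) 2 volume
  divFree : ∀ t : ℝ, 0 < t → IsDivFree (u t)
  hasWeakDeriv : ∀ t : ℝ, 0 < t → HasWeakDeriv (u t) (Du t)
  memLp_deriv : ∀ t : ℝ, 0 < t → MemLp (Du t) ⊤ volume

/-- `θ` is a weak solution of `∂ₜθ + u · ∇θ - κ Δθ = 0` on `ℝ^d × (0, ∞)` with `θ(0) = θ₀`, in the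
energy class `C([0, ∞); L²) ∩ L²_loc([0, ∞); H¹)`. The drift is written in divergence form,
`u · ∇θ = ∇ · (u θ)`, so this notion is used for divergence-free `u`. -/
structure IsSolution {d : ℕ} (κ : ℝ) (u : ℝ → E d → E d) (θ₀ : E d → ℝ) (θ : ℝ → E d → ℝ) :
    Prop where
  aestronglyMeasurable : AEStronglyMeasurable (Function.uncurry θ)
    ((volume.restrict (Set.Ioi (0 : ℝ))).prod volume)
  memLp : ∀ t : ℝ, 0 ≤ t → MemLp (θ t) 2 volume
  continuous : ∀ s : ℝ, 0 ≤ s →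
    Tendsto (fun t => eLpNorm (θ t - θ s) 2 volume) (𝓝[Set.Ici 0] s) (𝓝 0)
  gradient : ∃ G : ℝ → E d → (E d →L[ℝ] ℝ),
    (∀ᵐ t ∂(volume.restrict (Set.Ioi (0 : ℝ))), HasWeakDeriv (θ t) (G t)) ∧
    ∀ T : ℝ, 0 < T →
      MemLp (Function.uncurry G) 2 ((volume.restrict (Set.Ioc (0 : ℝ) T)).prod volume)
  equation : ∀ ψ : E d → ℝ, ContDiff ℝ (⊤ : ℕ∞) ψ → HasCompactSupport ψ → ∀ t : ℝ, 0 ≤ t →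
    ∫ x, θ t x * ψ x = (∫ x, θ₀ x * ψ x) +
      ∫ s in (0 : ℝ)..t, ∫ x, θ s x * (fderiv ℝ ψ x (u s x) + κ * Laplacian.laplacian ψ x)

/-- The condition that the time `t` is sufficiently large. -/
def LargeTime (d : ℕ) (r α m κ t : ℝ) : Prop :=
  (3 / 2 - r / 2 ≤ α ∧ (1 + t) ^ (r - 1) ≤ κ ^ (m + 1 / 2 - (d : ℝ) / 4 - r)) ∨
  (r / 2 + 1 / 2 < α ∧ α ≤ 3 / 2 - r / 2 ∧
    (1 + t) ^ (r / 2 - α + 1 / 2) ≤ κ ^ (m + 1 / 2 - (d : ℝ) / 4 - r))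

/-- The function `f` in the lower bound for the filamentation length. -/
def factor (d : ℕ) (r m κ ν t : ℝ) : ℝ :=
  κ ^ ((d : ℝ) / 4 + r / 2 - m - 1 / 2) *
    (if 1 < ν then Real.exp (((1 + t) ^ (-ν + 1) - 1) / (-ν + 1))
     else if ν = 1 then 1
     else Real.exp (((1 + t) ^ (-ν + 1) - 1) / (-ν + 1)) * (1 + t)⁻¹)

end AdvDiff

end

/-! ### The time factor in `factor` and the asymptotics of the bound. -/

noncomputable section
namespace AdvDiff

/-! Write β = r + d/2 > 1. The estimate behind the theorem is λ(t) ≥ c κ^(d/4 + 1/2) (1 + t)^(1/2).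
The stated bound follows because the time factor in `factor` is at least 1 and, as m ≥ d/2 + r/2 and
κ ≤ κ₁, the inverse of its κ power is at most a constant times κ^(d/4 + 1/2) (`inv_factor_le`).

The estimate compares low frequencies with the whole energy. If P_ρ restricts to |ξ| ≤ ρ, then ‖P_ρ
θ‖ ≤ ρ ‖∇⁻¹θ‖ (`norm_cutLp_le_mul_invGradNorm`, which also needs finiteness of the right side). With
ρ = ε (1 + t)^(-1/2) it suffices that ‖P_ρ θ(t)‖ ≥ c (1 + t)^(-β/2) (`IsFlow.le_norm_cutLp`) and
that ‖θ(t)‖ ≤ C κ^(-(d/4 + 1/2)) (1 + t)^(-β/2) (`IsFlow.l2Norm_le_rpow`).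

Both rest on one low frequency estimate. The Fourier transform of u · ∇θ is at most a constant times
|ξ| ‖u‖₂ ‖θ‖₂, so on a ball of radius ρ its L² norm is O(ρ^(d/2 + 1) (1 + t)^(-a)). Here a = (1 +
r)/2 < 1 is a decay rate of u, weaker than α. Integrated in time this is ρ^(d/2 + 1) (1 + t)^((1 -
r)/2), which for ρ of order (1 + t)^(-1/2) has exactly the order (1 + t)^(-β/2) of the initial low
frequencies, with an extra factor ε^(1 - r) if ρ = ε (1 + t)^(-1/2). Small ε makes the low
frequencies persist. For the upper bound, Fourier splitting at ρ² = g/(1 + t) turns dissipation into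
decay.

The weak solution cannot be tested with itself. It is tested with its truncation P_R θ, frozen at
one time. As u is divergence-free, the drift then sees only θ - P_R θ. Since u is bounded, half of
the dissipation absorbs this term up to (U²/κ) ‖θ - P_R θ‖², which vanishes as R → ∞
(`IsFlow.norm_sq_le_of_barrier`). The bound U does not enter the final constants. Since u has no
continuity in time, differential inequalities are stated for upper right slopes and integrated by
comparison with barriers. -/

/-- The time dependent part of `factor`. -/
def timeFactor (ν t : ℝ) : ℝ :=
  if 1 < ν then Real.exp (((1 + t) ^ (-ν + 1) - 1) / (-ν + 1))
  else if ν = 1 then 1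
  else Real.exp (((1 + t) ^ (-ν + 1) - 1) / (-ν + 1)) * (1 + t)⁻¹

lemma factor_eq (d : ℕ) (r m κ ν t : ℝ) :
    factor d r m κ ν t = κ ^ ((d : ℝ) / 4 + r / 2 - m - 1 / 2) * timeFactor ν t := rfl

/-- For ν > 1 the exponent is a quotient of nonpositive numbers. For ν < 1, with p = 1 - ν, the
inequality e^y ≥ 1 + y at y = p log(1 + t) gives ((1 + t)^p - 1)/p ≥ log(1 + t). -/
lemma one_le_timeFactor (ν : ℝ) {t : ℝ} (ht : 0 < t) : 1 ≤ timeFactor ν t := by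
  unfold timeFactor
  split_ifs with h1 h2
  · apply Real.one_le_exp
    apply div_nonneg_of_nonpos
    · have : (1 + t) ^ (-ν + 1) ≤ 1 :=
        Real.rpow_le_one_of_one_le_of_nonpos (by linarith) (by linarith)
      linarith
    · linarith
  · exact le_rfl
  · have hν : 0 < -ν + 1 := by
      have : ν < 1 := lt_of_le_of_ne (not_lt.1 h1) h2
      linarith
    have h1t : 0 < 1 + t := by linarith
    rw [← div_eq_mul_inv, one_le_div h1t]
    rw [← Real.log_le_iff_le_exp h1t, le_div_iff₀ hν]
    have := Real.add_one_le_exp (Real.log (1 + t) * (-ν + 1))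
    rw [Real.rpow_def_of_pos h1t]
    linarith

lemma timeFactor_le {ν : ℝ} (hν : 1 ≤ ν) :
    ∃ b : ℝ, 0 < b ∧ ∀ t : ℝ, 0 < t → timeFactor ν t ≤ b := by
  unfold timeFactor
  rcases hν.lt_or_eq with h | h
  · refine ⟨Real.exp (1 / (ν - 1)), Real.exp_pos _, fun t ht => ?_⟩
    rw [if_pos h]
    apply Real.exp_le_exp.2
    have : 0 < (1 + t) ^ (-ν + 1) := Real.rpow_pos_of_pos (by linarith) _
    have e : ((1 + t) ^ (-ν + 1) - 1) / (-ν + 1) = (1 - (1 + t) ^ (-ν + 1)) / (ν - 1) := by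
      rw [← neg_div_neg_eq]
      ring
    rw [e]
    exact div_le_div_of_nonneg_right (by linarith) (by linarith)
  · exact ⟨1, one_pos, fun t _ => by rw [if_neg (by linarith), if_pos h.symm]⟩

lemma tendsto_one_add_rpow {a : ℝ} (ha : 0 < a) :
    Tendsto (fun t : ℝ => (1 + t) ^ a) atTop atTop :=
  (tendsto_rpow_atTop ha).comp (tendsto_atTop_add_const_left _ _ tendsto_id)

lemma tendsto_bound_atTop (d : ℕ) (r m κ ν : ℝ) (hκ : 0 < κ) (hν : 1 ≤ ν) :
    Tendsto (fun t : ℝ => (1 + t) ^ (1 / 2 : ℝ) * (factor d r m κ ν t)⁻¹) atTop atTop := by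
  obtain ⟨b, hb, hle⟩ := timeFactor_le hν
  set q := κ ^ ((d : ℝ) / 4 + r / 2 - m - 1 / 2)
  have hq : 0 < q := Real.rpow_pos_of_pos hκ _
  have hlim : Tendsto (fun t : ℝ => (1 + t) ^ (1 / 2 : ℝ) * (q * b)⁻¹) atTop atTop :=
    (tendsto_one_add_rpow (by norm_num)).atTop_mul_const (by positivity)
  refine tendsto_atTop_mono' _ ?_ hlim
  filter_upwards [eventually_gt_atTop 0] with t ht
  have h1 := one_le_timeFactor ν ht
  have h2 := hle t ht
  rw [factor_eq]
  gcongr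

lemma tendsto_bound_zero (d : ℕ) (r m κ ν : ℝ) (hν : ν < 1) :
    Tendsto (fun t : ℝ => (1 + t) ^ (1 / 2 : ℝ) * (factor d r m κ ν t)⁻¹) atTop (𝓝 0) := by
  set q := κ ^ ((d : ℝ) / 4 + r / 2 - m - 1 / 2)
  have hp : 0 < -ν + 1 := by linarith
  set p := -ν + 1
  have hx : Tendsto (fun t : ℝ => (1 + t) ^ p / p) atTop atTop :=
    (tendsto_one_add_rpow hp).atTop_div_const hp
  -- In the variable x = (1 + t)^p / p the claim is x^s e^(-x) → 0. The exponent 3/2 is the 1/2 of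
  -- the prefactor plus the 1 from inverting (1 + t)⁻¹.
  have h1 := (tendsto_rpow_mul_exp_neg_mul_atTop_nhds_zero ((3 / 2) / p) 1 one_pos).comp hx
  have h2 := h1.const_mul (p ^ ((3 / 2) / p) * Real.exp (1 / p) * q⁻¹)
  rw [mul_zero] at h2
  refine h2.congr' ?_
  filter_upwards [eventually_gt_atTop 0] with t ht
  have h1t : 0 < 1 + t := by linarith
  rw [factor_eq, timeFactor, if_neg (by linarith), if_neg (by linarith)]
  simp only [Function.comp]
  have e1 : ((1 + t) ^ p / p) ^ ((3 / 2) / p) = (1 + t) ^ (3 / 2 : ℝ) / p ^ ((3 / 2) / p) := by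
    rw [Real.div_rpow (by positivity) hp.le, ← Real.rpow_mul h1t.le]
    congr 2
    field_simp
  have e2 : (1 + t) ^ (3 / 2 : ℝ) = (1 + t) ^ (1 / 2 : ℝ) * (1 + t) := by
    rw [← Real.rpow_add_one h1t.ne']
    norm_num
  have e3 : Real.exp (((1 + t) ^ p - 1) / p)
      = Real.exp ((1 + t) ^ p / p) / Real.exp (1 / p) := by
    rw [← Real.exp_sub]
    congr 1
    ring
  have hpp : 0 < p ^ ((3 / 2) / p) := Real.rpow_pos_of_pos hp _
  rw [e1, e2, e3, neg_one_mul, Real.exp_neg]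
  change _ = _ * (q * _)⁻¹
  -- Without a sign condition on κ the real power may vanish; both sides are then 0.
  by_cases hq : q = 0
  · simp [hq]
  field_simp

end AdvDiff
end

/-! ### Weak derivatives: Lipschitz representatives and boundedness of the velocity. -/

noncomputable section
namespace AdvDiff
open scoped Convolution ContDiff

variable {d : ℕ} {F : Type*} [NormedAddCommGroup F]

/-- Differentiation falls on the mollifier, and y ↦ φ(x - y) is an admissible test function in the
definition of the weak derivative. The two sign changes cancel. -/
lemma HasWeakDeriv.hasFDerivAt_convolution [NormedSpace ℝ F] [CompleteSpace F] {f : E d → F}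
    {f' : E d → (E d →L[ℝ] F)} (h : HasWeakDeriv f f') {φ : E d → ℝ} (hφ : ContDiff ℝ ∞ φ)
    (hc : HasCompactSupport φ) (x v : E d) :
    ∃ D : E d →L[ℝ] F, HasFDerivAt (fun x => ∫ y, φ (x - y) • f y) D x ∧
      D v = ∫ y, φ (x - y) • f' y v := by
  have hD := hc.hasFDerivAt_convolution_left (ContinuousLinearMap.lsmul ℝ ℝ)
    (μ := volume) (hφ.of_le (by exact_mod_cast le_top)) h.locallyIntegrable x
  have hfun : (φ ⋆[ContinuousLinearMap.lsmul ℝ ℝ, volume] f)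
      = fun x => ∫ y, φ (x - y) • f y := by
    ext x
    simp [convolution_eq_swap]
  rw [hfun] at hD
  refine ⟨_, hD, ?_⟩
  have hφ1 : ContDiff ℝ 1 φ := hφ.of_le (by exact_mod_cast le_top)
  have hint : Integrable (fun t => (ContinuousLinearMap.precompL (E d)
      (ContinuousLinearMap.lsmul ℝ ℝ (E := F)) (fderiv ℝ φ (x - t))) (f t)) := by
    have := (hc.fderiv ℝ).convolutionExists_left
      (ContinuousLinearMap.precompL (E d) (ContinuousLinearMap.lsmul ℝ ℝ (E := F)))
      (μ := volume) (hφ1.continuous_fderiv one_ne_zero) h.locallyIntegrable x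
    exact this.integrable_swap
  rw [convolution_eq_swap, ContinuousLinearMap.integral_apply hint]
  have hd : ∀ y, fderiv ℝ (fun y => φ (x - y)) y v = - fderiv ℝ φ (x - y) v := by
    intro y
    have h1 : HasFDerivAt (fun y => x - y) (-ContinuousLinearMap.id ℝ (E d)) y :=
      (hasFDerivAt_id y).const_sub x
    have h2 : HasFDerivAt φ (fderiv ℝ φ (x - y)) (x - y) :=
      ((hφ1.differentiable one_ne_zero) _).hasFDerivAt
    have h3 : HasFDerivAt (fun y => φ (x - y)) _ y := h2.comp y h1
    rw [h3.fderiv]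
    simp
  have key := h.integral_eq (fun y => φ (x - y)) (hφ.comp (contDiff_const.sub contDiff_id))
    (hc.comp_homeomorph (Homeomorph.subLeft x)) v
  simp only [hd, neg_smul, integral_neg, neg_inj] at key
  simpa [ContinuousLinearMap.precompL_apply] using key

/-- Mollifications of f have gradient bounded by L, hence are L-Lipschitz by the mean value
inequality. They converge to f almost everywhere, and S is the set of convergence. -/
lemma HasWeakDeriv.norm_sub_le [NormedSpace ℝ F] [CompleteSpace F] {f : E d → F}
    {f' : E d → (E d →L[ℝ] F)} (h : HasWeakDeriv f f') {L : ℝ} (hL : ∀ᵐ x, ‖f' x‖ ≤ L) :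
    ∃ S : Set (E d), (∀ᵐ x, x ∈ S) ∧ ∀ x ∈ S, ∀ y ∈ S, ‖f x - f y‖ ≤ L * ‖x - y‖ := by
  have hL0 : 0 ≤ L := by
    obtain ⟨x, hx⟩ := hL.exists
    exact (norm_nonneg _).trans hx
  let φ : ℕ → ContDiffBump (0 : E d) := fun n =>
    ⟨1 / (n + 1 : ℝ), 2 / (n + 1 : ℝ), by positivity, by gcongr; norm_num⟩
  have hlim := ContDiffBump.ae_convolution_tendsto_right_of_locallyIntegrable
    (μ := (volume : Measure (E d))) (φ := φ) (l := atTop) (K := 2)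
    (by simpa [φ, div_eq_mul_inv] using
      (tendsto_one_div_add_atTop_nhds_zero_nat (𝕜 := ℝ)).const_mul 2)
    (Eventually.of_forall fun n => by simp only [φ]; apply le_of_eq; ring)
    h.locallyIntegrable
  refine ⟨{x | Tendsto (fun i => ((φ i).normed volume ⋆[ContinuousLinearMap.lsmul ℝ ℝ, volume] f) x)
    atTop (𝓝 (f x))}, hlim, fun x hx y hy => ?_⟩
  simp only [Set.mem_ofPred_eq] at hx hy
  refine le_of_tendsto (hx.sub hy).norm (Eventually.of_forall fun n => ?_)
  set η : E d → ℝ := (φ n).normed volume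
  have hη : ContDiff ℝ ∞ η := (φ n).contDiff_normed
  have hηc : HasCompactSupport η := (φ n).hasCompactSupport_normed
  have hη0 : ∀ z, 0 ≤ η z := (φ n).nonneg_normed
  have hη1 : ∫ z, η z = 1 := (φ n).integral_normed
  have hfun : (η ⋆[ContinuousLinearMap.lsmul ℝ ℝ, volume] f)
      = fun x => ∫ y, η (x - y) • f y := by
    ext x
    simp [convolution_eq_swap]
  rw [hfun]
  -- Only differentiability is kept here, so the direction 0 is a dummy. Uniqueness of the
  -- derivative recovers its value in each direction below.
  choose D hD _ using fun x => h.hasFDerivAt_convolution hη hηc x 0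
  have hb : ∀ z, ‖D z‖ ≤ L := by
    intro z
    refine ContinuousLinearMap.opNorm_le_bound _ hL0 fun v => ?_
    obtain ⟨D', hD', hv⟩ := h.hasFDerivAt_convolution hη hηc z v
    rw [(hD z).unique hD', hv]
    have hηi : Integrable (fun y => η (z - y)) :=
      (hη.continuous.integrable_of_hasCompactSupport hηc).comp_sub_left z
    calc ‖∫ y, η (z - y) • f' y v‖ ≤ ∫ y, η (z - y) * (L * ‖v‖) := by
          refine norm_integral_le_of_norm_le (hηi.mul_const _) ?_
          filter_upwards [hL] with y hy
          rw [norm_smul, Real.norm_of_nonneg (hη0 _)]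
          gcongr
          · exact hη0 _
          · exact (f' y).le_of_opNorm_le hy v
      _ = L * ‖v‖ := by
          rw [integral_mul_const, integral_sub_left_eq_self η volume z, hη1, one_mul]
  have := Convex.norm_image_sub_le_of_norm_hasFDerivWithin_le (s := Set.univ) (C := L)
    (fun z _ => (hD z).hasFDerivWithinAt) (fun z _ => hb z) convex_univ (Set.mem_univ y)
    (Set.mem_univ x)
  exact this

lemma sq_l2Norm {f : E d → F} (hf : MemLp f 2) : l2Norm f ^ 2 = ∫ x, ‖f x‖ ^ 2 := by
  have h := hf.eLpNorm_eq_integral_rpow_norm (by norm_num) (by norm_num)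
  have h0 : 0 ≤ ∫ x, ‖f x‖ ^ 2 := integral_nonneg fun _ => by positivity
  simp only [ENNReal.toReal_ofNat, Real.rpow_ofNat] at h
  rw [l2Norm, h, ENNReal.toReal_ofReal (by positivity), ← Real.rpow_natCast, ← Real.rpow_mul h0]
  norm_num

lemma l2Norm_nonneg (f : E d → F) : 0 ≤ l2Norm f := ENNReal.toReal_nonneg

lemma ae_norm_le_lInfNorm {f : E d → F} (hf : MemLp f ⊤) : ∀ᵐ x, ‖f x‖ ≤ lInfNorm f := by
  filter_upwards [ae_le_eLpNormEssSup (f := f) (μ := volume)] with x hx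
  rw [← eLpNorm_exponent_top] at hx
  have := ENNReal.toReal_mono hf.2.ne hx
  simpa [lInfNorm] using this

/-- A square integrable function with bounded weak gradient is bounded. -/
lemma HasWeakDeriv.ae_norm_le [NormedSpace ℝ F] [CompleteSpace F]
    {f : E d → F} {f' : E d → (E d →L[ℝ] F)}
    (h : HasWeakDeriv f f') (hf : MemLp f 2) (hf' : MemLp f' ⊤) {K : ℝ}
    (h2 : l2Norm f ≤ K) (hi : lInfNorm f' ≤ K) :
    ∀ᵐ x, ‖f x‖ ≤ √(2 * K ^ 2 / volume.real (Metric.ball (0 : E d) 1) + 2 * K ^ 2) := by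
  have hK : 0 ≤ K := (l2Norm_nonneg f).trans h2
  obtain ⟨S, hS, hSL⟩ := h.norm_sub_le
    ((ae_norm_le_lInfNorm hf').mono fun x hx => hx.trans hi)
  have hV : 0 < volume.real (Metric.ball (0 : E d) 1) :=
    ENNReal.toReal_pos (Metric.measure_ball_pos _ _ one_pos).ne' measure_ball_lt_top.ne
  filter_upwards [hS] with x hx
  apply Real.le_sqrt_of_sq_le
  have hsq : Integrable (fun y => ‖f y‖ ^ 2) := hf.integrable_norm_pow (by norm_num)
  have hVx : volume.real (Metric.ball x 1) = volume.real (Metric.ball (0 : E d) 1) := by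
    simp only [measureReal_def]
    rw [Measure.addHaar_ball_center]
  have hc : ∀ c : ℝ, ∫ _ in Metric.ball x 1, c = volume.real (Metric.ball (0 : E d) 1) * c := by
    intro c
    rw [setIntegral_const, hVx, smul_eq_mul]
  -- On the unit ball around x one has ‖f x‖ ≤ ‖f y‖ + K, hence ‖f x‖² ≤ 2‖f y‖² + 2K². Integrating
  -- in y over this ball bounds ‖f x‖ by the L² norm.
  have key : ∫ y in Metric.ball x 1, ‖f x‖ ^ 2
      ≤ ∫ y in Metric.ball x 1, (2 * ‖f y‖ ^ 2 + 2 * K ^ 2) := by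
    refine setIntegral_mono_on_ae (integrableOn_const measure_ball_lt_top.ne)
      ((hsq.const_mul 2).integrableOn.add (integrableOn_const measure_ball_lt_top.ne))
      measurableSet_ball ?_
    filter_upwards [hS] with y hy hyx
    have h1 : ‖f x - f y‖ ≤ K := by
      refine (hSL x hx y hy).trans ?_
      have : ‖x - y‖ ≤ 1 := by
        rw [← dist_eq_norm, dist_comm]
        exact (Metric.mem_ball.1 hyx).le
      nlinarith
    have h3 : ‖f x‖ ≤ ‖f y‖ + K := by
      have := norm_sub_norm_le (f x) (f y)
      linarith
    nlinarith [norm_nonneg (f x), norm_nonneg (f y), sq_nonneg (‖f y‖ - K)]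
  rw [hc, integral_add (hsq.const_mul 2).integrableOn
    (integrableOn_const measure_ball_lt_top.ne), hc, integral_const_mul] at key
  have h4 : ∫ y in Metric.ball x 1, ‖f y‖ ^ 2 ≤ K ^ 2 := by
    refine (setIntegral_le_integral hsq (Eventually.of_forall fun _ => by positivity)).trans ?_
    rw [← sq_l2Norm hf]
    exact pow_le_pow_left₀ (l2Norm_nonneg f) h2 2
  have h5 : ‖f x‖ ^ 2 * volume.real (Metric.ball (0 : E d) 1)
      ≤ 2 * K ^ 2 + 2 * K ^ 2 * volume.real (Metric.ball (0 : E d) 1) := by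
    linarith
  rw [← sub_le_iff_le_add, le_div_iff₀ hV]
  linarith

end AdvDiff
end

/-! ### Product rule for the Laplacian, cutoffs, and divergence-free fields. -/

noncomputable section
namespace AdvDiff
open scoped ContDiff
open Laplacian

variable {d : ℕ}

lemma laplacian_eq_sum_fderiv {F : Type*} [NormedAddCommGroup F] [NormedSpace ℝ F] {f : E d → F}
    (hf : ContDiff ℝ 2 f) (x : E d) :
    Δ f x = ∑ i, fderiv ℝ (fun y => fderiv ℝ f y (EuclideanSpace.basisFun (Fin d) ℝ i)) x
      (EuclideanSpace.basisFun (Fin d) ℝ i) := by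
  rw [InnerProductSpace.laplacian_eq_iteratedFDeriv_orthonormalBasis f
    (EuclideanSpace.basisFun (Fin d) ℝ)]
  refine Finset.sum_congr rfl fun i _ => ?_
  have h1 : DifferentiableAt ℝ (fderiv ℝ f) x :=
    (hf.fderiv_right (m := 1) (by norm_num)).differentiable one_ne_zero x
  rw [iteratedFDeriv_two_apply, fderiv_clm_apply h1 (differentiableAt_const _)]
  simp

lemma continuous_laplacian {F : Type*} [NormedAddCommGroup F] [NormedSpace ℝ F] {f : E d → F}
    (hf : ContDiff ℝ 2 f) : Continuous (Δ f) := by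
  rw [InnerProductSpace.laplacian_eq_iteratedFDeriv_orthonormalBasis f
    (EuclideanSpace.basisFun (Fin d) ℝ)]
  have h : Continuous (iteratedFDeriv ℝ 2 f) := hf.continuous_iteratedFDeriv le_rfl
  fun_prop

lemma laplacian_mul {f g : E d → ℝ} (hf : ContDiff ℝ 2 f) (hg : ContDiff ℝ 2 g) (x : E d) :
    Δ (fun y => f y * g y) x = f x * Δ g x + g x * Δ f x
      + 2 * ∑ i, fderiv ℝ f x (EuclideanSpace.basisFun (Fin d) ℝ i)
        * fderiv ℝ g x (EuclideanSpace.basisFun (Fin d) ℝ i) := by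
  have hfd := hf.differentiable two_ne_zero
  have hgd := hg.differentiable two_ne_zero
  have hf1 : ∀ v, Differentiable ℝ (fun y => fderiv ℝ f y v) := fun v =>
    ((hf.fderiv_right (m := 1) (by norm_num)).differentiable one_ne_zero).clm_apply
      (differentiable_const v)
  have hg1 : ∀ v, Differentiable ℝ (fun y => fderiv ℝ g y v) := fun v =>
    ((hg.fderiv_right (m := 1) (by norm_num)).differentiable one_ne_zero).clm_apply
      (differentiable_const v)
  rw [laplacian_eq_sum_fderiv (hf.mul hg), laplacian_eq_sum_fderiv hf, laplacian_eq_sum_fderiv hg,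
    Finset.mul_sum, Finset.mul_sum, Finset.mul_sum, ← Finset.sum_add_distrib,
    ← Finset.sum_add_distrib]
  refine Finset.sum_congr rfl fun i _ => ?_
  set v := EuclideanSpace.basisFun (Fin d) ℝ i
  have h1 : (fun y => fderiv ℝ (fun y => f y * g y) y v)
      = fun y => f y * fderiv ℝ g y v + g y * fderiv ℝ f y v := by
    ext y
    rw [fderiv_fun_mul (hfd y) (hgd y)]
    simp
  rw [h1, fderiv_fun_add ((hfd x).fun_mul (hg1 v x)) ((hgd x).fun_mul (hf1 v x)),
    fderiv_fun_mul (hfd x) (hg1 v x), fderiv_fun_mul (hgd x) (hf1 v x)]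
  simp
  ring

lemma fderiv_comp_smul_apply {F : Type*} [NormedAddCommGroup F] [NormedSpace ℝ F] {f : E d → F}
    (hf : Differentiable ℝ f) (c : ℝ) (x v : E d) :
    fderiv ℝ (fun y => f (c • y)) x v = c • fderiv ℝ f (c • x) v := by
  have h : HasFDerivAt (fun y => f (c • y)) _ x :=
    ((hf (c • x)).hasFDerivAt).comp x ((hasFDerivAt_id x).const_smul c)
  rw [h.fderiv]
  simp

/-- A sequence of smooth cutoff functions exhausting the space. -/
lemma exists_cutoff (d : ℕ) : ∃ (χ : ℕ → E d → ℝ) (C : ℝ), 0 ≤ C ∧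
    (∀ n, ContDiff ℝ ∞ (χ n)) ∧ (∀ n, HasCompactSupport (χ n)) ∧ (∀ n x, |χ n x| ≤ 1) ∧
    (∀ n x, ‖fderiv ℝ (χ n) x‖ ≤ C / (n + 1)) ∧ (∀ n x, |Δ (χ n) x| ≤ C / (n + 1)) ∧
    ∀ x, Tendsto (fun n => χ n x) atTop (𝓝 1) := by
  let b : ContDiffBump (0 : E d) := ⟨1, 2, one_pos, one_lt_two⟩
  have hb : ContDiff ℝ ∞ b := b.contDiff
  have hb1 : ContDiff ℝ 1 b := hb.of_le (by exact_mod_cast le_top)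
  have hb2 : ContDiff ℝ 2 b := mod_cast contDiff_infty.1 hb 2
  obtain ⟨C₁, hC₁⟩ := (hb1.continuous_fderiv one_ne_zero).bounded_above_of_compact_support
    (b.hasCompactSupport.fderiv ℝ)
  have hbL : HasCompactSupport (Δ (b : E d → ℝ)) := by
    refine HasCompactSupport.intro b.hasCompactSupport.isCompact fun x hx => ?_
    rw [InnerProductSpace.laplacian_eq_iteratedFDeriv_orthonormalBasis _
      (EuclideanSpace.basisFun (Fin d) ℝ)]
    have : iteratedFDeriv ℝ 2 b x = 0 := by
      by_contra h
      exact hx (support_iteratedFDeriv_subset (𝕜 := ℝ) 2 (Function.mem_support.2 h))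
    simp [this]
  obtain ⟨C₂, hC₂⟩ := (continuous_laplacian hb2).bounded_above_of_compact_support hbL
  have h1 : 0 ≤ C₁ := (norm_nonneg _).trans (hC₁ 0)
  have h2 : 0 ≤ C₂ := (norm_nonneg _).trans (hC₂ 0)
  refine ⟨fun n x => b ((1 / (n + 1 : ℝ)) • x), C₁ + C₂, by positivity,
    fun n => hb.comp (contDiff_const_smul _), fun n => ?_, fun n x => ?_, fun n x => ?_,
    fun n x => ?_, fun x => ?_⟩
  · exact b.hasCompactSupport.comp_smul (by positivity)
  · rw [abs_of_nonneg b.nonneg]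
    exact b.le_one
  · refine ContinuousLinearMap.opNorm_le_bound _ (by positivity) fun v => ?_
    rw [fderiv_comp_smul_apply (hb1.differentiable one_ne_zero), norm_smul, Real.norm_of_nonneg
      (by positivity), div_mul_eq_mul_div, div_mul_eq_mul_div, one_mul]
    gcongr
    refine (ContinuousLinearMap.le_of_opNorm_le _ (hC₁ _) v).trans ?_
    gcongr
    linarith
  · have hn : (1 : ℝ) ≤ n + 1 := by linarith [Nat.cast_nonneg (α := ℝ) n]
    have e : Δ (fun x => b ((1 / (n + 1 : ℝ)) • x)) x
        = (1 / (n + 1 : ℝ)) ^ 2 * Δ (b : E d → ℝ) ((1 / (n + 1 : ℝ)) • x) := by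
      rw [laplacian_eq_sum_fderiv (f := fun x => b ((1 / (n + 1 : ℝ)) • x))
        (hb2.comp (contDiff_const_smul _)),
        laplacian_eq_sum_fderiv hb2, Finset.mul_sum]
      refine Finset.sum_congr rfl fun i _ => ?_
      simp_rw [fderiv_comp_smul_apply (hb1.differentiable one_ne_zero)]
      have hd : Differentiable ℝ (fun y => fderiv ℝ b y (EuclideanSpace.basisFun (Fin d) ℝ i)) :=
        ((hb2.fderiv_right (m := 1) (by norm_num)).differentiable one_ne_zero).clm_apply
          (differentiable_const _)
      have hd' : DifferentiableAt ℝ (fun y => fderiv ℝ b ((1 / (n + 1 : ℝ)) • y)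
          (EuclideanSpace.basisFun (Fin d) ℝ i)) x :=
        (hd _).comp x ((contDiff_const_smul (n := 1) _).differentiable one_ne_zero x)
      rw [fderiv_fun_const_smul hd', smul_apply,
        fderiv_comp_smul_apply (f := fun y => fderiv ℝ b y (EuclideanSpace.basisFun (Fin d) ℝ i))
          hd]
      simp only [smul_eq_mul]
      ring
    rw [e, abs_mul, abs_of_nonneg (by positivity), one_div, inv_pow, inv_mul_eq_div]
    gcongr
    · exact (hC₂ _).trans (by linarith)
    · nlinarith
  · have h0 : Tendsto (fun n : ℕ => (1 / (n + 1 : ℝ)) • x) atTop (𝓝 ((0 : ℝ) • x)) :=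
      tendsto_one_div_add_atTop_nhds_zero_nat.smul_const x
    rw [zero_smul] at h0
    have h3 := (hb.continuous.tendsto 0).comp h0
    have hb0 : b 0 = 1 := b.one_of_mem_closedBall (by simp [b])
    rwa [hb0] at h3

/-- The divergence-free condition tested with integrable smooth functions that need not have
compact support. -/
lemma IsDivFree.integral_fderiv_eq_zero {w : E d → E d} (hw : IsDivFree w)
    (hwm : AEStronglyMeasurable w) {U : ℝ}
    (hU : ∀ᵐ x, ‖w x‖ ≤ U) {g : E d → ℝ} (hg : ContDiff ℝ ∞ g) (hgi : Integrable g)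
    (hgw : Integrable (fun x => fderiv ℝ g x (w x))) :
    ∫ x, fderiv ℝ g x (w x) = 0 := by
  obtain ⟨χ, C, hC, hχ, hχc, hχ1, hχd, -, hχt⟩ := exists_cutoff d
  have hgd : Differentiable ℝ g := hg.differentiable (by simp)
  have hχdiff : ∀ n, Differentiable ℝ (χ n) := fun n => (hχ n).differentiable (by simp)
  have hpt : ∀ n x v, fderiv ℝ (fun y => χ n y * g y) x v
      = χ n x * fderiv ℝ g x v + g x * fderiv ℝ (χ n) x v := by
    intro n x v
    rw [fderiv_fun_mul (hχdiff n x) (hgd x)]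
    simp
  have hzero : ∀ n, ∫ x, fderiv ℝ (fun y => χ n y * g y) x (w x) = 0 := fun n =>
    hw _ ((hχ n).mul hg) ((hχc n).mul_right)
  -- The commutator term g ∇χ_n · w is at most C U |g| and tends to 0 pointwise, so dominated
  -- convergence removes the cutoff.
  have hlim : Tendsto (fun n => ∫ x, fderiv ℝ (fun y => χ n y * g y) x (w x)) atTop
      (𝓝 (∫ x, fderiv ℝ g x (w x))) := by
    refine tendsto_integral_of_dominated_convergence
      (fun x => ‖fderiv ℝ g x (w x)‖ + ‖g x‖ * (C * U)) ?_ (hgw.norm.add (hgi.norm.mul_const _))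
      ?_ ?_
    · intro n
      have hc : Continuous (fderiv ℝ (fun y => χ n y * g y)) :=
        ((hχ n).mul hg).continuous_fderiv (by simp)
      exact (isBoundedBilinearMap_apply.continuous).comp_aestronglyMeasurable
        (hc.aestronglyMeasurable.prodMk hwm)
    · intro n
      filter_upwards [hU] with x hx
      rw [hpt]
      refine (norm_add_le _ _).trans ?_
      rw [norm_mul, norm_mul]
      gcongr
      · exact mul_le_of_le_one_left (norm_nonneg _) (hχ1 n x)
      · refine (ContinuousLinearMap.le_of_opNorm_le _ (hχd n x) _).trans ?_
        gcongr
        exact div_le_self hC (by linarith [Nat.cast_nonneg (α := ℝ) n])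
    · refine Eventually.of_forall fun x => ?_
      simp_rw [hpt]
      have h1 := (hχt x).mul_const (fderiv ℝ g x (w x))
      have h2 : Tendsto (fun n => fderiv ℝ (χ n) x (w x)) atTop (𝓝 0) := by
        have h0 : Tendsto (fun n : ℕ => C * (1 / (n + 1 : ℝ)) * ‖w x‖) atTop (𝓝 0) := by
          simpa using ((tendsto_one_div_add_atTop_nhds_zero_nat (𝕜 := ℝ)).const_mul C).mul_const
            ‖w x‖
        refine squeeze_zero_norm (fun n => ?_) h0
        rw [mul_one_div]
        exact ContinuousLinearMap.le_of_opNorm_le _ (hχd n x) _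
      simpa using h1.add (h2.const_mul (g x))
  simp only [hzero] at hlim
  exact (tendsto_nhds_unique hlim tendsto_const_nhds)

end AdvDiff
end

/-! ### Extending the weak formulation to test functions without compact support. -/

noncomputable section
namespace AdvDiff
open scoped ContDiff
open Laplacian

variable {d : ℕ}

lemma integral_norm_mul_norm_le {F G : Type*} [NormedAddCommGroup F] [NormedAddCommGroup G]
    {f : E d → F} {g : E d → G} (hf : MemLp f 2) (hg : MemLp g 2) :
    ∫ x, ‖f x‖ * ‖g x‖ ≤ l2Norm f * l2Norm g := by
  have h := integral_mul_norm_le_Lp_mul_Lq (μ := (volume : Measure (E d)))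
    (p := 2) (q := 2) Real.HolderConjugate.two_two (f := fun x => ‖f x‖) (g := fun x => ‖g x‖)
    (by simpa using hf.norm) (by simpa using hg.norm)
  simpa only [norm_norm, Real.rpow_ofNat, ← sq_l2Norm hf, ← sq_l2Norm hg, ← Real.sqrt_eq_rpow,
    Real.sqrt_sq (l2Norm_nonneg _)] using h

lemma integrable_norm_mul_norm {F G : Type*} [NormedAddCommGroup F] [NormedAddCommGroup G]
    {f : E d → F} {g : E d → G} (hf : MemLp f 2) (hg : MemLp g 2) :
    Integrable (fun x => ‖f x‖ * ‖g x‖) :=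
  hf.norm.integrable_mul hg.norm

/-- Smooth functions which may be used to test the weak formulation against
square integrable functions. -/
structure IsTestFun (ψ : E d → ℝ) : Prop where
  contDiff : ContDiff ℝ ∞ ψ
  bounded : ∃ B, ∀ x, ‖ψ x‖ ≤ B
  bounded_fderiv : ∃ D, ∀ x, ‖fderiv ℝ ψ x‖ ≤ D
  memLp : MemLp ψ 2
  memLp_fderiv : MemLp (fderiv ℝ ψ) 2
  memLp_laplacian : MemLp (Δ ψ) 2

/-- The weak form of `∂ₜθ = -∇ · (uθ) + κ Δ θ` at a fixed time. -/
def weakForm (κ : ℝ) (w : E d → E d) (f ψ : E d → ℝ) : ℝ :=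
  ∫ x, f x * (fderiv ℝ ψ x (w x) + κ * Δ ψ x)

/-- Cutting off a test function approximates the weak form, with a bound that depends on `w` and
`f` only through their norms. -/
lemma IsTestFun.exists_approx {ψ : E d → ℝ} (hψ : IsTestFun ψ) (κ : ℝ) :
    ∃ (φ : ℕ → E d → ℝ) (C : ℝ), (∀ n, ContDiff ℝ ∞ (φ n)) ∧ (∀ n, HasCompactSupport (φ n)) ∧
      (∀ f : E d → ℝ, MemLp f 2 →
        Tendsto (fun n => ∫ x, f x * φ n x) atTop (𝓝 (∫ x, f x * ψ x))) ∧
      ∀ f : E d → ℝ, MemLp f 2 → ∀ w : E d → E d, MemLp w 2 →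
        (∀ n, |weakForm κ w f (φ n)| ≤ C * l2Norm f * (l2Norm w + 1)) ∧
        |weakForm κ w f ψ| ≤ C * l2Norm f * (l2Norm w + 1) ∧
        Tendsto (fun n => weakForm κ w f (φ n)) atTop (𝓝 (weakForm κ w f ψ)) := by
  obtain ⟨χ, C, hC, hχ, hχc, hχ1, hχd, hχL, hχt⟩ := exists_cutoff d
  obtain ⟨B, hB⟩ := hψ.bounded
  obtain ⟨D, hD⟩ := hψ.bounded_fderiv
  have hB0 : 0 ≤ B := (norm_nonneg _).trans (hB 0)
  have hD0 : 0 ≤ D := (norm_nonneg _).trans (hD 0)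
  have hψ2 : ContDiff ℝ 2 ψ := mod_cast contDiff_infty.1 hψ.contDiff 2
  have hχ2 : ∀ n, ContDiff ℝ 2 (χ n) := fun n => mod_cast contDiff_infty.1 (hχ n) 2
  have hψd : Differentiable ℝ ψ := hψ.contDiff.differentiable (by simp)
  have hχdiff : ∀ n, Differentiable ℝ (χ n) := fun n => (hχ n).differentiable (by simp)
  -- By the product rule q dominates |Δ(χ_n ψ)| for all n at once, and it is square integrable.
  set q : E d → ℝ := fun x => ‖Δ ψ x‖ + ‖ψ x‖ * C + 2 * (d * (C * ‖fderiv ℝ ψ x‖)) with hq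
  have hq2 : MemLp q 2 :=
    (hψ.memLp_laplacian.norm.add (hψ.memLp.norm.mul_const C)).add
      (((hψ.memLp_fderiv.norm.const_mul C).const_mul d).const_mul 2)
  have hq0 : ∀ x, 0 ≤ q x := fun x => by positivity
  have hpt : ∀ n x v, fderiv ℝ (fun y => χ n y * ψ y) x v
      = χ n x * fderiv ℝ ψ x v + ψ x * fderiv ℝ (χ n) x v := by
    intro n x v
    rw [fderiv_fun_mul (hχdiff n x) (hψd x)]
    simp
  have hn1 : ∀ n : ℕ, C / (n + 1 : ℝ) ≤ C := fun n =>
    div_le_self hC (by linarith [Nat.cast_nonneg (α := ℝ) n])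
  have hb1 : ∀ n x v, ‖fderiv ℝ (fun y => χ n y * ψ y) x v‖ ≤ (D + B * C) * ‖v‖ := by
    intro n x v
    rw [hpt, add_mul, mul_assoc]
    refine (norm_add_le _ _).trans ?_
    rw [norm_mul, norm_mul]
    refine add_le_add ?_ (mul_le_mul (hB x) ?_ (norm_nonneg _) hB0)
    · exact (mul_le_of_le_one_left (norm_nonneg _) (hχ1 n x)).trans
        (ContinuousLinearMap.le_of_opNorm_le _ (hD x) v)
    · exact ContinuousLinearMap.le_of_opNorm_le _ ((hχd n x).trans (hn1 n)) v
  have he : ∀ i, ‖EuclideanSpace.basisFun (Fin d) ℝ i‖ = 1 := fun i => by simp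
  have hs : ∀ n x, |∑ i, fderiv ℝ (χ n) x (EuclideanSpace.basisFun (Fin d) ℝ i)
      * fderiv ℝ ψ x (EuclideanSpace.basisFun (Fin d) ℝ i)|
      ≤ d * (C / (n + 1) * ‖fderiv ℝ ψ x‖) := by
    intro n x
    refine (Finset.abs_sum_le_sum_abs _ _).trans ?_
    refine (Finset.sum_le_card_nsmul _ _ (C / (n + 1) * ‖fderiv ℝ ψ x‖) fun i _ => ?_).trans ?_
    · rw [abs_mul]
      gcongr
      · have := ContinuousLinearMap.le_of_opNorm_le _ (hχd n x)
          (EuclideanSpace.basisFun (Fin d) ℝ i)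
        rwa [he, mul_one] at this
      · have := (fderiv ℝ ψ x).le_opNorm (EuclideanSpace.basisFun (Fin d) ℝ i)
        rwa [he, mul_one] at this
    · simp
  have hb2 : ∀ n x, ‖Δ (fun y => χ n y * ψ y) x‖ ≤ q x := by
    intro n x
    rw [laplacian_mul (hχ2 n) hψ2]
    refine (norm_add_le _ _).trans (add_le_add ((norm_add_le _ _).trans (add_le_add ?_ ?_)) ?_)
    · rw [norm_mul]
      exact mul_le_of_le_one_left (norm_nonneg _) (hχ1 n x)
    · rw [norm_mul]
      gcongr
      exact (hχL n x).trans (hn1 n)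
    · rw [norm_mul, Real.norm_ofNat]
      gcongr
      exact (hs n x).trans (by gcongr; exact hn1 n)
  have hb3 : ∀ x v, ‖fderiv ℝ ψ x v‖ ≤ (D + B * C) * ‖v‖ := fun x v =>
    (ContinuousLinearMap.le_of_opNorm_le _ (hD x) v).trans
      (by gcongr; linarith [mul_nonneg hB0 hC])
  have hb4 : ∀ x, ‖Δ ψ x‖ ≤ q x := fun x => by
    simp only [hq]
    have : 0 ≤ ‖ψ x‖ * C + 2 * (d * (C * ‖fderiv ℝ ψ x‖)) := by positivity
    linarith
  have hbound : ∀ φ : E d → ℝ, (∀ x v, ‖fderiv ℝ φ x v‖ ≤ (D + B * C) * ‖v‖) →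
      (∀ x, ‖Δ φ x‖ ≤ q x) → ∀ (f : E d → ℝ) (w : E d → E d) (x : E d),
      ‖f x * (fderiv ℝ φ x (w x) + κ * Δ φ x)‖
        ≤ (D + B * C) * (‖f x‖ * ‖w x‖) + |κ| * (‖f x‖ * ‖q x‖) := by
    intro φ h1 h2 f w x
    rw [norm_mul, Real.norm_of_nonneg (hq0 x)]
    calc ‖f x‖ * ‖fderiv ℝ φ x (w x) + κ * Δ φ x‖
        ≤ ‖f x‖ * ((D + B * C) * ‖w x‖ + |κ| * q x) := by
          gcongr
          refine (norm_add_le _ _).trans (add_le_add (h1 x _) ?_)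
          rw [norm_mul, Real.norm_eq_abs κ]
          gcongr
          exact h2 x
      _ = _ := by ring
  have hboundi : ∀ (f : E d → ℝ), MemLp f 2 → ∀ (w : E d → E d), MemLp w 2 →
      Integrable (fun x => (D + B * C) * (‖f x‖ * ‖w x‖) + |κ| * (‖f x‖ * ‖q x‖)) :=
    fun f hf w hw => ((integrable_norm_mul_norm hf hw).const_mul _).add
      ((integrable_norm_mul_norm hf hq2).const_mul _)
  have hwf : ∀ φ : E d → ℝ, (∀ x v, ‖fderiv ℝ φ x v‖ ≤ (D + B * C) * ‖v‖) →
      (∀ x, ‖Δ φ x‖ ≤ q x) → ∀ (f : E d → ℝ), MemLp f 2 → ∀ (w : E d → E d), MemLp w 2 →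
      |weakForm κ w f φ| ≤ (D + B * C + |κ| * l2Norm q) * l2Norm f * (l2Norm w + 1) := by
    intro φ h1 h2 f hf w hw
    have h3 := norm_integral_le_of_norm_le (hboundi f hf w hw)
      (Eventually.of_forall fun x => hbound φ h1 h2 f w x)
    rw [integral_add ((integrable_norm_mul_norm hf hw).const_mul _)
      ((integrable_norm_mul_norm hf hq2).const_mul _), integral_const_mul,
      integral_const_mul] at h3
    have h4 := integral_norm_mul_norm_le hf hw
    have h5 := integral_norm_mul_norm_le hf hq2
    have p1 := l2Norm_nonneg f
    have p2 := l2Norm_nonneg w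
    have p3 := l2Norm_nonneg q
    have p4 : 0 ≤ D + B * C := by positivity
    calc |weakForm κ w f φ| ≤ (D + B * C) * (l2Norm f * l2Norm w) + |κ| * (l2Norm f * l2Norm q) :=
          h3.trans (by gcongr)
      -- Nonnegative cross terms are added only to make the bound factor.
      _ ≤ (D + B * C) * (l2Norm f * l2Norm w) + |κ| * (l2Norm f * l2Norm q)
          + ((D + B * C) * l2Norm f + |κ| * (l2Norm f * l2Norm q) * l2Norm w) :=
          le_add_of_nonneg_right (by positivity)
      _ = _ := by ring
  have hsmooth : ∀ n, ContDiff ℝ ∞ (fun x => χ n x * ψ x) := fun n => (hχ n).mul hψ.contDiff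
  refine ⟨fun n x => χ n x * ψ x, D + B * C + |κ| * l2Norm q, hsmooth,
    fun n => (hχc n).mul_right, fun f hf => ?_, fun f hf w hw => ⟨fun n => ?_, ?_, ?_⟩⟩
  · refine tendsto_integral_of_dominated_convergence (fun x => ‖f x‖ * ‖ψ x‖)
      (fun n => hf.1.mul (hsmooth n).continuous.aestronglyMeasurable)
      (integrable_norm_mul_norm hf hψ.memLp) (fun n => Eventually.of_forall fun x => ?_)
      (Eventually.of_forall fun x => ?_)
    · rw [norm_mul, norm_mul]
      gcongr
      exact mul_le_of_le_one_left (norm_nonneg _) (hχ1 n x)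
    · simpa using ((hχt x).mul_const (ψ x)).const_mul (f x)
  · exact hwf _ (hb1 n) (hb2 n) f hf w hw
  · exact hwf _ hb3 hb4 f hf w hw
  · refine tendsto_integral_of_dominated_convergence _ (fun n => ?_) (hboundi f hf w hw)
      (fun n => Eventually.of_forall fun x => hbound _ (hb1 n) (hb2 n) f w x)
      (Eventually.of_forall fun x => ?_)
    · refine hf.1.mul (AEStronglyMeasurable.add ?_ ?_)
      · have hc : Continuous (fderiv ℝ (fun y => χ n y * ψ y)) :=
          (hsmooth n).continuous_fderiv (by simp)
        exact (isBoundedBilinearMap_apply.continuous).comp_aestronglyMeasurable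
          (hc.aestronglyMeasurable.prodMk hw.1)
      · exact ((continuous_laplacian ((hχ2 n).mul hψ2)).aestronglyMeasurable).const_mul κ
    · have hz : Tendsto (fun n : ℕ => C / (n + 1 : ℝ)) atTop (𝓝 0) := by
        simpa [div_eq_mul_inv] using (tendsto_one_div_add_atTop_nhds_zero_nat (𝕜 := ℝ)).const_mul C
      have t1 : Tendsto (fun n => fderiv ℝ (fun y => χ n y * ψ y) x (w x)) atTop
          (𝓝 (fderiv ℝ ψ x (w x))) := by
        simp_rw [hpt]
        have h1 := (hχt x).mul_const (fderiv ℝ ψ x (w x))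
        have h2 : Tendsto (fun n => fderiv ℝ (χ n) x (w x)) atTop (𝓝 0) :=
          squeeze_zero_norm (fun n => ContinuousLinearMap.le_of_opNorm_le _ (hχd n x) _)
            (by simpa using hz.mul_const ‖w x‖)
        simpa using h1.add (h2.const_mul (ψ x))
      have t2 : Tendsto (fun n => Δ (fun y => χ n y * ψ y) x) atTop (𝓝 (Δ ψ x)) := by
        simp_rw [laplacian_mul (hχ2 _) hψ2]
        have h1 := (hχt x).mul_const (Δ ψ x)
        have h2 : Tendsto (fun n => Δ (χ n) x) atTop (𝓝 0) :=
          squeeze_zero_norm (fun n => hχL n x) hz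
        have h3 : Tendsto (fun n => ∑ i, fderiv ℝ (χ n) x (EuclideanSpace.basisFun (Fin d) ℝ i)
            * fderiv ℝ ψ x (EuclideanSpace.basisFun (Fin d) ℝ i)) atTop (𝓝 0) :=
          squeeze_zero_norm (fun n => hs n x)
            (by simpa using (hz.mul_const ‖fderiv ℝ ψ x‖).const_mul (d : ℝ))
        simpa using (h1.add (h2.const_mul (ψ x))).add (h3.const_mul 2)
      exact (t1.add (t2.const_mul κ)).const_mul (f x)

/-- The weak formulation tested with smooth square integrable functions. -/
lemma IsSolution.integral_mul_eq {κ : ℝ} {u : ℝ → E d → E d}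
    {θ₀ : E d → ℝ} {θ : ℝ → E d → ℝ} (hθ : IsSolution κ u θ₀ θ) (hθ₀ : MemLp θ₀ 2)
    (hum : AEStronglyMeasurable (Function.uncurry u)
      ((volume.restrict (Set.Ioi (0 : ℝ))).prod volume))
    (hu : ∀ t, 0 < t → MemLp (u t) 2) {K : ℝ} (hK : ∀ t, 0 < t → l2Norm (u t) ≤ K)
    {A t : ℝ} (ht : 0 ≤ t) (hA : ∀ s, 0 < s → s ≤ t → l2Norm (θ s) ≤ A) {ψ : E d → ℝ}
    (hψ : IsTestFun ψ) :
    IntervalIntegrable (fun s => weakForm κ (u s) (θ s) ψ) volume 0 t ∧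
    ∫ x, θ t x * ψ x = (∫ x, θ₀ x * ψ x) + ∫ s in (0 : ℝ)..t, weakForm κ (u s) (θ s) ψ := by
  obtain ⟨φ, C, hφ, hφc, hl, hw⟩ := hψ.exists_approx κ
  have hmeas : ∀ φ : E d → ℝ, ContDiff ℝ ∞ φ →
      AEStronglyMeasurable (fun s => weakForm κ (u s) (θ s) φ)
        (volume.restrict (Set.uIoc 0 t)) := by
    intro φ hφ
    have hφ2 : ContDiff ℝ 2 φ := mod_cast contDiff_infty.1 hφ 2
    have h1 : AEStronglyMeasurable (fun p : ℝ × E d =>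
        θ p.1 p.2 * (fderiv ℝ φ p.2 (u p.1 p.2) + κ * Δ φ p.2))
        ((volume.restrict (Set.Ioi (0 : ℝ))).prod volume) := by
      refine hθ.aestronglyMeasurable.mul (AEStronglyMeasurable.add ?_ ?_)
      · have hc : Continuous (fun p : ℝ × E d => fderiv ℝ φ p.2) :=
          (hφ.continuous_fderiv (by simp)).comp continuous_snd
        exact (isBoundedBilinearMap_apply.continuous).comp_aestronglyMeasurable
          (hc.aestronglyMeasurable.prodMk hum)
      · exact (((continuous_laplacian hφ2).comp continuous_snd).aestronglyMeasurable).const_mul κ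
    have h2 := h1.integral_prod_right'
    refine h2.mono_measure (Measure.restrict_mono ?_ le_rfl)
    rw [Set.uIoc_of_le ht]
    exact Set.Ioc_subset_Ioi_self
  -- The weak form is controlled by L² norms of θ and u, which are bounded on (0, t]. This constant
  -- therefore dominates the time integrals.
  have hbd : ∀ s ∈ Set.uIoc 0 t, C * l2Norm (θ s) * (l2Norm (u s) + 1) ≤ |C| * A * (K + 1) := by
    intro s hs
    rw [Set.uIoc_of_le ht] at hs
    have h1 := l2Norm_nonneg (θ s)
    have h2 := l2Norm_nonneg (u s)
    have h3 := hA s hs.1 hs.2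
    have h4 : 0 ≤ A := h1.trans h3
    gcongr
    · exact le_abs_self C
    · exact hK s hs.1
  have hprop : ∀ s ∈ Set.uIoc 0 t, MemLp (θ s) 2 ∧ MemLp (u s) 2 := by
    intro s hs
    rw [Set.uIoc_of_le ht] at hs
    exact ⟨hθ.memLp s hs.1.le, hu s hs.1⟩
  constructor
  · rw [intervalIntegrable_iff]
    refine Integrable.mono' (g := fun _ => |C| * A * (K + 1))
      (integrableOn_const (by rw [Set.uIoc_of_le ht]; exact measure_Ioc_lt_top.ne))
      (hmeas ψ hψ.contDiff) ?_
    filter_upwards [ae_restrict_mem measurableSet_uIoc] with s hs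
    exact ((hw _ (hprop s hs).1 _ (hprop s hs).2).2.1).trans (hbd s hs)
  · have e : ∀ n, ∫ x, θ t x * φ n x
        = (∫ x, θ₀ x * φ n x) + ∫ s in (0 : ℝ)..t, weakForm κ (u s) (θ s) (φ n) :=
      fun n => hθ.equation (φ n) (hφ n) (hφc n) t ht
    have hlim : Tendsto (fun n => ∫ s in (0 : ℝ)..t, weakForm κ (u s) (θ s) (φ n)) atTop
        (𝓝 (∫ s in (0 : ℝ)..t, weakForm κ (u s) (θ s) ψ)) := by
      refine intervalIntegral.tendsto_integral_filter_of_dominated_convergence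
        (fun _ => |C| * A * (K + 1)) (Eventually.of_forall fun n => hmeas _ (hφ n))
        (Eventually.of_forall fun n => Eventually.of_forall fun s hs => ?_)
        intervalIntegrable_const (Eventually.of_forall fun s hs => ?_)
      · exact ((hw _ (hprop s hs).1 _ (hprop s hs).2).1 n).trans (hbd s hs)
      · exact (hw _ (hprop s hs).1 _ (hprop s hs).2).2.2
    refine tendsto_nhds_unique (hl _ (hθ.memLp t ht)) ?_
    simp_rw [e]
    exact (hl _ hθ₀).add hlim

end AdvDiff
end

/-! ### Band-limited functions and their inverse Fourier transforms. -/

noncomputable section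
namespace AdvDiff
open scoped ContDiff
open Laplacian FourierTransform

variable {d : ℕ}

/-- Square integrable functions supported in the closed ball of radius `R`. -/
structure IsBand (R : ℝ) (w : E d → ℂ) : Prop where
  memLp : MemLp w 2
  eq_zero : ∀ ξ, R < ‖ξ‖ → w ξ = 0

namespace IsBand
variable {R : ℝ} {w : E d → ℂ}

lemma mul (hw : IsBand R w) {p : E d → ℂ} (hp : Continuous p) : IsBand R (fun ξ => p ξ * w ξ) := by
  obtain ⟨C, hC⟩ := (isCompact_closedBall (0 : E d) R).exists_bound_of_continuousOn
    hp.continuousOn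
  refine ⟨?_, fun ξ hξ => by rw [hw.eq_zero ξ hξ, mul_zero]⟩
  refine MemLp.of_le_mul (c := C) hw.memLp (hp.aestronglyMeasurable.mul hw.memLp.1)
    (Eventually.of_forall fun ξ => ?_)
  by_cases h : R < ‖ξ‖
  · simp [hw.eq_zero ξ h]
  · rw [norm_mul]
    gcongr
    exact hC ξ (by simpa using h)

/-- Cauchy–Schwarz against the indicator of the ball. This is the source of every sup bound below
(Bernstein's inequality). -/
lemma integral_norm_le (hw : IsBand R w) :
    Integrable w ∧ ∫ ξ, ‖w ξ‖ ≤ √(volume.real (Metric.closedBall (0 : E d) R)) * l2Norm w := by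
  have hB : volume (Metric.closedBall (0 : E d) R) ≠ ⊤ := measure_closedBall_lt_top.ne
  have h1 : MemLp ((Metric.closedBall (0 : E d) R).indicator (fun _ => (1 : ℝ))) 2 :=
    memLp_indicator_const 2 measurableSet_closedBall 1 (Or.inr hB)
  have e : ∀ ξ, ‖w ξ‖
      = ‖(Metric.closedBall (0 : E d) R).indicator (fun _ => (1 : ℝ)) ξ‖ * ‖w ξ‖ := by
    intro ξ
    by_cases h : R < ‖ξ‖
    · simp [hw.eq_zero ξ h]
    · rw [Set.indicator_of_mem (by simpa using h)]
      simp
  have hi : Integrable (fun ξ => ‖w ξ‖) :=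
    (integrable_norm_mul_norm h1 hw.memLp).congr (Eventually.of_forall fun ξ => (e ξ).symm)
  refine ⟨(integrable_norm_iff hw.memLp.1).1 hi, ?_⟩
  rw [integral_congr_ae (Eventually.of_forall e)]
  refine (integral_norm_mul_norm_le h1 hw.memLp).trans_eq ?_
  congr 1
  rw [← Real.sqrt_sq (l2Norm_nonneg _), sq_l2Norm h1]
  congr 1
  have : ∀ ξ, ‖(Metric.closedBall (0 : E d) R).indicator (fun _ => (1 : ℝ)) ξ‖ ^ 2
      = (Metric.closedBall (0 : E d) R).indicator (fun _ => (1 : ℝ)) ξ := by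
    intro ξ
    by_cases h : ξ ∈ Metric.closedBall (0 : E d) R <;> simp [h]
  simp_rw [this]
  rw [integral_indicator measurableSet_closedBall]
  simp

lemma integrable (hw : IsBand R w) : Integrable w := hw.integral_norm_le.1

lemma comp_neg (hw : IsBand R w) : IsBand R (fun ξ => w (-ξ)) :=
  ⟨hw.memLp.comp_measurePreserving (Measure.measurePreserving_neg volume),
    fun ξ hξ => hw.eq_zero _ (by simpa using hξ)⟩

lemma norm_fourierInv_le (hw : IsBand R w) (x : E d) :
    ‖𝓕⁻ w x‖ ≤ √(volume.real (Metric.closedBall (0 : E d) R)) * l2Norm w := by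
  refine le_trans ?_ hw.integral_norm_le.2
  rw [Real.fourierInv_eq]
  refine (norm_integral_le_integral_norm _).trans_eq ?_
  simp

lemma contDiff_fourierInv (hw : IsBand R w) : ContDiff ℝ ∞ (𝓕⁻ w) := by
  rw [Real.fourierInv_eq_fourier_comp_neg]
  refine Real.contDiff_fourier (N := ⊤) fun n _ => ?_
  have := (hw.comp_neg.mul (p := fun ξ => ((‖ξ‖ ^ n : ℝ) : ℂ)) (by fun_prop)).integrable.norm
  refine this.congr (Eventually.of_forall fun ξ => ?_)
  simp

lemma fderiv_fourierInv (hw : IsBand R w) (x v : E d) :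
    fderiv ℝ (𝓕⁻ w) x v
      = 𝓕⁻ (fun ξ => (2 * Real.pi * Complex.I * (inner ℝ ξ v : ℝ)) * w ξ) x := by
  rw [Real.fourierInv_eq_fourier_comp_neg, Real.fourierInv_eq_fourier_comp_neg]
  have h1 : Integrable (fun ξ : E d => ‖ξ‖ * ‖w (-ξ)‖) := by
    have := (hw.comp_neg.mul (p := fun ξ => ((‖ξ‖ : ℝ) : ℂ)) (by fun_prop)).integrable.norm
    refine this.congr (Eventually.of_forall fun ξ => ?_)
    simp
  rw [Real.fderiv_fourier hw.comp_neg.integrable h1]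
  have h2 : Integrable (VectorFourier.fourierSMulRight (innerSL ℝ) (fun ξ : E d => w (-ξ))) := by
    refine Integrable.mono' (h1.const_mul (2 * Real.pi * ‖innerSL ℝ (E := E d)‖))
      hw.comp_neg.memLp.1.fourierSMulRight (Eventually.of_forall fun ξ => ?_)
    refine (VectorFourier.norm_fourierSMulRight_le _ _ _).trans_eq (by ring)
  rw [Real.fourier_continuousLinearMap_apply h2]
  refine congrArg (fun f : E d → ℂ => 𝓕 f x) (funext fun ξ => ?_)
  simp only [VectorFourier.fourierSMulRight_apply, innerSL_apply_apply ℝ, inner_neg_left,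
    Complex.ofReal_neg, smul_eq_mul, Complex.real_smul]
  ring

lemma laplacian_fourierInv (hw : IsBand R w) (x : E d) :
    Δ (𝓕⁻ w) x = 𝓕⁻ (fun ξ => ((-(2 * Real.pi) ^ 2 * ‖ξ‖ ^ 2 : ℝ) : ℂ) * w ξ) x := by
  have h2 : ContDiff ℝ 2 (𝓕⁻ w) := mod_cast contDiff_infty.1 hw.contDiff_fourierInv 2
  rw [laplacian_eq_sum_fderiv h2]
  have hb : ∀ v : E d,
      IsBand R (fun ξ => (2 * Real.pi * Complex.I * (inner ℝ ξ v : ℝ)) * w ξ) := fun v =>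
    hw.mul (by fun_prop)
  have e : ∀ i, fderiv ℝ (fun y => fderiv ℝ (𝓕⁻ w) y (EuclideanSpace.basisFun (Fin d) ℝ i)) x
      (EuclideanSpace.basisFun (Fin d) ℝ i)
      = 𝓕⁻ (fun ξ => ((-(2 * Real.pi) ^ 2 * ξ i ^ 2 : ℝ) : ℂ) * w ξ) x := by
    intro i
    have : (fun y => fderiv ℝ (𝓕⁻ w) y (EuclideanSpace.basisFun (Fin d) ℝ i))
        = 𝓕⁻ (fun ξ => (2 * Real.pi * Complex.I *
          (inner ℝ ξ (EuclideanSpace.basisFun (Fin d) ℝ i) : ℝ)) * w ξ) := by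
      ext y
      rw [hw.fderiv_fourierInv]
    rw [this, (hb _).fderiv_fourierInv]
    refine congrArg (fun f : E d → ℂ => 𝓕⁻ f x) (funext fun ξ => ?_)
    have : inner ℝ ξ (EuclideanSpace.basisFun (Fin d) ℝ i) = ξ i := by
      rw [real_inner_comm, EuclideanSpace.basisFun_apply, EuclideanSpace.inner_single_left]
      simp
    rw [this]
    push_cast
    linear_combination (2 * Real.pi) ^ 2 * (ξ i : ℂ) ^ 2 * w ξ * Complex.I_sq
  simp_rw [e, Real.fourierInv_eq]
  rw [← integral_finsetSum]
  · congr 1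
    ext ξ
    rw [← Finset.smul_sum, ← Finset.sum_mul, EuclideanSpace.real_norm_sq_eq]
    push_cast
    rw [Finset.mul_sum]
  · intro i _
    have h3 : IsBand R (fun ξ : E d => ((-(2 * Real.pi) ^ 2 * ξ i ^ 2 : ℝ) : ℂ) * w ξ) :=
      hw.mul (by fun_prop)
    refine (integrable_norm_iff ?_).1 ?_
    · refine AEStronglyMeasurable.smul ?_ h3.memLp.1
      apply Continuous.aestronglyMeasurable
      fun_prop
    · simpa using h3.integrable.norm

/-- The abstract L² inverse transform and the inverse Fourier integral agree as distributions:
moving either transform onto a smooth compactly supported function gives the same pairing with w. -/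
lemma toLp_fourierInv_ae_eq (hw : IsBand R w) :
    ((𝓕⁻ (hw.memLp.toLp w) : Lp ℂ 2 (volume : Measure (E d))) : E d → ℂ) =ᵐ[volume] 𝓕⁻ w := by
  set g : Lp ℂ 2 (volume : Measure (E d)) := hw.memLp.toLp w
  refine ae_eq_of_integral_contDiff_smul_eq
    ((Lp.memLp (𝓕⁻ g)).locallyIntegrable (by norm_num))
    hw.contDiff_fourierInv.continuous.locallyIntegrable fun φ hφ hφc => ?_
  have hg₁ : HasCompactSupport (Complex.ofRealCLM ∘ φ) := hφc.comp_left rfl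
  have hg₂ : ContDiff ℝ ∞ (Complex.ofRealCLM ∘ φ) := by fun_prop
  set Φ := hg₁.toSchwartzMap hg₂
  have h1 := congrArg (fun T => T Φ) (Lp.fourierInv_toTemperedDistribution_eq g)
  simp only [TemperedDistribution.fourierInv_apply, Lp.toTemperedDistribution_apply] at h1
  have h2 : ∫ x, φ x • (𝓕⁻ g : Lp ℂ 2 (volume : Measure (E d))) x
      = ∫ x, Φ x • (𝓕⁻ g : Lp ℂ 2 (volume : Measure (E d))) x := by
    simp [Φ]
  rw [h2, ← h1]
  have h3 : ∫ x, φ x • 𝓕⁻ w x = ∫ x, 𝓕⁻ w x • Φ x := by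
    simp [Φ, mul_comm]
  rw [h3]
  have h4 := VectorFourier.integral_fourierIntegral_smul_eq_flip (f := w) (g := Φ)
    (μ := volume) (ν := volume) (e := Real.fourierChar) (L := -innerₗ (E d))
    Real.continuous_fourierChar (by simp only [LinearMap.neg_apply]; exact continuous_inner.neg)
    hw.integrable Φ.integrable
  refine Eq.trans ?_ h4.symm
  refine integral_congr_ae ?_
  filter_upwards [hw.memLp.coeFn_toLp] with ξ hξ
  rw [hξ, SchwartzMap.fourierInv_coe, smul_eq_mul, smul_eq_mul, mul_comm]
  congr 1
  simp only [FourierTransformInv.fourierInv, VectorFourier.fourierIntegral]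
  simp [real_inner_comm]

lemma memLp_fourierInv (hw : IsBand R w) : MemLp (𝓕⁻ w) 2 :=
  (memLp_congr_ae hw.toLp_fourierInv_ae_eq).1 (Lp.memLp _)

lemma l2Norm_fourierInv (hw : IsBand R w) : l2Norm (𝓕⁻ w) = l2Norm w := by
  have h1 : ‖(𝓕⁻ (hw.memLp.toLp w) : Lp ℂ 2 (volume : Measure (E d)))‖
      = ‖hw.memLp.toLp w‖ := (Lp.fourierTransformₗᵢ (E d) ℂ).symm.norm_map _
  rw [Lp.norm_def, eLpNorm_congr_ae hw.toLp_fourierInv_ae_eq, Lp.norm_toLp] at h1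
  exact h1

end IsBand

end AdvDiff
end

/-! ### Real test functions built from band-limited data, and Parseval's identity. -/

noncomputable section
namespace AdvDiff
open scoped ContDiff
open Laplacian FourierTransform

variable {d : ℕ}

lemma l2Norm_le_of_ae_le {F G : Type*} [NormedAddCommGroup F] [NormedAddCommGroup G]
    {f : E d → F} {g : E d → G} (hg : MemLp g 2) (h : ∀ᵐ x, ‖f x‖ ≤ ‖g x‖) :
    l2Norm f ≤ l2Norm g :=
  ENNReal.toReal_mono hg.2.ne (eLpNorm_mono_ae h)

lemma memLp_complex {f : E d → ℝ} (hf : MemLp f 2) : MemLp (fun x => (f x : ℂ)) 2 :=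
  hf.ofReal

/-- The Fourier transform of a real valued square integrable function as an element of `L²`. -/
def hat (f : E d → ℝ) : Lp ℂ 2 (volume : Measure (E d)) :=
  open Classical in
  if h : MemLp (fun x => (f x : ℂ)) 2 (volume : Measure (E d)) then 𝓕 (h.toLp _) else 0

lemma plancherel_ae_eq_hat (f : E d → ℝ) : plancherel f =ᵐ[volume] hat f := by
  unfold plancherel hat
  split_ifs with h
  · exact EventuallyEq.rfl
  · exact (Lp.coeFn_zero ℂ 2 _).symm

lemma hat_eq {f : E d → ℝ} (hf : MemLp f 2) : hat f = 𝓕 ((memLp_complex hf).toLp (fun x => (f x : ℂ))) :=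
  dif_pos _

lemma l2Norm_ofReal (f : E d → ℝ) : l2Norm (fun x => (f x : ℂ)) = l2Norm f := by
  unfold l2Norm
  congr 1
  exact eLpNorm_congr_norm_ae (Eventually.of_forall fun x => by simp)

lemma norm_hat {f : E d → ℝ} (hf : MemLp f 2) : ‖hat f‖ = l2Norm f := by
  rw [hat_eq hf, Lp.norm_fourier_eq, Lp.norm_toLp]
  exact l2Norm_ofReal f

lemma hat_sub {f g : E d → ℝ} (hf : MemLp f 2) (hg : MemLp g 2) :
    hat (f - g) = hat f - hat g := by
  rw [hat_eq hf, hat_eq hg, hat_eq (hf.sub hg), sub_eq_add_neg (𝓕 _),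
    ← FourierTransform.fourier_neg, ← FourierTransform.fourier_add, ← sub_eq_add_neg (MemLp.toLp _ _),
    ← MemLp.toLp_sub]
  congr 1
  rw [MemLp.toLp_eq_toLp_iff]
  exact Eventually.of_forall fun x => by simp

lemma hat_congr {f g : E d → ℝ} (hf : MemLp f 2) (hg : MemLp g 2) (h : f =ᵐ[volume] g) :
    hat f = hat g := by
  rw [hat_eq hf, hat_eq hg]
  congr 1
  rw [MemLp.toLp_eq_toLp_iff]
  filter_upwards [h] with x hx
  rw [hx]

/-- The real part of the inverse Fourier transform. -/
def reInv (w : E d → ℂ) (x : E d) : ℝ := (𝓕⁻ w x).re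

namespace IsBand
variable {R : ℝ} {w : E d → ℂ}

lemma contDiff_reInv (hw : IsBand R w) : ContDiff ℝ ∞ (reInv w) :=
  Complex.reCLM.contDiff.comp hw.contDiff_fourierInv

lemma fderiv_reInv (hw : IsBand R w) (x v : E d) :
    fderiv ℝ (reInv w) x v
      = reInv (fun ξ => (2 * Real.pi * Complex.I * (inner ℝ ξ v : ℝ)) * w ξ) x := by
  have hd : DifferentiableAt ℝ (𝓕⁻ w) x := hw.contDiff_fourierInv.differentiable (by simp) x
  have h : HasFDerivAt (reInv w) (Complex.reCLM.comp (fderiv ℝ (𝓕⁻ w) x)) x :=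
    Complex.reCLM.hasFDerivAt.comp x hd.hasFDerivAt
  rw [h.fderiv, ContinuousLinearMap.comp_apply, hw.fderiv_fourierInv]
  rfl

lemma laplacian_reInv (hw : IsBand R w) :
    Δ (reInv w) = reInv (fun ξ => ((-(2 * Real.pi) ^ 2 * ‖ξ‖ ^ 2 : ℝ) : ℂ) * w ξ) := by
  ext x
  have h2 : ContDiffAt ℝ 2 (𝓕⁻ w) x :=
    ContDiff.contDiffAt (mod_cast contDiff_infty.1 hw.contDiff_fourierInv 2)
  have := h2.laplacian_CLM_comp_left (l := Complex.reCLM)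
  change Δ (Complex.reCLM ∘ 𝓕⁻ w) x = _
  rw [this, Function.comp_apply, hw.laplacian_fourierInv]
  rfl

lemma memLp_reInv (hw : IsBand R w) : MemLp (reInv w) 2 := hw.memLp_fourierInv.re

lemma l2Norm_reInv_le (hw : IsBand R w) : l2Norm (reInv w) ≤ l2Norm w := by
  rw [← hw.l2Norm_fourierInv]
  exact l2Norm_le_of_ae_le hw.memLp_fourierInv
    (Eventually.of_forall fun x => Complex.abs_re_le_norm _)

lemma norm_reInv_le (hw : IsBand R w) (x : E d) :
    ‖reInv w x‖ ≤ √(volume.real (Metric.closedBall (0 : E d) R)) * l2Norm w :=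
  (Complex.abs_re_le_norm _).trans (hw.norm_fourierInv_le x)

lemma norm_mul (hw : IsBand R w) : IsBand R (fun ξ => (‖ξ‖ : ℂ) * w ξ) := hw.mul (by fun_prop)

lemma l2Norm_norm_mul_le (hw : IsBand R w) (hR : 0 ≤ R) :
    l2Norm (fun ξ => (‖ξ‖ : ℂ) * w ξ) ≤ R * l2Norm w := by
  have h : l2Norm (fun ξ => (R : ℂ) * w ξ) = R * l2Norm w := by
    have := eLpNorm_const_smul (R : ℂ) w 2 (volume : Measure (E d))
    simp only [l2Norm]
    change (eLpNorm ((R : ℂ) • w) 2 volume).toReal = _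
    rw [this, ENNReal.toReal_mul]
    simp [abs_of_nonneg hR]
  rw [← h]
  refine l2Norm_le_of_ae_le (hw.memLp.const_mul _) (Eventually.of_forall fun ξ => ?_)
  by_cases hξ : R < ‖ξ‖
  · simp [hw.eq_zero ξ hξ]
  · rw [_root_.norm_mul, _root_.norm_mul]
    gcongr
    simpa [abs_of_nonneg hR] using not_lt.1 hξ

lemma inner_mul (hw : IsBand R w) (v : E d) :
    IsBand R (fun ξ => (2 * Real.pi * Complex.I * (inner ℝ ξ v : ℝ)) * w ξ) :=
  hw.mul (by fun_prop)

lemma norm_fderiv_reInv_le (hw : IsBand R w) (hR : 0 ≤ R) (x : E d) :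
    ‖fderiv ℝ (reInv w) x‖
      ≤ 2 * Real.pi * R * √(volume.real (Metric.closedBall (0 : E d) R)) * l2Norm w := by
  have hl := l2Norm_nonneg w
  refine ContinuousLinearMap.opNorm_le_bound _ (by positivity) fun v => ?_
  rw [hw.fderiv_reInv]
  refine ((hw.inner_mul v).norm_reInv_le x).trans ?_
  have h : l2Norm (fun ξ => (2 * Real.pi * Complex.I * (inner ℝ ξ v : ℝ)) * w ξ)
      ≤ 2 * Real.pi * ‖v‖ * l2Norm (fun ξ => (‖ξ‖ : ℂ) * w ξ) := by
    have e : 2 * Real.pi * ‖v‖ * l2Norm (fun ξ => (‖ξ‖ : ℂ) * w ξ)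
        = l2Norm (((2 * Real.pi * ‖v‖ : ℝ) : ℂ) • (fun ξ : E d => (‖ξ‖ : ℂ) * w ξ)) := by
      rw [l2Norm, l2Norm, eLpNorm_const_smul, ENNReal.toReal_mul]
      simp [abs_of_pos Real.pi_pos]
    rw [e]
    refine l2Norm_le_of_ae_le (hw.norm_mul.memLp.const_smul _) (Eventually.of_forall fun ξ => ?_)
    have h1 := abs_real_inner_le_norm ξ v
    simp only [_root_.norm_mul, Complex.norm_ofNat, Complex.norm_real, Complex.norm_I,
      Real.norm_eq_abs, abs_of_pos Real.pi_pos, mul_one, Pi.smul_apply, norm_smul, abs_norm,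
      Nat.abs_ofNat]
    have : 0 ≤ ‖w ξ‖ := norm_nonneg _
    have : |inner ℝ ξ v| * ‖w ξ‖ ≤ ‖ξ‖ * ‖v‖ * ‖w ξ‖ := by gcongr
    nlinarith [Real.pi_pos]
  have h2 := hw.l2Norm_norm_mul_le hR
  calc _ ≤ √(volume.real (Metric.closedBall (0 : E d) R)) * (2 * Real.pi * ‖v‖ * (R * l2Norm w)) := by
        gcongr
        exact h.trans (by gcongr)
    _ = _ := by ring

lemma _root_.AdvDiff.opNorm_sq_le (L : E d →L[ℝ] ℝ) :
    ‖L‖ ^ 2 ≤ ∑ i, ‖L (EuclideanSpace.basisFun (Fin d) ℝ i)‖ ^ 2 := by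
  have h0 : 0 ≤ ∑ i, ‖L (EuclideanSpace.basisFun (Fin d) ℝ i)‖ ^ 2 := by positivity
  refine (Real.le_sqrt (norm_nonneg _) h0).1 (ContinuousLinearMap.opNorm_le_bound _ (by positivity)
    fun v => ?_)
  have e : L v = ∑ i, v i * L (EuclideanSpace.basisFun (Fin d) ℝ i) := by
    conv_lhs => rw [← (EuclideanSpace.basisFun (Fin d) ℝ).sum_repr v]
    simp
  rw [e, EuclideanSpace.norm_eq, Real.norm_eq_abs, mul_comm,
    ← Real.sqrt_mul (by positivity)]
  apply Real.abs_le_sqrt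
  simpa using Finset.sum_mul_sq_le_sq_mul_sq Finset.univ (fun i => v i)
    (fun i => L (EuclideanSpace.basisFun (Fin d) ℝ i))

lemma memLp_fderiv_apply (hw : IsBand R w) (v : E d) :
    MemLp (fun x => fderiv ℝ (reInv w) x v) 2 := by
  simp_rw [hw.fderiv_reInv]
  exact (hw.inner_mul v).memLp_reInv

lemma memLp_fderiv_reInv (hw : IsBand R w) : MemLp (fderiv ℝ (reInv w)) 2 := by
  have h1 : MemLp (fun x => ∑ i, ‖fderiv ℝ (reInv w) x (EuclideanSpace.basisFun (Fin d) ℝ i)‖) 2 :=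
    memLp_finsetSum _ fun i _ => (hw.memLp_fderiv_apply _).norm
  refine h1.mono (hw.contDiff_reInv.continuous_fderiv (by simp)).aestronglyMeasurable
    (Eventually.of_forall fun x => ?_)
  rw [Real.norm_of_nonneg (by positivity)]
  refine (sq_le_sq₀ (norm_nonneg _) (by positivity)).1 ?_
  refine (opNorm_sq_le _).trans ?_
  exact Finset.sum_sq_le_sq_sum_of_nonneg fun i _ => norm_nonneg _

/-- Each partial derivative has multiplier 2πi ξ_i, Plancherel applies componentwise, and the
squares of the ξ_i sum to |ξ|². -/
lemma l2Norm_fderiv_reInv_le (hw : IsBand R w) :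
    l2Norm (fderiv ℝ (reInv w)) ≤ 2 * Real.pi * l2Norm (fun ξ => (‖ξ‖ : ℂ) * w ξ) := by
  refine (sq_le_sq₀ (l2Norm_nonneg _)
    (mul_nonneg Real.two_pi_pos.le (l2Norm_nonneg _))).1 ?_
  have hi : ∀ i : Fin d, Integrable (fun x =>
      ‖fderiv ℝ (reInv w) x (EuclideanSpace.basisFun (Fin d) ℝ i)‖ ^ 2) :=
    fun i => (hw.memLp_fderiv_apply _).integrable_norm_pow (by norm_num)
  rw [mul_pow, sq_l2Norm hw.memLp_fderiv_reInv, sq_l2Norm hw.norm_mul.memLp]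
  calc ∫ x, ‖fderiv ℝ (reInv w) x‖ ^ 2
      ≤ ∫ x, ∑ i, ‖fderiv ℝ (reInv w) x (EuclideanSpace.basisFun (Fin d) ℝ i)‖ ^ 2 :=
        integral_mono (hw.memLp_fderiv_reInv.integrable_norm_pow (by norm_num))
          (integrable_finsetSum _ fun i _ => hi i) fun x => opNorm_sq_le _
    _ = ∑ i, ∫ x, ‖fderiv ℝ (reInv w) x (EuclideanSpace.basisFun (Fin d) ℝ i)‖ ^ 2 :=
        integral_finsetSum _ fun i _ => hi i
    _ ≤ ∑ i, ∫ ξ, ‖(2 * Real.pi * Complex.I *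
          (inner ℝ ξ (EuclideanSpace.basisFun (Fin d) ℝ i) : ℝ)) * w ξ‖ ^ 2 := by
        refine Finset.sum_le_sum fun i _ => ?_
        rw [← sq_l2Norm (hw.memLp_fderiv_apply _), ← sq_l2Norm (hw.inner_mul _).memLp]
        simp_rw [hw.fderiv_reInv]
        exact pow_le_pow_left₀ (l2Norm_nonneg _) (hw.inner_mul _).l2Norm_reInv_le 2
    _ = ∫ ξ, ∑ i, ‖(2 * Real.pi * Complex.I *
          (inner ℝ ξ (EuclideanSpace.basisFun (Fin d) ℝ i) : ℝ)) * w ξ‖ ^ 2 :=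
        (integral_finsetSum _ fun i _ =>
          (hw.inner_mul _).memLp.integrable_norm_pow (by norm_num)).symm
    _ = (2 * Real.pi) ^ 2 * ∫ ξ, ‖(‖ξ‖ : ℂ) * w ξ‖ ^ 2 := by
        rw [← integral_const_mul]
        refine integral_congr_ae (Eventually.of_forall fun ξ => ?_)
        have : ∀ i, inner ℝ ξ (EuclideanSpace.basisFun (Fin d) ℝ i) = ξ i := by
          intro i
          rw [real_inner_comm, EuclideanSpace.basisFun_apply, EuclideanSpace.inner_single_left]
          simp
        simp only [this, _root_.norm_mul, Complex.norm_ofNat, Complex.norm_real, Complex.norm_I,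
          Real.norm_eq_abs, abs_of_pos Real.pi_pos, mul_one, mul_pow, sq_abs, abs_norm,
          EuclideanSpace.real_norm_sq_eq, Finset.mul_sum, Finset.sum_mul]
        exact Finset.sum_congr rfl fun i _ => by ring

lemma isTestFun_reInv (hw : IsBand R w) (hR : 0 ≤ R) : IsTestFun (reInv w) where
  contDiff := hw.contDiff_reInv
  bounded := ⟨_, hw.norm_reInv_le⟩
  bounded_fderiv := ⟨_, hw.norm_fderiv_reInv_le hR⟩
  memLp := hw.memLp_reInv
  memLp_fderiv := hw.memLp_fderiv_reInv
  memLp_laplacian := by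
    rw [hw.laplacian_reInv]
    exact (hw.mul (by fun_prop)).memLp_reInv

/-- Parseval's identity. Because f is real, taking the real part of 𝓕⁻ w amounts to taking the real
part of the inner product, so no Hermitian symmetry of w is needed. -/
lemma integral_mul_reInv (hw : IsBand R w) {f : E d → ℝ} (hf : MemLp f 2) :
    ∫ x, f x * reInv w x = (inner ℂ (hw.memLp.toLp w) (hat f)).re := by
  set W := hw.memLp.toLp w
  have e : inner ℂ W (hat f) = inner ℂ (𝓕⁻ W) ((memLp_complex hf).toLp (fun x => (f x : ℂ))) := by
    rw [hat_eq hf, ← Lp.inner_fourier_eq (𝓕⁻ W), FourierTransform.fourier_fourierInv_eq]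
  have hi := L2.integrable_inner (𝕜 := ℂ) (𝓕⁻ W) ((memLp_complex hf).toLp (fun x => (f x : ℂ)))
  rw [e, L2.inner_def]
  have := integral_re hi
  simp only [RCLike.re_to_complex] at this
  rw [← this]
  refine integral_congr_ae ?_
  filter_upwards [hw.toLp_fourierInv_ae_eq, (memLp_complex hf).coeFn_toLp] with x h1 h2
  rw [h1, h2]
  simp [reInv]

/-- For real f, |f - Re g| ≤ |f - g|, and Plancherel evaluates the right side. -/
lemma l2Norm_sub_reInv_le (hw : IsBand R w) {f : E d → ℝ} (hf : MemLp f 2) :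
    l2Norm (f - reInv w) ≤ ‖hat f - hw.memLp.toLp w‖ := by
  set W := hw.memLp.toLp w
  have e : ‖hat f - W‖ = ‖(memLp_complex hf).toLp (fun x => (f x : ℂ)) - 𝓕⁻ W‖ := by
    rw [← Lp.norm_fourier_eq ((memLp_complex hf).toLp (fun x => (f x : ℂ)) - 𝓕⁻ W), sub_eq_add_neg,
      sub_eq_add_neg, FourierTransform.fourier_add, FourierTransform.fourier_neg,
      FourierTransform.fourier_fourierInv_eq, hat_eq hf]
  rw [e, Lp.norm_def]
  refine ENNReal.toReal_mono (Lp.eLpNorm_ne_top _) (eLpNorm_mono_ae ?_)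
  filter_upwards [hw.toLp_fourierInv_ae_eq, (memLp_complex hf).coeFn_toLp,
    Lp.coeFn_sub ((memLp_complex hf).toLp (fun x => (f x : ℂ))) (𝓕⁻ W)] with x h1 h2 h3
  rw [h3, Pi.sub_apply, Pi.sub_apply, h1, h2]
  simpa [reInv] using Complex.abs_re_le_norm ((f x : ℂ) - 𝓕⁻ w x)

end IsBand

end AdvDiff
end

/-! ### The drift term, frequency truncation, and mass on balls. -/

noncomputable section
namespace AdvDiff
open scoped ContDiff
open Laplacian FourierTransform

variable {d : ℕ}

/-- The transport part of the weak form. -/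
def drift (v : E d → E d) (f ψ : E d → ℝ) : ℝ := ∫ x, f x * fderiv ℝ ψ x (v x)

namespace IsBand
variable {R : ℝ} {w : E d → ℂ}

lemma sq_norm_mul (hw : IsBand R w) : IsBand R (fun ξ => ((‖ξ‖ ^ 2 : ℝ) : ℂ) * w ξ) :=
  hw.mul (by fun_prop)

lemma aestronglyMeasurable_fderiv_apply (hw : IsBand R w) {v : E d → E d} (hv : MemLp v 2) :
    AEStronglyMeasurable (fun x => fderiv ℝ (reInv w) x (v x)) := by
  have hc : Continuous (fderiv ℝ (reInv w)) := hw.contDiff_reInv.continuous_fderiv (by simp)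
  exact (isBoundedBilinearMap_apply.continuous).comp_aestronglyMeasurable
    (hc.aestronglyMeasurable.prodMk hv.1)

/-- Physical space form of the bound by |ξ| ‖vf‖₁ on the transform of ∇ · (vf): the gradient of a
band-limited test function is bounded by Bernstein's inequality. The volume factor later supplies
the power R^(d/2). -/
lemma abs_drift_le (hw : IsBand R w) (hR : 0 ≤ R) {v : E d → E d} (hv : MemLp v 2)
    {f : E d → ℝ} (hf : MemLp f 2) :
    Integrable (fun x => f x * fderiv ℝ (reInv w) x (v x)) ∧
    |drift v f (reInv w)|
      ≤ 2 * Real.pi * R * √(volume.real (Metric.closedBall (0 : E d) R)) * l2Norm w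
        * (l2Norm f * l2Norm v) := by
  set D := 2 * Real.pi * R * √(volume.real (Metric.closedBall (0 : E d) R)) * l2Norm w
  have hl := l2Norm_nonneg w
  have hb : ∀ x, ‖f x * fderiv ℝ (reInv w) x (v x)‖ ≤ D * (‖f x‖ * ‖v x‖) := by
    intro x
    rw [_root_.norm_mul, mul_left_comm]
    gcongr
    exact ContinuousLinearMap.le_of_opNorm_le _ (hw.norm_fderiv_reInv_le hR x) _
  have hi := (integrable_norm_mul_norm hf hv).const_mul D
  refine ⟨hi.mono' (hf.1.mul (hw.aestronglyMeasurable_fderiv_apply hv))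
    (Eventually.of_forall hb), ?_⟩
  refine (norm_integral_le_of_norm_le hi (Eventually.of_forall hb)).trans ?_
  rw [integral_const_mul]
  gcongr
  exact integral_norm_mul_norm_le hf hv

/-- For a bounded divergence-free field, the transport part only sees the part of the scalar which
is not resolved by the test function. -/
lemma abs_drift_le_of_isDivFree (hw : IsBand R w) (hR : 0 ≤ R) {v : E d → E d} (hv : MemLp v 2)
    (hdiv : IsDivFree v) {U : ℝ} (hU0 : 0 ≤ U) (hU : ∀ᵐ x, ‖v x‖ ≤ U) {f : E d → ℝ}
    (hf : MemLp f 2) :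
    |drift v f (reInv w)|
      ≤ 2 * Real.pi * U * ‖hat f - hw.memLp.toLp w‖ * l2Norm (fun ξ => (‖ξ‖ : ℂ) * w ξ) := by
  set ψ := reInv w
  have hi1 := (hw.abs_drift_le hR hv hf).1
  have hi2 := (hw.abs_drift_le hR hv hw.memLp_reInv).1
  have hψd : Differentiable ℝ ψ := hw.contDiff_reInv.differentiable (by simp)
  have hg : ∀ x, fderiv ℝ (fun y => ψ y * ψ y) x (v x) = 2 * (ψ x * fderiv ℝ ψ x (v x)) := by
    intro x
    rw [fderiv_fun_mul (hψd x) (hψd x)]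
    simp
    ring
  -- ψ ∇ψ = ∇(ψ²)/2, and ψ² is integrable and smooth but not compactly supported, hence the extended
  -- form of the divergence-free condition.
  have hzero : drift v ψ ψ = 0 := by
    have h := hdiv.integral_fderiv_eq_zero hv.1 hU (g := fun y => ψ y * ψ y)
      (hw.contDiff_reInv.mul hw.contDiff_reInv) (hw.memLp_reInv.integrable_mul hw.memLp_reInv)
      (by simp_rw [hg]; exact hi2.const_mul 2)
    simp_rw [hg, integral_const_mul] at h
    unfold drift
    linarith
  have e : drift v f ψ = ∫ x, (f - ψ) x * fderiv ℝ ψ x (v x) := by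
    rw [← sub_zero (drift v f ψ), ← hzero, drift, drift, ← integral_sub hi1 hi2]
    simp only [Pi.sub_apply, sub_mul]
    rfl
  have hsub : MemLp (f - ψ) 2 := hf.sub hw.memLp_reInv
  rw [e, ← Real.norm_eq_abs]
  have hi := (integrable_norm_mul_norm hsub hw.memLp_fderiv_reInv).const_mul U
  refine (norm_integral_le_of_norm_le hi ?_).trans ?_
  · filter_upwards [hU] with x hx
    rw [_root_.norm_mul, mul_left_comm]
    gcongr
    rw [mul_comm]
    exact ((fderiv ℝ ψ x).le_opNorm _).trans (by gcongr)
  · rw [integral_const_mul]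
    have h1 := integral_norm_mul_norm_le hsub hw.memLp_fderiv_reInv
    have h2 := hw.l2Norm_sub_reInv_le hf
    have h3 := hw.l2Norm_fderiv_reInv_le
    calc _ ≤ U * (‖hat f - hw.memLp.toLp w‖ *
          (2 * Real.pi * l2Norm (fun ξ => (‖ξ‖ : ℂ) * w ξ))) := by
          gcongr
          refine h1.trans ?_
          gcongr
          exact l2Norm_nonneg _
      _ = _ := by ring

/-- The Laplacian acts as multiplication by -(2π)²|ξ|², which Parseval turns into an inner product
with the transform of f. -/
lemma weakForm_reInv (hw : IsBand R w) (hR : 0 ≤ R) (κ : ℝ) {v : E d → E d} (hv : MemLp v 2)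
    {f : E d → ℝ} (hf : MemLp f 2) :
    weakForm κ v f (reInv w) = drift v f (reInv w)
      - κ * (2 * Real.pi) ^ 2 * (inner ℂ (hw.sq_norm_mul.memLp.toLp _) (hat f)).re := by
  have hb : IsBand R (fun ξ => ((-(2 * Real.pi) ^ 2 * ‖ξ‖ ^ 2 : ℝ) : ℂ) * w ξ) :=
    hw.mul (by fun_prop)
  have e : reInv (fun ξ => ((-(2 * Real.pi) ^ 2 * ‖ξ‖ ^ 2 : ℝ) : ℂ) * w ξ)
      = fun x => -(2 * Real.pi) ^ 2 * reInv (fun ξ => ((‖ξ‖ ^ 2 : ℝ) : ℂ) * w ξ) x := by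
    ext x
    simp only [reInv, Real.fourierInv_eq]
    have : ∀ ξ : E d, (Real.fourierChar (inner ℝ ξ x) : Circle) •
        (((-(2 * Real.pi) ^ 2 * ‖ξ‖ ^ 2 : ℝ) : ℂ) * w ξ)
        = ((-(2 * Real.pi) ^ 2 : ℝ) : ℂ) * ((Real.fourierChar (inner ℝ ξ x) : Circle) •
          (((‖ξ‖ ^ 2 : ℝ) : ℂ) * w ξ)) := by
      intro ξ
      simp only [Circle.smul_def, smul_eq_mul]
      push_cast
      ring
    simp_rw [this]
    rw [integral_const_mul, Complex.re_ofReal_mul]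
  have h2 := hw.sq_norm_mul.integral_mul_reInv hf
  rw [weakForm, ← h2, hw.laplacian_reInv, e]
  have hi2 : Integrable (fun x => f x * reInv (fun ξ => ((‖ξ‖ ^ 2 : ℝ) : ℂ) * w ξ) x) :=
    hf.integrable_mul hw.sq_norm_mul.memLp_reInv
  rw [drift, ← integral_const_mul, ← integral_sub (hw.abs_drift_le hR hv hf).1
    (hi2.const_mul _)]
  refine integral_congr_ae (Eventually.of_forall fun x => ?_)
  simp only
  ring

end IsBand

/-- Restriction of a square integrable function to the closed ball of radius `R`. -/
def cut (R : ℝ) (x : Lp ℂ 2 (volume : Measure (E d))) : E d → ℂ :=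
  (Metric.closedBall (0 : E d) R).indicator x

lemma isBand_cut (R : ℝ) (x : Lp ℂ 2 (volume : Measure (E d))) : IsBand R (cut R x) :=
  ⟨(Lp.memLp x).indicator measurableSet_closedBall, fun ξ hξ =>
    Set.indicator_of_notMem (by simpa using hξ) _⟩

/-- Restriction to a ball as an element of `L²`. -/
def cutLp (R : ℝ) (x : Lp ℂ 2 (volume : Measure (E d))) : Lp ℂ 2 (volume : Measure (E d)) :=
  (isBand_cut R x).memLp.toLp _

/-- The mass of a square integrable function on a ball. -/
def mass (R : ℝ) (x : Lp ℂ 2 (volume : Measure (E d))) : ℝ :=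
  ∫ ξ in Metric.closedBall (0 : E d) R, ‖x ξ‖ ^ 2

lemma l2Norm_eq_norm_toLp {w : E d → ℂ} (hw : MemLp w 2) : l2Norm w = ‖hw.toLp w‖ := by
  rw [Lp.norm_toLp, l2Norm]

lemma cutLp_ae_eq (R : ℝ) (x : Lp ℂ 2 (volume : Measure (E d))) :
    cutLp R x =ᵐ[volume] cut R x := (isBand_cut R x).memLp.coeFn_toLp

lemma cutLp_sub (R : ℝ) (x y : Lp ℂ 2 (volume : Measure (E d))) :
    cutLp R (x - y) = cutLp R x - cutLp R y := by
  unfold cutLp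
  rw [← MemLp.toLp_sub, MemLp.toLp_eq_toLp_iff]
  filter_upwards [Lp.coeFn_sub x y] with ξ hξ
  by_cases h : ξ ∈ Metric.closedBall (0 : E d) R
  · simp only [cut, Pi.sub_apply, Set.indicator_of_mem h]
    exact hξ
  · simp [cut, Set.indicator_of_notMem h]

lemma integrable_sq_norm (x : Lp ℂ 2 (volume : Measure (E d))) :
    Integrable (fun ξ => ‖x ξ‖ ^ 2) := (Lp.memLp x).integrable_norm_pow (by norm_num)

lemma norm_sq_eq_integral (x : Lp ℂ 2 (volume : Measure (E d))) :
    ‖x‖ ^ 2 = ∫ ξ, ‖x ξ‖ ^ 2 := by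
  rw [← sq_l2Norm (Lp.memLp x), l2Norm, Lp.norm_def]

lemma norm_cutLp_sq (R : ℝ) (x : Lp ℂ 2 (volume : Measure (E d))) :
    ‖cutLp R x‖ ^ 2 = mass R x := by
  rw [norm_sq_eq_integral, mass, ← integral_indicator measurableSet_closedBall]
  refine integral_congr_ae ?_
  filter_upwards [cutLp_ae_eq R x] with ξ hξ
  rw [hξ]
  by_cases h : ξ ∈ Metric.closedBall (0 : E d) R <;> simp [cut, h]

lemma mass_nonneg (R : ℝ) (x : Lp ℂ 2 (volume : Measure (E d))) : 0 ≤ mass R x := by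
  rw [← norm_cutLp_sq]
  positivity

lemma mass_le (R : ℝ) (x : Lp ℂ 2 (volume : Measure (E d))) : mass R x ≤ ‖x‖ ^ 2 := by
  rw [norm_sq_eq_integral]
  exact setIntegral_le_integral (integrable_sq_norm x) (Eventually.of_forall fun _ => by positivity)

lemma IsBand.inner_cutLp {R : ℝ} {w : E d → ℂ} (hw : IsBand R w)
    (x : Lp ℂ 2 (volume : Measure (E d))) :
    inner ℂ (hw.memLp.toLp w) (cutLp R x) = inner ℂ (hw.memLp.toLp w) x := by
  rw [L2.inner_def, L2.inner_def]
  refine integral_congr_ae ?_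
  filter_upwards [hw.memLp.coeFn_toLp, cutLp_ae_eq R x] with ξ h1 h2
  rw [h1, h2]
  by_cases h : ξ ∈ Metric.closedBall (0 : E d) R
  · simp [cut, h]
  · rw [hw.eq_zero ξ (by simpa using h)]
    simp

lemma norm_sub_cutLp_sq (R : ℝ) (x : Lp ℂ 2 (volume : Measure (E d))) :
    ‖x - cutLp R x‖ ^ 2 = ‖x‖ ^ 2 - mass R x := by
  have h := (isBand_cut R x).inner_cutLp x
  have h2 := @norm_sub_sq ℂ _ _ _ _ x (cutLp R x)
  have h3 : inner ℂ x (cutLp R x) = inner ℂ (cutLp R x) (cutLp R x) := by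
    rw [← inner_conj_symm, show inner ℂ (cutLp R x) x = inner ℂ (cutLp R x) (cutLp R x) from h.symm,
      inner_conj_symm]
  rw [h2, h3, inner_self_eq_norm_sq, norm_cutLp_sq]
  ring

/-- Identifies the viscous term of the weak form, tested with the truncation of x itself, with the
dissipation on the ball. -/
lemma sq_l2Norm_norm_mul_cut (R : ℝ) (x : Lp ℂ 2 (volume : Measure (E d))) :
    l2Norm (fun ξ => (‖ξ‖ : ℂ) * cut R x ξ) ^ 2
      = (inner ℂ ((isBand_cut R x).sq_norm_mul.memLp.toLp _) x).re := by
  rw [sq_l2Norm (isBand_cut R x).norm_mul.memLp, L2.inner_def]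
  have hi := L2.integrable_inner (𝕜 := ℂ) ((isBand_cut R x).sq_norm_mul.memLp.toLp _) x
  have := integral_re hi
  simp only [RCLike.re_to_complex] at this
  rw [← this]
  refine integral_congr_ae ?_
  filter_upwards [(isBand_cut R x).sq_norm_mul.memLp.coeFn_toLp] with ξ hξ
  rw [hξ]
  by_cases h : ξ ∈ Metric.closedBall (0 : E d) R
  · simp only [cut, Set.indicator_of_mem h, norm_mul, RCLike.inner_apply, map_mul,
      Complex.conj_ofReal]
    rw [mul_left_comm, Complex.mul_conj, ← Complex.ofReal_mul, Complex.ofReal_re, mul_pow,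
      Complex.normSq_eq_norm_sq]
    simp
  · simp [cut, h]

/-- The Fourier splitting inequality: beyond radius ρ the weight |ξ|² is at least ρ². -/
lemma sq_mul_mass_sub_le {ρ : ℝ} (hρ : 0 ≤ ρ) (R : ℝ) (x : Lp ℂ 2 (volume : Measure (E d))) :
    ρ ^ 2 * (mass R x - mass ρ x) ≤ l2Norm (fun ξ => (‖ξ‖ : ℂ) * cut R x ξ) ^ 2 := by
  rw [sq_l2Norm (isBand_cut R x).norm_mul.memLp, mass, mass,
    ← integral_indicator measurableSet_closedBall, ← integral_indicator measurableSet_closedBall,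
    ← integral_sub ((integrable_sq_norm x).indicator measurableSet_closedBall)
      ((integrable_sq_norm x).indicator measurableSet_closedBall), ← integral_const_mul]
  refine integral_mono ((((integrable_sq_norm x).indicator measurableSet_closedBall).sub
      ((integrable_sq_norm x).indicator measurableSet_closedBall)).const_mul _)
    ((isBand_cut R x).norm_mul.memLp.integrable_norm_pow (by norm_num)) fun ξ => ?_
  by_cases h : ξ ∈ Metric.closedBall (0 : E d) R <;>
    by_cases h' : ξ ∈ Metric.closedBall (0 : E d) ρ
  · simp [cut, h, h']
    positivity
  · simp only [cut, Set.indicator_of_mem h, Set.indicator_of_notMem h', norm_mul, sub_zero,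
      Complex.norm_real, norm_norm, mul_pow]
    have : ρ ≤ ‖ξ‖ := by simpa using (not_le.1 (by simpa using h')).le
    gcongr
  -- This case occurs only if R < ρ; the left side is then nonpositive, so no order between the
  -- radii is required.
  · simp only [cut, Set.indicator_of_notMem h, Set.indicator_of_mem h', mul_zero, norm_zero,
      zero_sub]
    have : 0 ≤ ρ ^ 2 * ‖x ξ‖ ^ 2 := by positivity
    simp only [mul_neg]
    linarith
  · simp [cut, h, h']

lemma tendsto_mass (x : Lp ℂ 2 (volume : Measure (E d))) :
    Tendsto (fun n : ℕ => mass n x) atTop (𝓝 (‖x‖ ^ 2)) := by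
  rw [norm_sq_eq_integral]
  simp only [mass, ← integral_indicator measurableSet_closedBall]
  refine tendsto_integral_of_dominated_convergence (fun ξ => ‖x ξ‖ ^ 2)
    (fun n => (integrable_sq_norm x).1.indicator measurableSet_closedBall) (integrable_sq_norm x)
    (fun n => Eventually.of_forall fun ξ => ?_) (Eventually.of_forall fun ξ => ?_)
  · exact (norm_indicator_le_norm_self _ _).trans (by simp)
  · refine tendsto_const_nhds.congr' ?_
    filter_upwards [eventually_ge_atTop ⌈‖ξ‖⌉₊] with n hn
    rw [Set.indicator_of_mem]
    simpa using (Nat.le_ceil _).trans (Nat.cast_le.2 hn)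

end AdvDiff
end

/-! ### The evolution of the Fourier transform of a solution. -/

noncomputable section
namespace AdvDiff
open scoped ContDiff
open Laplacian FourierTransform

variable {d : ℕ}

/-- The properties of a solution of the advection diffusion equation on which the decay estimates
are based: the drift is divergence-free, bounded by `U`, and decays in `L²`. -/
structure IsFlow (κ U K a : ℝ) (u : ℝ → E d → E d) (θ₀ : E d → ℝ) (θ : ℝ → E d → ℝ) : Prop where
  κ_pos : 0 < κ
  U_nonneg : 0 ≤ U
  K_nonneg : 0 ≤ K
  a_pos : 0 < a
  solution : IsSolution κ u θ₀ θ
  memLp_init : MemLp θ₀ 2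
  aestronglyMeasurable : AEStronglyMeasurable (Function.uncurry u)
    ((volume.restrict (Set.Ioi (0 : ℝ))).prod volume)
  memLp : ∀ t, 0 < t → MemLp (u t) 2
  divFree : ∀ t, 0 < t → IsDivFree (u t)
  bounded : ∀ t, 0 < t → ∀ᵐ x, ‖u t x‖ ≤ U
  decay : ∀ t, 0 < t → l2Norm (u t) ≤ K * (1 + t) ^ (-a)

/-- The Fourier transform of the solution, frozen at its initial value for negative times. -/
def hatPath (θ : ℝ → E d → ℝ) (t : ℝ) : Lp ℂ 2 (volume : Measure (E d)) := hat (θ (max t 0))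

lemma hatPath_of_nonneg {θ : ℝ → E d → ℝ} {t : ℝ} (ht : 0 ≤ t) : hatPath θ t = hat (θ t) := by
  rw [hatPath, max_eq_left ht]

namespace IsFlow
variable {κ U K a : ℝ} {u : ℝ → E d → E d} {θ₀ : E d → ℝ} {θ : ℝ → E d → ℝ}

lemma l2Norm_le (h : IsFlow κ U K a u θ₀ θ) {t : ℝ} (ht : 0 < t) : l2Norm (u t) ≤ K := by
  refine (h.decay t ht).trans (mul_le_of_le_one_right h.K_nonneg ?_)
  exact Real.rpow_le_one_of_one_le_of_nonpos (by linarith) (by linarith [h.a_pos])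

lemma continuous_hatPath (h : IsFlow κ U K a u θ₀ θ) : Continuous (hatPath θ) := by
  have hc : ContinuousOn (fun t => hat (θ t)) (Set.Ici 0) := by
    intro s hs
    rw [ContinuousWithinAt, tendsto_iff_norm_sub_tendsto_zero]
    have h1 := (ENNReal.tendsto_toReal ENNReal.zero_ne_top).comp (h.solution.continuous s hs)
    rw [ENNReal.toReal_zero] at h1
    refine h1.congr' ?_
    filter_upwards [self_mem_nhdsWithin] with t ht
    have m1 := h.solution.memLp t ht
    have m2 := h.solution.memLp s hs
    rw [← hat_sub m1 m2, norm_hat (m1.sub m2)]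
    rfl
  exact hc.comp_continuous (by fun_prop) fun t => le_max_right t 0

/-- The initial condition is encoded only in the weak equation: at time 0 it says that θ(0) and θ₀
have the same integrals against all test functions. -/
lemma hatPath_zero (h : IsFlow κ U K a u θ₀ θ) : hatPath θ 0 = hat θ₀ := by
  have m := h.solution.memLp 0 le_rfl
  rw [hatPath_of_nonneg le_rfl]
  refine hat_congr m h.memLp_init ?_
  refine ae_eq_of_integral_contDiff_smul_eq (m.locallyIntegrable (by norm_num))
    (h.memLp_init.locallyIntegrable (by norm_num)) fun ψ hψ hψc => ?_
  have := h.solution.equation ψ hψ hψc 0 le_rfl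
  simp only [intervalIntegral.integral_same, add_zero] at this
  simpa only [smul_eq_mul, mul_comm] using this

lemma exists_norm_hatPath_le (h : IsFlow κ U K a u θ₀ θ) (t : ℝ) :
    ∃ A, 0 ≤ A ∧ ∀ s, 0 ≤ s → s ≤ t → ‖hatPath θ s‖ ≤ A := by
  obtain ⟨A, hA⟩ := (isCompact_Icc (a := (0 : ℝ)) (b := t)).exists_bound_of_continuousOn
    h.continuous_hatPath.continuousOn
  exact ⟨max A 0, le_max_right _ _, fun s h0 h1 => (hA s ⟨h0, h1⟩).trans (le_max_left _ _)⟩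

lemma norm_hatPath (h : IsFlow κ U K a u θ₀ θ) {t : ℝ} (ht : 0 ≤ t) :
    ‖hatPath θ t‖ = l2Norm (θ t) := by
  rw [hatPath_of_nonneg ht, norm_hat (h.solution.memLp t ht)]

/-- The weak formulation in Fourier variables. -/
lemma inner_hatPath_sub (h : IsFlow κ U K a u θ₀ θ) {R : ℝ} (hR : 0 ≤ R) {w : E d → ℂ}
    (hw : IsBand R w) {s t : ℝ} (hs : 0 ≤ s) (hst : s ≤ t) :
    IntervalIntegrable (fun τ => weakForm κ (u τ) (θ τ) (reInv w)) volume s t ∧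
    (inner ℂ (hw.memLp.toLp w) (hatPath θ t - hatPath θ s)).re
      = ∫ τ in s..t, weakForm κ (u τ) (θ τ) (reInv w) := by
  obtain ⟨A, -, hA⟩ := h.exists_norm_hatPath_le t
  have hA' : ∀ τ, 0 < τ → τ ≤ t → l2Norm (θ τ) ≤ A := fun τ h1 h2 => by
    rw [← h.norm_hatPath h1.le]
    exact hA τ h1.le h2
  obtain ⟨i1, e1⟩ := h.solution.integral_mul_eq h.memLp_init h.aestronglyMeasurable h.memLp
    (fun _ => h.l2Norm_le) (hs.trans hst) hA' (hw.isTestFun_reInv hR)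
  obtain ⟨i2, e2⟩ := h.solution.integral_mul_eq h.memLp_init h.aestronglyMeasurable h.memLp
    (fun _ => h.l2Norm_le) hs (fun τ h1 h2 => hA' τ h1 (h2.trans hst)) (hw.isTestFun_reInv hR)
  rw [hw.integral_mul_reInv (h.solution.memLp t (hs.trans hst))] at e1
  rw [hw.integral_mul_reInv (h.solution.memLp s hs)] at e2
  refine ⟨i2.symm.trans i1, ?_⟩
  rw [inner_sub_right, Complex.sub_re, hatPath_of_nonneg hs, hatPath_of_nonneg (hs.trans hst), e1, e2,
    ← intervalIntegral.integral_interval_sub_left i1 i2]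
  ring

/-- Duality: taking for w the truncated increment itself makes the left side of the weak formulation
its squared norm, and one factor of the norm cancels. -/
lemma norm_cutLp_sub_le (h : IsFlow κ U K a u θ₀ θ) {R : ℝ} (hR : 0 ≤ R) {s t : ℝ} (hs : 0 ≤ s)
    (hst : s ≤ t) {g : ℝ → ℝ} (hg : IntervalIntegrable g volume s t)
    (hg0 : ∀ τ ∈ Set.Icc s t, 0 ≤ g τ)
    (hle : ∀ w : E d → ℂ, ∀ _ : IsBand R w, ∀ τ, 0 < τ → s ≤ τ → τ ≤ t →
      weakForm κ (u τ) (θ τ) (reInv w) ≤ g τ * l2Norm w) :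
    ‖cutLp R (hatPath θ t) - cutLp R (hatPath θ s)‖ ≤ ∫ τ in s..t, g τ := by
  rw [← cutLp_sub]
  set y := hatPath θ t - hatPath θ s
  have hw := isBand_cut R y
  obtain ⟨hi, he⟩ := h.inner_hatPath_sub hR hw hs hst
  have h1 : ‖cutLp R y‖ ^ 2 = (inner ℂ (hw.memLp.toLp (cut R y)) y).re := by
    rw [← hw.inner_cutLp]
    exact (inner_self_eq_norm_sq (𝕜 := ℂ) (cutLp R y)).symm
  have h2 : l2Norm (cut R y) = ‖cutLp R y‖ := l2Norm_eq_norm_toLp _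
  have h3 : ‖cutLp R y‖ ^ 2 ≤ (∫ τ in s..t, g τ) * ‖cutLp R y‖ := by
    rw [h1, he, ← intervalIntegral.integral_mul_const]
    refine intervalIntegral.integral_mono_on_of_le_Ioo hst hi (hg.mul_const _) fun τ hτ => ?_
    rw [← h2]
    exact hle _ hw τ (hs.trans_lt hτ.1) hτ.1.le hτ.2.le
  have h4 : 0 ≤ ∫ τ in s..t, g τ := intervalIntegral.integral_nonneg hst hg0
  rcases (norm_nonneg (cutLp R y)).eq_or_lt with h0 | h0
  · rwa [← h0]
  · nlinarith

lemma weakForm_le (h : IsFlow κ U K a u θ₀ θ) {R : ℝ} (hR : 0 ≤ R) {w : E d → ℂ}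
    (hw : IsBand R w) {τ : ℝ} (hτ : 0 < τ) :
    weakForm κ (u τ) (θ τ) (reInv w)
      ≤ (2 * Real.pi * R * √(volume.real (Metric.closedBall (0 : E d) R))
          * (‖hatPath θ τ‖ * (K * (1 + τ) ^ (-a)))
        + κ * (2 * Real.pi) ^ 2 * R ^ 2 * ‖cutLp R (hatPath θ τ)‖) * l2Norm w := by
  have m := h.solution.memLp τ hτ.le
  have hl := l2Norm_nonneg w
  rw [hw.weakForm_reInv hR κ (h.memLp τ hτ) m, ← hatPath_of_nonneg hτ.le,
    ← hw.sq_norm_mul.inner_cutLp]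
  have h1 := (le_abs_self _).trans (hw.abs_drift_le hR (h.memLp τ hτ) m).2
  rw [← h.norm_hatPath hτ.le] at h1
  have h2 : -(inner ℂ (hw.sq_norm_mul.memLp.toLp _) (cutLp R (hatPath θ τ))).re
      ≤ R ^ 2 * l2Norm w * ‖cutLp R (hatPath θ τ)‖ := by
    refine (neg_le_abs _).trans ((Complex.abs_re_le_norm _).trans ((norm_inner_le_norm _ _).trans ?_))
    gcongr
    rw [← l2Norm_eq_norm_toLp]
    have e : (fun ξ => ((‖ξ‖ ^ 2 : ℝ) : ℂ) * w ξ) = fun ξ => (‖ξ‖ : ℂ) * ((‖ξ‖ : ℂ) * w ξ) := by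
      ext ξ
      push_cast
      ring
    rw [e, pow_two, mul_assoc]
    exact (hw.norm_mul.l2Norm_norm_mul_le hR).trans
      (mul_le_mul_of_nonneg_left (hw.l2Norm_norm_mul_le hR) hR)
  have h3 := h.decay τ hτ
  have hκ := h.κ_pos
  calc _ ≤ 2 * Real.pi * R * √(volume.real (Metric.closedBall (0 : E d) R)) * l2Norm w
          * (‖hatPath θ τ‖ * (K * (1 + τ) ^ (-a)))
        + κ * (2 * Real.pi) ^ 2 * (R ^ 2 * l2Norm w * ‖cutLp R (hatPath θ τ)‖) := by
        rw [sub_eq_add_neg, ← mul_neg]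
        gcongr
        exact h1.trans (by gcongr)
    _ = _ := by ring

/-- The mass on a ball is differentiable from above along the flow, with the expected bound. -/
lemma eventually_slope_mass_lt (h : IsFlow κ U K a u θ₀ θ) {R : ℝ} (hR : 0 ≤ R) {x : ℝ}
    (hx : 0 ≤ x) {g : ℝ → ℝ} (hg : ContinuousOn g (Set.Ici 0))
    (hdrift : ∀ τ, x < τ → drift (u τ) (θ τ) (reInv (cut R (hatPath θ x))) ≤ g τ) {r : ℝ}
    (hr : 2 * g x - 2 * κ * (2 * Real.pi) ^ 2
      * l2Norm (fun ξ => (‖ξ‖ : ℂ) * cut R (hatPath θ x) ξ) ^ 2 < r) :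
    ∀ᶠ z in 𝓝[>] x, slope (fun t => mass R (hatPath θ t)) x z < r := by
  have hc := h.continuous_hatPath
  have hw := isBand_cut R (hatPath θ x)
  set q := hw.sq_norm_mul.memLp.toLp _ with hq
  -- G bounds the weak form tested with the truncation frozen at time x. The maximum makes it
  -- continuous on the whole line, as the fundamental theorem of calculus at x requires.
  set G : ℝ → ℝ := fun τ => g (max τ 0)
    - κ * (2 * Real.pi) ^ 2 * (inner ℂ q (hatPath θ τ)).re with hG
  have hGc : Continuous G := by
    have h1 : Continuous (fun τ : ℝ => g (max τ 0)) :=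
      hg.comp_continuous (by fun_prop) fun t => le_max_right t 0
    have h2 : Continuous (fun τ => (inner ℂ q (hatPath θ τ)).re) :=
      Complex.continuous_re.comp (continuous_const.inner hc)
    exact h1.sub (h2.const_mul _)
  obtain ⟨A, hA0, hA⟩ := h.exists_norm_hatPath_le (x + 1)
  set V := √(volume.real (Metric.closedBall (0 : E d) R))
  set L := 2 * Real.pi * R * V * (A * K) + κ * (2 * Real.pi) ^ 2 * R ^ 2 * A with hL
  have hK := h.K_nonneg
  have hκ := h.κ_pos
  have hL0 : 0 ≤ L := by positivity
  -- The increment of the mass is 2 Re⟨c(x), c(z) - c(x)⟩ + ‖c(z) - c(x)‖² with c the truncated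
  -- transform. The first term is at most 2∫G, the second is O((z - x)²) since c is Lipschitz with
  -- constant L near x. So Φ majorises the increment and has derivative 2 G(x).
  set Φ : ℝ → ℝ := fun z => 2 * (∫ τ in x..z, G τ) + L ^ 2 * (z - x) ^ 2 with hΦ
  have hΦd : HasDerivAt Φ (2 * G x + L ^ 2 * (2 * (x - x) ^ 1 * 1)) x := by
    refine HasDerivAt.add ?_ ?_
    · exact (intervalIntegral.integral_hasDerivAt_right (hGc.intervalIntegrable _ _)
        (hGc.stronglyMeasurableAtFilter _ _) hGc.continuousAt).const_mul 2
    · exact (((hasDerivAt_id x).sub_const x).pow 2).const_mul _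
  have hΦ' : 2 * G x + L ^ 2 * (2 * (x - x) ^ 1 * 1) < r := by
    simp only [hG, sub_self, max_eq_left hx]
    rw [sq_l2Norm_norm_mul_cut] at hr
    linarith
  have hev := ((hasDerivAt_iff_tendsto_slope.1 hΦd).mono_left
    (nhdsWithin_mono x (fun z (hz : x < z) => hz.ne'))).eventually_lt_const hΦ'
  filter_upwards [hev, Ioc_mem_nhdsGT (lt_add_one x)] with z hz hzx
  refine lt_of_le_of_lt ?_ hz
  have hpos : 0 < z - x := sub_pos.2 hzx.1
  rw [slope_def_field, slope_def_field]
  refine div_le_div_of_nonneg_right ?_ hpos.le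
  have hΦx : Φ x = 0 := by simp [hΦ]
  rw [hΦx, sub_zero]
  obtain ⟨hi, he⟩ := h.inner_hatPath_sub hR hw hx hzx.1.le
  have h1 : (inner ℂ (cutLp R (hatPath θ x)) (cutLp R (hatPath θ z) - cutLp R (hatPath θ x))).re
      ≤ ∫ τ in x..z, G τ := by
    have e : (inner ℂ (cutLp R (hatPath θ x)) (cutLp R (hatPath θ z) - cutLp R (hatPath θ x))).re
        = (inner ℂ (hw.memLp.toLp _) (hatPath θ z - hatPath θ x)).re := by
      rw [← cutLp_sub, ← hw.inner_cutLp]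
      rfl
    rw [e, he]
    refine intervalIntegral.integral_mono_on_of_le_Ioo hzx.1.le hi (hGc.intervalIntegrable _ _)
      fun τ hτ => ?_
    have h0τ : 0 < τ := hx.trans_lt hτ.1
    rw [hw.weakForm_reInv hR κ (h.memLp τ h0τ) (h.solution.memLp τ h0τ.le)]
    simp only [hG, max_eq_left h0τ.le, ← hatPath_of_nonneg h0τ.le]
    gcongr
    exact hdrift τ hτ.1
  have h2 : ‖cutLp R (hatPath θ z) - cutLp R (hatPath θ x)‖ ≤ L * (z - x) := by
    have := h.norm_cutLp_sub_le hR hx hzx.1.le (g := fun _ => L) intervalIntegrable_const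
      (fun _ _ => hL0) fun w hw τ h0 h1 h2 => ?_
    · rw [intervalIntegral.integral_const, smul_eq_mul] at this
      linarith
    refine (h.weakForm_le hR hw h0).trans ?_
    have hAτ := hA τ h0.le (h2.trans hzx.2)
    have hcA : ‖cutLp R (hatPath θ τ)‖ ≤ A := by
      refine le_trans ?_ hAτ
      rw [← sq_le_sq₀ (norm_nonneg _) (norm_nonneg _), norm_cutLp_sq]
      exact mass_le _ _
    have hKτ : K * (1 + τ) ^ (-a) ≤ K := mul_le_of_le_one_right hK
      (Real.rpow_le_one_of_one_le_of_nonpos (by linarith) (by linarith [h.a_pos]))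
    have hp : 0 ≤ K * (1 + τ) ^ (-a) := by positivity
    refine mul_le_mul_of_nonneg_right ?_ (l2Norm_nonneg w)
    rw [hL]
    gcongr
  have e3 : mass R (hatPath θ z) - mass R (hatPath θ x)
      = 2 * (inner ℂ (cutLp R (hatPath θ x)) (cutLp R (hatPath θ z) - cutLp R (hatPath θ x))).re
        + ‖cutLp R (hatPath θ z) - cutLp R (hatPath θ x)‖ ^ 2 := by
    rw [← norm_cutLp_sq, ← norm_cutLp_sq]
    have := @norm_add_sq ℂ _ _ _ _ (cutLp R (hatPath θ x))
      (cutLp R (hatPath θ z) - cutLp R (hatPath θ x))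
    rw [add_sub_cancel] at this
    rw [this]
    simp only [RCLike.re_to_complex]
    ring
  rw [e3]
  have h4 : ‖cutLp R (hatPath θ z) - cutLp R (hatPath θ x)‖ ^ 2 ≤ (L * (z - x)) ^ 2 := by gcongr
  simp only [hΦ]
  nlinarith

/-- Truncation is a contraction of L², so continuity passes from the path to the mass. -/
lemma continuous_mass (h : IsFlow κ U K a u θ₀ θ) (R : ℝ) :
    Continuous fun t => mass R (hatPath θ t) := by
  have hl : LipschitzWith 1 (cutLp (d := d) R) := LipschitzWith.of_dist_le_mul fun x y => by
    rw [dist_eq_norm, dist_eq_norm, ← cutLp_sub, NNReal.coe_one, one_mul,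
      ← sq_le_sq₀ (norm_nonneg _) (norm_nonneg _), norm_cutLp_sq]
    exact mass_le _ _
  simp_rw [← norm_cutLp_sq]
  exact ((hl.continuous.comp h.continuous_hatPath).norm).pow 2

end IsFlow
end AdvDiff
end

/-! ### Energy inequality and low frequency estimates by comparison with barriers. -/

noncomputable section
namespace AdvDiff

variable {d : ℕ}

lemma hasDerivAt_one_add_rpow (p : ℝ) {x : ℝ} (hx : 0 ≤ x) :
    HasDerivAt (fun t : ℝ => (1 + t) ^ p) (p * (1 + x) ^ (p - 1)) x := by
  have h1 : HasDerivAt (fun t : ℝ => 1 + t) 1 x := (hasDerivAt_id x).const_add 1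
  simpa using h1.rpow_const (p := p) (Or.inl (by linarith))

namespace IsFlow
variable {κ U K a : ℝ} {u : ℝ → E d → E d} {θ₀ : E d → ℝ} {θ : ℝ → E d → ℝ}

/-- The energy dissipation as a comparison principle: the energy stays below every barrier that
decreases less fast than the dissipation dictates. -/
lemma norm_sq_le_of_barrier (h : IsFlow κ U K a u θ₀ θ) {T : ℝ} (hT : 0 ≤ T) {B B' : ℝ → ℝ}
    (hB : ∀ x, 0 ≤ x → HasDerivAt B (B' x) x) (h0 : ‖hatPath θ 0‖ ^ 2 ≤ B 0)
    (hbound : ∀ R, 0 ≤ R → ∀ x, 0 ≤ x → B x ≤ mass R (hatPath θ x) →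
      -(κ * (2 * Real.pi) ^ 2 * l2Norm (fun ξ => (‖ξ‖ : ℂ) * cut R (hatPath θ x) ξ) ^ 2) < B' x) :
    ‖hatPath θ T‖ ^ 2 ≤ B T := by
  have hc := h.continuous_hatPath
  have hκ := h.κ_pos
  have hU := h.U_nonneg
  -- The price of truncation: the energy beyond R, weighted as Young's inequality requires.
  set e : ℝ → ℝ → ℝ := fun R t => U ^ 2 / κ * (‖hatPath θ t‖ ^ 2 - mass R (hatPath θ t)) with he
  have hec : ∀ R, Continuous (e R) := fun R =>
    ((hc.norm.pow 2).sub (h.continuous_mass R)).const_mul _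
  have he0 : ∀ R t, 0 ≤ e R t := fun R t =>
    mul_nonneg (by positivity) (sub_nonneg.2 (mass_le _ _))
  have key : ∀ R, 0 ≤ R → mass R (hatPath θ T) - ∫ τ in (0 : ℝ)..T, e R τ ≤ B T := by
    intro R hR
    have hEd : ∀ x, HasDerivAt (fun t => ∫ τ in (0 : ℝ)..t, e R τ) (e R x) x := fun x =>
      intervalIntegral.integral_hasDerivAt_right ((hec R).intervalIntegrable _ _)
        ((hec R).stronglyMeasurableAtFilter _ _) (hec R).continuousAt
    refine image_le_of_liminf_slope_right_lt_deriv_boundary'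
      (f := fun t => mass R (hatPath θ t) - ∫ τ in (0 : ℝ)..t, e R τ) (a := 0) (b := T)
      (f' := fun x => -(κ * (2 * Real.pi) ^ 2
        * l2Norm (fun ξ => (‖ξ‖ : ℂ) * cut R (hatPath θ x) ξ) ^ 2)) ?_ ?_ ?_ ?_
      (fun x hx => (hB x hx.1).hasDerivWithinAt) ?_ (Set.right_mem_Icc.2 hT)
    · exact ((h.continuous_mass R).sub
        (continuous_iff_continuousAt.2 fun x => (hEd x).continuousAt)).continuousOn
    · intro x hx r hr
      have hw := isBand_cut R (hatPath θ x)
      set b := l2Norm (fun ξ => (‖ξ‖ : ℂ) * cut R (hatPath θ x) ξ) with hb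
      set f' := -(κ * (2 * Real.pi) ^ 2 * b ^ 2) with hf'
      set g : ℝ → ℝ := fun τ => 2 * Real.pi * U * ‖hatPath θ τ - cutLp R (hatPath θ x)‖ * b with hg
      have hgc : Continuous g :=
        (((hc.sub continuous_const).norm).const_mul _).mul_const _
      have hdr : ∀ τ, x < τ → drift (u τ) (θ τ) (reInv (cut R (hatPath θ x))) ≤ g τ := by
        intro τ hτ
        have h0τ : 0 < τ := hx.1.trans_lt hτ
        simp only [hg]
        rw [hatPath_of_nonneg h0τ.le]
        exact (le_abs_self _).trans (hw.abs_drift_le_of_isDivFree hR (h.memLp τ h0τ)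
          (h.divFree τ h0τ) hU (h.bounded τ h0τ) (h.solution.memLp τ h0τ.le))
      have hg2 : 2 * g x - 2 * κ * (2 * Real.pi) ^ 2 * b ^ 2 ≤ f' + e R x := by
        set s := ‖hatPath θ x - cutLp R (hatPath θ x)‖ with hs
        have e1 : e R x = U ^ 2 / κ * s ^ 2 := by
          simp only [he]
          rw [hs, norm_sub_cutLp_sq]
        -- Completing the square absorbs the drift into half of the dissipation. This is why f'
        -- carries the factor κ and not 2κ.
        have e2 : f' + e R x - (2 * g x - 2 * κ * (2 * Real.pi) ^ 2 * b ^ 2)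
            = (κ * (2 * Real.pi) * b - U * s) ^ 2 / κ := by
          rw [e1, hf']
          simp only [hg]
          rw [← hs]
          field_simp
          ring
        have : 0 ≤ (κ * (2 * Real.pi) * b - U * s) ^ 2 / κ := by positivity
        linarith
      -- The slack r - f' is shared equally between the slope of the mass and the slope of the
      -- integral of e.
      have hev1 := h.eventually_slope_mass_lt hR hx.1 hgc.continuousOn hdr
        (r := f' + e R x + (r - f') / 2) (by linarith)
      have hev2 := ((hasDerivAt_iff_tendsto_slope.1 (hEd x)).mono_left
        (nhdsWithin_mono x (fun z (hz : x < z) => hz.ne'))).eventually_const_lt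
        (show e R x - (r - f') / 2 < e R x by linarith)
      refine Eventually.frequently ?_
      filter_upwards [hev1, hev2] with z h1 h2
      rw [slope_def_field] at h1 h2 ⊢
      rw [sub_sub_sub_comm, sub_div]
      linarith
    · simp only [intervalIntegral.integral_same, sub_zero]
      exact (mass_le _ _).trans h0
    · exact fun x hx => (hB x hx.1).continuousAt.continuousWithinAt
    -- At a contact point mass = B + ∫ e ≥ B, which is the condition under which the barrier
    -- hypothesis may be used.
    · intro x hx hxB
      refine hbound R hR x hx.1 ?_
      have : 0 ≤ ∫ τ in (0 : ℝ)..x, e R τ :=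
        intervalIntegral.integral_nonneg hx.1 fun τ _ => he0 R τ
      linarith
  -- As R → ∞ the truncation error vanishes at each time, boundedly on (0, T].
  have hlim : Tendsto (fun n : ℕ => mass n (hatPath θ T) - ∫ τ in (0 : ℝ)..T, e n τ) atTop
      (𝓝 (‖hatPath θ T‖ ^ 2 - ∫ τ in (0 : ℝ)..T, (0 : ℝ))) := by
    refine (tendsto_mass _).sub ?_
    obtain ⟨A, hA0, hA⟩ := h.exists_norm_hatPath_le T
    refine intervalIntegral.tendsto_integral_filter_of_dominated_convergence
      (fun _ => U ^ 2 / κ * A ^ 2)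
      (Eventually.of_forall fun n => (hec n).aestronglyMeasurable)
      (Eventually.of_forall fun n => Eventually.of_forall fun s hs => ?_)
      intervalIntegrable_const (Eventually.of_forall fun s hs => ?_)
    · rw [Set.uIoc_of_le hT] at hs
      rw [Real.norm_of_nonneg (he0 _ _)]
      simp only [he]
      have h1 := mass_nonneg n (hatPath θ s)
      have h2 := hA s hs.1.le hs.2
      have h3 : ‖hatPath θ s‖ ^ 2 ≤ A ^ 2 := by gcongr
      gcongr
      linarith
    · have := ((tendsto_mass (hatPath θ s)).const_sub (‖hatPath θ s‖ ^ 2)).const_mul (U ^ 2 / κ)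
      simpa [he] using this
  simp only [intervalIntegral.integral_zero, sub_zero] at hlim
  exact le_of_tendsto hlim (Eventually.of_forall fun n => key n (Nat.cast_nonneg n))

/-- The barrier is constant up to a slope ε/(1 + T), which supplies the strict inequality and costs
only ε at time T. -/
lemma norm_hatPath_le (h : IsFlow κ U K a u θ₀ θ) {T : ℝ} (hT : 0 ≤ T) :
    ‖hatPath θ T‖ ≤ ‖hatPath θ 0‖ := by
  have hκ := h.κ_pos
  rw [← sq_le_sq₀ (norm_nonneg _) (norm_nonneg _)]
  refine le_of_forall_pos_le_add fun ε hε => ?_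
  have h1T : 0 < 1 + T := by linarith
  have := h.norm_sq_le_of_barrier hT
    (B := fun x => ‖hatPath θ 0‖ ^ 2 + ε / (1 + T) * (1 + x)) (B' := fun _ => ε / (1 + T))
    (fun x _ => by
      simpa using (((hasDerivAt_id x).const_add 1).const_mul (ε / (1 + T))).const_add
        (‖hatPath θ 0‖ ^ 2))
    (by
      have : 0 ≤ ε / (1 + T) * (1 + 0) := by positivity
      linarith)
    (fun R _ x _ _ => by
      have h1 : 0 < ε / (1 + T) := by positivity
      have h2 : 0 ≤ κ * (2 * Real.pi) ^ 2
        * l2Norm (fun ξ => (‖ξ‖ : ℂ) * cut R (hatPath θ x) ξ) ^ 2 := by positivity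
      linarith)
  simpa [h1T.ne'] using this

/-- The rate at which the drift can change the part of the solution at frequencies below `ρ`. -/
def lowFreqRate (d : ℕ) (A K ρ : ℝ) : ℝ :=
  2 * Real.pi * ρ * √(volume.real (Metric.closedBall (0 : E d) ρ)) * (A * K)

lemma lowFreqRate_nonneg {A K ρ : ℝ} (hA : 0 ≤ A) (hK : 0 ≤ K) (hρ : 0 ≤ ρ) :
    0 ≤ lowFreqRate d A K ρ := by
  unfold lowFreqRate
  positivity

/-- Viscosity only lowers the mass and is dropped. What remains says that the norm s of the low
frequencies satisfies (s²)' ≤ 2 c (1 + t)^(-a) s, that is, s' ≤ c (1 + t)^(-a). The ε term of Q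
makes the comparison strict and keeps Q positive. -/
lemma norm_cutLp_le (h : IsFlow κ U K a u θ₀ θ) (ha : a < 1) {ρ : ℝ} (hρ : 0 ≤ ρ) {T : ℝ}
    (hT : 0 ≤ T) :
    ‖cutLp ρ (hatPath θ T)‖ ≤ ‖cutLp ρ (hatPath θ 0)‖
      + lowFreqRate d ‖hatPath θ 0‖ K ρ / (1 - a) * (1 + T) ^ (1 - a) := by
  have hκ := h.κ_pos
  have hK := h.K_nonneg
  set A := ‖hatPath θ 0‖ with hA
  have hA0 : 0 ≤ A := norm_nonneg _
  set c := lowFreqRate d A K ρ with hc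
  have hc0 : 0 ≤ c := lowFreqRate_nonneg hA0 hK hρ
  have ha' : 0 < 1 - a := by linarith
  refine le_of_forall_pos_le_add fun ε hε => ?_
  have h1T : 0 < 1 + T := by linarith
  set s₀ := ‖cutLp ρ (hatPath θ 0)‖
  have hs₀ : 0 ≤ s₀ := norm_nonneg _
  set Q : ℝ → ℝ := fun x => s₀ + c / (1 - a) * (1 + x) ^ (1 - a) + ε / (1 + T) * (1 + x) with hQ
  set Q' : ℝ → ℝ := fun x => c * (1 + x) ^ (-a) + ε / (1 + T) with hQ'
  have hQ0 : ∀ x, 0 ≤ x → 0 < Q x := fun x hx => by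
    have : 0 < 1 + x := by linarith
    positivity
  have hQd : ∀ x, 0 ≤ x → HasDerivAt Q (Q' x) x := by
    intro x hx
    have h1 := (((hasDerivAt_one_add_rpow (1 - a) hx).const_mul (c / (1 - a))).const_add s₀).add
      (((hasDerivAt_id x).const_add 1).const_mul (ε / (1 + T)))
    convert! h1 using 1
    simp only [hQ']
    rw [show 1 - a - 1 = -a by ring]
    field_simp
  have hle : mass ρ (hatPath θ T) ≤ Q T ^ 2 := by
    refine image_le_of_liminf_slope_right_lt_deriv_boundary'
      (f := fun t => mass ρ (hatPath θ t)) (a := 0) (b := T)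
      (f' := fun x => 2 * (c * (1 + x) ^ (-a) * ‖cutLp ρ (hatPath θ x)‖))
      (B := fun x => Q x ^ 2) (B' := fun x => 2 * (Q x * Q' x)) ?_ ?_ ?_ ?_ ?_ ?_
      (Set.right_mem_Icc.2 hT)
    · exact (h.continuous_mass ρ).continuousOn
    · intro x hx r hr
      have hw := isBand_cut ρ (hatPath θ x)
      refine (h.eventually_slope_mass_lt hρ hx.1
        (g := fun τ => c * (1 + τ) ^ (-a) * ‖cutLp ρ (hatPath θ x)‖) ?_ ?_ ?_).frequently
      · intro τ hτ
        exact (((hasDerivAt_one_add_rpow (-a) hτ).continuousAt.const_mul c).mul_const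
          _).continuousWithinAt
      · intro τ hτ
        have h0τ : 0 < τ := hx.1.trans_lt hτ
        refine (le_abs_self _).trans ((hw.abs_drift_le hρ (h.memLp τ h0τ)
          (h.solution.memLp τ h0τ.le)).2.trans ?_)
        rw [← h.norm_hatPath h0τ.le, l2Norm_eq_norm_toLp hw.memLp]
        have h1 := h.norm_hatPath_le h0τ.le
        have h2 := h.decay τ h0τ
        have h3 : 0 ≤ l2Norm (u τ) := l2Norm_nonneg _
        calc _ ≤ 2 * Real.pi * ρ * √(volume.real (Metric.closedBall (0 : E d) ρ))
              * ‖cutLp ρ (hatPath θ x)‖ * (A * (K * (1 + τ) ^ (-a))) := by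
              gcongr
              exact le_rfl
          _ = _ := by
              simp only [hc, lowFreqRate]
              ring
      · refine lt_of_le_of_lt ?_ hr
        have : 0 ≤ 2 * κ * (2 * Real.pi) ^ 2
          * l2Norm (fun ξ => (‖ξ‖ : ℂ) * cut ρ (hatPath θ x) ξ) ^ 2 := by positivity
        linarith
    · rw [← norm_cutLp_sq]
      gcongr
      simp only [hQ, add_zero, Real.one_rpow, mul_one, add_assoc]
      exact le_add_of_nonneg_right (by positivity)
    · exact fun x hx => ((hQd x hx.1).continuousAt.pow 2).continuousWithinAt
    · intro x hx
      have := (hQd x hx.1).pow 2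
      refine HasDerivAt.hasDerivWithinAt ?_
      convert! this using 1
      simp
      ring
    · intro x hx hxQ
      rw [← norm_cutLp_sq] at hxQ
      have h1 : ‖cutLp ρ (hatPath θ x)‖ = Q x :=
        (pow_left_inj₀ (norm_nonneg _) (hQ0 x hx.1).le two_ne_zero).1 hxQ
      have h2 : 0 < ε / (1 + T) := by positivity
      have h3 := hQ0 x hx.1
      simp only [h1, hQ']
      nlinarith [mul_pos h2 h3]
  rw [← norm_cutLp_sq, sq_le_sq₀ (norm_nonneg _) (hQ0 T hT).le] at hle
  simpa [hQ, h1T.ne'] using hle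

/-- The change is the integrated drift plus viscosity, which acts below ρ with rate at most κ(2π)²ρ²
on a quantity that `norm_cutLp_le` bounds by S throughout [0, T]. -/
lemma norm_cutLp_sub_init_le (h : IsFlow κ U K a u θ₀ θ) (ha : a < 1) {ρ : ℝ} (hρ : 0 ≤ ρ) {T : ℝ}
    (hT : 0 ≤ T) :
    ‖cutLp ρ (hatPath θ T) - cutLp ρ (hatPath θ 0)‖
      ≤ lowFreqRate d ‖hatPath θ 0‖ K ρ / (1 - a) * (1 + T) ^ (1 - a)
        + κ * (2 * Real.pi) ^ 2 * ρ ^ 2 * T * (‖cutLp ρ (hatPath θ 0)‖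
          + lowFreqRate d ‖hatPath θ 0‖ K ρ / (1 - a) * (1 + T) ^ (1 - a)) := by
  have hκ := h.κ_pos
  have hK := h.K_nonneg
  set A := ‖hatPath θ 0‖ with hA
  have hA0 : 0 ≤ A := norm_nonneg _
  set c := lowFreqRate d A K ρ with hc
  have hc0 : 0 ≤ c := lowFreqRate_nonneg hA0 hK hρ
  have ha' : 0 < 1 - a := by linarith
  set S := ‖cutLp ρ (hatPath θ 0)‖ + c / (1 - a) * (1 + T) ^ (1 - a) with hS
  have h1T : 0 < 1 + T := by linarith
  have hS0 : 0 ≤ S := by positivity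
  have hd : ∀ x ∈ Set.uIcc 0 T, HasDerivAt (fun x => c / (1 - a) * (1 + x) ^ (1 - a)
      + κ * (2 * Real.pi) ^ 2 * ρ ^ 2 * S * x)
      (c * (1 + x) ^ (-a) + κ * (2 * Real.pi) ^ 2 * ρ ^ 2 * S) x := by
    intro x hx
    rw [Set.uIcc_of_le hT] at hx
    have h1 := ((hasDerivAt_one_add_rpow (1 - a) hx.1).const_mul (c / (1 - a))).add
      ((hasDerivAt_id x).const_mul (κ * (2 * Real.pi) ^ 2 * ρ ^ 2 * S))
    convert! h1 using 1
    rw [show 1 - a - 1 = -a by ring]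
    field_simp
  have hcont : ContinuousOn (fun x => c * (1 + x) ^ (-a) + κ * (2 * Real.pi) ^ 2 * ρ ^ 2 * S)
      (Set.uIcc 0 T) := by
    intro x hx
    rw [Set.uIcc_of_le hT] at hx
    exact (((hasDerivAt_one_add_rpow (-a) hx.1).continuousAt.const_mul c).add
      continuousAt_const).continuousWithinAt
  have hint := hcont.intervalIntegrable (μ := volume)
  have key := h.norm_cutLp_sub_le hρ le_rfl hT hint (fun τ hτ => by
    have : 0 ≤ 1 + τ := by linarith [hτ.1]
    positivity) (fun w hw τ h0τ _ hτT => by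
    refine (h.weakForm_le hρ hw h0τ).trans ?_
    refine mul_le_mul_of_nonneg_right ?_ (l2Norm_nonneg w)
    have h1 := h.norm_hatPath_le h0τ.le
    have h2 : ‖cutLp ρ (hatPath θ τ)‖ ≤ S := by
      refine (h.norm_cutLp_le ha hρ h0τ.le).trans ?_
      simp only [hS]
      gcongr
    have h3 : 0 ≤ 1 + τ := by linarith
    calc _ ≤ 2 * Real.pi * ρ * √(volume.real (Metric.closedBall (0 : E d) ρ))
          * (A * (K * (1 + τ) ^ (-a))) + κ * (2 * Real.pi) ^ 2 * ρ ^ 2 * S := by gcongr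
      _ = _ := by
        simp only [hc, lowFreqRate]
        ring)
  refine key.trans ?_
  rw [intervalIntegral.integral_eq_sub_of_hasDerivAt hd hint]
  simp only [add_zero, Real.one_rpow, mul_one, mul_zero]
  have : 0 ≤ c / (1 - a) := by positivity
  linarith

end IsFlow
end AdvDiff
end

/-! ### The negative order norm: normalisation, finiteness, and low frequency lower bound. -/

noncomputable section
namespace AdvDiff

variable {d : ℕ}

/-- The low frequency mass in the two normalisations of the Fourier transform. -/
lemma setIntegral_fhat (f : E d → ℝ) {δ : ℝ} (hδ : 0 ≤ δ) :
    ∫ ξ in Metric.closedBall 0 δ, ‖fhat f ξ‖ ^ 2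
      = (2 * Real.pi) ^ d * mass ((2 * Real.pi)⁻¹ * δ) (hat f) := by
  have hpi : 0 < (2 * Real.pi)⁻¹ := by positivity
  have h := Measure.setIntegral_comp_smul_of_pos volume (fun η => ‖plancherel f η‖ ^ 2)
    (Metric.closedBall (0 : E d) δ) hpi
  simp only [fhat]
  rw [h, smul_closedBall _ _ hδ, smul_zero, Real.norm_of_nonneg hpi.le, finrank_euclideanSpace,
    Fintype.card_fin, inv_pow, inv_inv, smul_eq_mul, mass]
  congr 1
  refine setIntegral_congr_ae measurableSet_closedBall ?_
  filter_upwards [plancherel_ae_eq_hat f] with η hη _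
  rw [hη]

lemma sq_invGradNorm (f : E d → ℝ) :
    invGradNorm f ^ 2
      = (2 * Real.pi) ^ d * ((2 * Real.pi)⁻¹ ^ 2 * ∫ η, (‖η‖⁻¹ * ‖hat f η‖) ^ 2) := by
  have hpi : 0 < (2 * Real.pi)⁻¹ := by positivity
  have h := Measure.integral_comp_smul_of_nonneg volume
    (fun η : E d => (2 * Real.pi)⁻¹ ^ 2 * (‖η‖⁻¹ * ‖plancherel f η‖) ^ 2) (2 * Real.pi)⁻¹
    (hR := hpi.le)
  rw [invGradNorm, Real.sq_sqrt (integral_nonneg fun _ => by positivity)]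
  rw [finrank_euclideanSpace, Fintype.card_fin, inv_pow _ d, inv_inv, smul_eq_mul,
    integral_const_mul _ (fun η => (‖η‖⁻¹ * ‖plancherel f η‖) ^ 2)] at h
  have e : ∫ η, (‖η‖⁻¹ * ‖hat f η‖) ^ 2 = ∫ η, (‖η‖⁻¹ * ‖plancherel f η‖) ^ 2 := by
    refine integral_congr_ae ?_
    filter_upwards [plancherel_ae_eq_hat f] with η hη
    rw [hη]
  rw [e, ← h]
  refine integral_congr_ae (Eventually.of_forall fun ξ => ?_)
  simp only [fhat, norm_smul, norm_inv, Real.norm_of_nonneg (show 0 ≤ 2 * Real.pi by positivity)]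
  field_simp

/-- A power bound on the low frequency mass makes the weighted integral finite. -/
lemma integrable_inv_norm_mul (x : Lp ℂ 2 (volume : Measure (E d))) {C p ρ₀ : ℝ} (hp : 2 < p)
    (hρ₀ : 0 < ρ₀) (hC : ∀ ρ, 0 < ρ → ρ ≤ ρ₀ → mass ρ x ≤ C * ρ ^ p) :
    Integrable (fun η => (‖η‖⁻¹ * ‖x η‖) ^ 2) := by
  set g : E d → ℝ := fun η => (‖η‖⁻¹ * ‖x η‖) ^ 2 with hg
  have hx := integrable_sq_norm x
  have hmeas : AEStronglyMeasurable g := by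
    refine ((Measurable.aestronglyMeasurable ?_).mul (Lp.aestronglyMeasurable x).norm).pow 2
    fun_prop
  have hout : ∀ σ : ℝ, 0 < σ → ∀ η : E d, σ < ‖η‖ → ‖g η‖ ≤ σ⁻¹ ^ 2 * ‖x η‖ ^ 2 := by
    intro σ hσ η hη
    simp only [hg]
    rw [Real.norm_of_nonneg (by positivity), mul_pow]
    gcongr
  -- Dyadic annuli: on the n-th one the weight is at most (ρ₀ 2^(-n-1))^(-2) and the mass at most C
  -- (ρ₀ 2^(-n))^p. The sum is geometric with ratio 2^(-(p - 2)) < 1, and the factor 4 comes from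
  -- the shift n + 1.
  set s : ℕ → Set (E d) := fun n => Metric.closedBall 0 (ρ₀ * (1 / 2) ^ n)
    \ Metric.closedBall 0 (ρ₀ * (1 / 2) ^ (n + 1)) with hs
  have hsm : ∀ n, MeasurableSet (s n) := fun n =>
    measurableSet_closedBall.diff measurableSet_closedBall
  have hsb : ∀ n, ∀ η ∈ s n, ‖g η‖ ≤ (ρ₀ * (1 / 2) ^ (n + 1))⁻¹ ^ 2 * ‖x η‖ ^ 2 := by
    intro n η hη
    exact hout _ (by positivity) η (by simpa using hη.2)
  have hsi : ∀ n, IntegrableOn g (s n) := by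
    intro n
    refine Integrable.mono' (hx.const_mul ((ρ₀ * (1 / 2) ^ (n + 1))⁻¹ ^ 2)).integrableOn
      hmeas.restrict ?_
    exact (ae_restrict_iff' (hsm n)).2 (Eventually.of_forall (hsb n))
  have hin : IntegrableOn g (⋃ n, s n) := by
    refine integrableOn_iUnion_of_summable_integral_norm hsi ?_
    set q : ℝ := (1 / 2 : ℝ) ^ (p - 2)
    have hq : q < 1 := Real.rpow_lt_one (by norm_num) (by norm_num) (by linarith)
    have hq0 : 0 ≤ q := by positivity
    refine Summable.of_nonneg_of_le (fun n => by positivity) (fun n => ?_)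
      ((summable_geometric_of_lt_one hq0 hq).mul_left (4 * (C * ρ₀ ^ p) * ρ₀⁻¹ ^ 2))
    have h1 : ∫ η in s n, ‖g η‖ ≤ ∫ η in s n, (ρ₀ * (1 / 2) ^ (n + 1))⁻¹ ^ 2 * ‖x η‖ ^ 2 :=
      setIntegral_mono_on (hsi n).norm (hx.const_mul _).integrableOn (hsm n) (hsb n)
    have h2 : ∫ η in s n, ‖x η‖ ^ 2 ≤ mass (ρ₀ * (1 / 2) ^ n) x :=
      setIntegral_mono_set hx.integrableOn (Eventually.of_forall fun _ => by positivity)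
        (Eventually.of_forall Set.sdiff_subset)
    have h3 := hC (ρ₀ * (1 / 2) ^ n) (by positivity)
      (mul_le_of_le_one_right hρ₀.le (pow_le_one₀ (by norm_num) (by norm_num)))
    rw [integral_const_mul] at h1
    refine h1.trans ((mul_le_mul_of_nonneg_left (h2.trans h3) (by positivity)).trans_eq ?_)
    have e1 : q ^ n = ((1 / 2 : ℝ) ^ n) ^ p * (((1 / 2 : ℝ) ^ n) ^ 2)⁻¹ := by
      rw [← Real.rpow_natCast q, ← Real.rpow_natCast (1 / 2 : ℝ) n,
        ← Real.rpow_mul (by norm_num), ← Real.rpow_mul (by norm_num),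
        ← Real.rpow_natCast (_ ^ (n : ℝ)), ← Real.rpow_mul (by norm_num),
        ← Real.rpow_neg (by norm_num), ← Real.rpow_add (by norm_num)]
      congr 1
      push_cast
      ring
    rw [e1, Real.mul_rpow hρ₀.le (by positivity), pow_succ (1 / 2 : ℝ) n]
    field_simp
    ring
  have hbig : IntegrableOn g {η | ρ₀ < ‖η‖} := by
    refine Integrable.mono' (hx.const_mul (ρ₀⁻¹ ^ 2)).integrableOn hmeas.restrict ?_
    exact (ae_restrict_iff' (measurableSet_lt measurable_const measurable_norm)).2
      (Eventually.of_forall fun η hη => hout _ hρ₀ η hη)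
  have hzero : IntegrableOn g {0} := by
    refine (integrableOn_zero (s := {(0 : E d)})).congr_fun (fun η hη => ?_)
      (measurableSet_singleton _)
    rw [Set.mem_singleton_iff.1 hη]
    simp [hg]
  rw [← integrableOn_univ]
  refine ((hin.union hbig).union hzero).mono_set fun η _ => ?_
  by_cases h0 : η = 0
  · exact Or.inr h0
  refine Or.inl ?_
  by_cases h1 : ρ₀ < ‖η‖
  · exact Or.inr h1
  have hη : 0 < ‖η‖ := norm_pos_iff.2 h0
  obtain ⟨n, hn1, hn2⟩ := exists_nat_pow_near_of_lt_one (x := ‖η‖ / ρ₀) (y := (1 / 2 : ℝ))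
    (by positivity) ((div_le_one hρ₀).2 (not_lt.1 h1)) (by norm_num) (by norm_num)
  refine Or.inl (Set.mem_iUnion.2 ⟨n, ?_, ?_⟩)
  · rw [div_le_iff₀' hρ₀] at hn2
    simpa using hn2
  · rw [lt_div_iff₀' hρ₀] at hn1
    simpa using hn1

/-- Finiteness of `‖∇⁻¹ f‖₂` and a lower bound by the low frequencies. -/
lemma norm_cutLp_le_mul_invGradNorm (hd : 2 ≤ d) (f : E d → ℝ) {C p ρ₀ : ℝ} (hp : 2 < p)
    (hρ₀ : 0 < ρ₀) (hC : ∀ ρ, 0 < ρ → ρ ≤ ρ₀ → mass ρ (hat f) ≤ C * ρ ^ p) {ρ : ℝ} (hρ : 0 < ρ) :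
    ‖cutLp ρ (hat f)‖ ≤ ρ * invGradNorm f := by
  have hi := integrable_inv_norm_mul (hat f) hp hρ₀ hC
  have h0 : 0 ≤ invGradNorm f := Real.sqrt_nonneg _
  refine le_of_sq_le_sq ?_ (by positivity)
  have hae : ∀ᵐ η : E d, η ≠ 0 := by
    have : Nontrivial (E d) := by
      have : Nonempty (Fin d) := ⟨⟨0, by omega⟩⟩
      infer_instance
    exact Measure.ae_ne volume 0
  -- On the ball 1 ≤ ρ/|η| away from the origin, a null set. Integrability matters: otherwise the
  -- integral on the right would be the default 0.
  have h1 : mass ρ (hat f) ≤ ρ ^ 2 * ∫ η, (‖η‖⁻¹ * ‖hat f η‖) ^ 2 := by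
    rw [mass, ← integral_const_mul]
    refine le_trans ?_ (setIntegral_le_integral (s := Metric.closedBall 0 ρ) (hi.const_mul (ρ ^ 2))
      (Eventually.of_forall fun _ => by positivity))
    refine integral_mono_ae (integrable_sq_norm _).integrableOn (hi.const_mul _).integrableOn ?_
    refine (ae_restrict_iff' measurableSet_closedBall).2 ?_
    filter_upwards [hae] with η hη hmem
    have hη' : 0 < ‖η‖ := norm_pos_iff.2 hη
    have : ‖η‖ ≤ ρ := by simpa using hmem
    rw [← mul_pow, ← mul_assoc]
    gcongr
    exact le_mul_of_one_le_left (norm_nonneg _) (by rwa [← div_eq_mul_inv, one_le_div hη'])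
  -- The change of normalisation costs (2π)^(d - 2), which is at least 1 because d ≥ 2.
  have h2 : (1 : ℝ) ≤ (2 * Real.pi) ^ d * (2 * Real.pi)⁻¹ ^ 2 := by
    have : (1 : ℝ) ≤ 2 * Real.pi := by linarith [Real.pi_gt_three]
    rw [inv_pow, ← div_eq_mul_inv, one_le_div (by positivity)]
    exact pow_le_pow_right₀ this hd
  have h3 : 0 ≤ ∫ η, (‖η‖⁻¹ * ‖hat f η‖) ^ 2 := integral_nonneg fun _ => by positivity
  rw [norm_cutLp_sq, mul_pow, sq_invGradNorm, ← mul_assoc ((2 * Real.pi) ^ d)]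
  refine h1.trans ?_
  gcongr
  exact le_mul_of_one_le_left h3 h2

end AdvDiff
end

/-! ### Quantitative decay of the energy and persistence of the low frequencies. -/

noncomputable section
namespace AdvDiff

variable {d : ℕ}

namespace IsFlow
variable {κ U K r : ℝ} {u : ℝ → E d → E d} {θ₀ : E d → ℝ} {θ : ℝ → E d → ℝ}

/-- The constant in the bound for the low frequencies created by the drift. -/
def driftConst (d : ℕ) (r A K : ℝ) : ℝ :=
  2 * Real.pi * √(volume.real (Metric.ball (0 : E d) 1)) * (A * K) / (1 - (1 + r) / 2)

lemma driftConst_nonneg {A K : ℝ} (hr1 : r < 1) (hA : 0 ≤ A) (hK : 0 ≤ K) :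
    0 ≤ driftConst d r A K := by
  have : 0 < 1 - (1 + r) / 2 := by linarith
  unfold driftConst
  positivity

/-- The square root of the volume of the ball contributes ρ^(d/2), and 1 - (1 + r)/2 = (1 - r)/2. -/
lemma lowFreqRate_mul_eq (A K : ℝ) {ρ : ℝ} (hρ : 0 < ρ) (T : ℝ) :
    lowFreqRate d A K ρ / (1 - (1 + r) / 2) * (1 + T) ^ (1 - (1 + r) / 2)
      = driftConst d r A K * (ρ ^ ((d : ℝ) / 2 + 1) * (1 + T) ^ ((1 - r) / 2)) := by
  have e : √(volume.real (Metric.closedBall (0 : E d) ρ))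
      = ρ ^ ((d : ℝ) / 2) * √(volume.real (Metric.ball (0 : E d) 1)) := by
    rw [Measure.addHaar_real_closedBall _ _ hρ.le, finrank_euclideanSpace, Fintype.card_fin,
      Real.sqrt_mul (by positivity), Real.sqrt_eq_rpow (ρ ^ d), ← Real.rpow_natCast,
      ← Real.rpow_mul hρ.le, mul_one_div]
  rw [lowFreqRate, driftConst, e, Real.rpow_add hρ, Real.rpow_one,
    show (1 - r) / 2 = 1 - (1 + r) / 2 by ring]
  ring

lemma norm_cutLp_le_rpow (h : IsFlow κ U K ((1 + r) / 2) u θ₀ θ) (hr1 : r < 1) {M β : ℝ}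
    (hup : ∀ ρ, 0 < ρ → ‖cutLp ρ (hatPath θ 0)‖ ≤ M * ρ ^ β) {ρ : ℝ} (hρ : 0 < ρ) {T : ℝ}
    (hT : 0 ≤ T) :
    ‖cutLp ρ (hatPath θ T)‖ ≤ M * ρ ^ β
      + driftConst d r ‖hatPath θ 0‖ K * (ρ ^ ((d : ℝ) / 2 + 1) * (1 + T) ^ ((1 - r) / 2)) := by
  rw [← lowFreqRate_mul_eq _ _ hρ]
  exact (h.norm_cutLp_le (by linarith) hρ.le hT).trans (by gcongr; exact hup ρ hρ)

/-- Since r < 1, the drift contribution ρ^(d/2 + 1) is no larger than ρ^(r + d/2) for ρ ≤ 1. This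
serves to make ‖∇⁻¹θ(T)‖₂ finite, so growth of the constant in T is harmless. -/
lemma mass_le_rpow (h : IsFlow κ U K ((1 + r) / 2) u θ₀ θ) (hr1 : r < 1) {M : ℝ}
    (hup : ∀ ρ, 0 < ρ → ‖cutLp ρ (hatPath θ 0)‖ ≤ M * ρ ^ (r + (d : ℝ) / 2)) {T : ℝ}
    (hT : 0 ≤ T) {ρ : ℝ} (hρ : 0 < ρ) (hρ1 : ρ ≤ 1) :
    mass ρ (hatPath θ T)
      ≤ (M + driftConst d r ‖hatPath θ 0‖ K * (1 + T) ^ ((1 - r) / 2)) ^ 2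
        * ρ ^ (2 * r + d) := by
  have hD : 0 ≤ driftConst d r ‖hatPath θ 0‖ K :=
    driftConst_nonneg hr1 (norm_nonneg _) h.K_nonneg
  have h1T : 0 ≤ 1 + T := by linarith
  have h1 := h.norm_cutLp_le_rpow hr1 hup hρ hT
  have h2 : ρ ^ ((d : ℝ) / 2 + 1) ≤ ρ ^ (r + (d : ℝ) / 2) :=
    Real.rpow_le_rpow_of_exponent_ge hρ hρ1 (by linarith)
  have h3 : ρ ^ (2 * r + d) = (ρ ^ (r + (d : ℝ) / 2)) ^ 2 := by
    rw [← Real.rpow_natCast, ← Real.rpow_mul hρ.le]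
    congr 1
    push_cast
    ring
  rw [← norm_cutLp_sq, h3, ← mul_pow]
  refine pow_le_pow_left₀ (norm_nonneg _) (h1.trans ?_) 2
  rw [add_mul, mul_assoc _ ((1 + T) ^ _), mul_comm ((1 + T) ^ _)]
  gcongr

/-- Decay of the energy, by splitting at a frequency which decreases like `(1 + t)^(-1/2)`. -/
lemma sq_l2Norm_le (h : IsFlow κ U K ((1 + r) / 2) u θ₀ θ) (hr1 : r < 1) {M β g : ℝ}
    (hβ : β = r + (d : ℝ) / 2) (hβ0 : 0 < β)
    (hup : ∀ ρ, 0 < ρ → ‖cutLp ρ (hatPath θ 0)‖ ≤ M * ρ ^ β) (hg : 0 < g)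
    (hgκ : κ * (2 * Real.pi) ^ 2 * g = 2 * β) {T : ℝ} (hT : 0 ≤ T) :
    l2Norm (θ T) ^ 2 ≤ (2 * (M * g ^ (β / 2) + driftConst d r ‖hatPath θ 0‖ K
      * g ^ (((d : ℝ) / 2 + 1) / 2)) ^ 2 + ‖hatPath θ 0‖ ^ 2 + 1) * (1 + T) ^ (-β) := by
  have hκ := h.κ_pos
  set S := M * g ^ (β / 2) + driftConst d r ‖hatPath θ 0‖ K * g ^ (((d : ℝ) / 2 + 1) / 2) with hS
  set C := 2 * S ^ 2 + ‖hatPath θ 0‖ ^ 2 + 1 with hC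
  rw [← h.norm_hatPath hT]
  refine h.norm_sq_le_of_barrier hT (B := fun x => C * (1 + x) ^ (-β))
    (B' := fun x => C * (-β * (1 + x) ^ (-β - 1)))
    (fun x hx => (hasDerivAt_one_add_rpow (-β) hx).const_mul C) ?_ ?_
  · simp only [add_zero, Real.one_rpow, mul_one, hC]
    nlinarith [sq_nonneg S]
  · intro R hR x hx hB
    have h1x : 0 < 1 + x := by linarith
    -- With κ(2π)²g = 2β the frequencies above ρ dissipate at rate 2β/(1 + x), twice the relative
    -- decay rate β/(1 + x) of the barrier. Those below carry at most S² b, so contact is excluded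
    -- once 2β(C - S²) > βC, that is, C > 2S².
    set ρ := (g / (1 + x)) ^ (1 / 2 : ℝ) with hρd
    have hρ : 0 < ρ := by positivity
    have hpow : ∀ p : ℝ, ρ ^ p = g ^ (p / 2) * (1 + x) ^ (-(p / 2)) := by
      intro p
      rw [hρd, ← Real.rpow_mul (by positivity), Real.div_rpow hg.le h1x.le, Real.rpow_neg h1x.le,
        ← div_eq_mul_inv]
      congr 2 <;> ring
    have hρ2 : ρ ^ 2 = g * (1 + x)⁻¹ := by
      rw [← Real.rpow_natCast, hpow]
      norm_num [Real.rpow_neg_one]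
    have hlow : mass ρ (hatPath θ x) ≤ S ^ 2 * (1 + x) ^ (-β) := by
      have h1 := h.norm_cutLp_le_rpow hr1 hup hρ hx
      have e : M * ρ ^ β + driftConst d r ‖hatPath θ 0‖ K
          * (ρ ^ ((d : ℝ) / 2 + 1) * (1 + x) ^ ((1 - r) / 2)) = S * (1 + x) ^ (-(β / 2)) := by
        rw [hpow, hpow, mul_assoc (g ^ _), ← Real.rpow_add h1x,
          show -(((d : ℝ) / 2 + 1) / 2) + (1 - r) / 2 = -(β / 2) by rw [hβ]; ring, hS]
        ring
      rw [e] at h1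
      have e2 : (1 + x) ^ (-β) = ((1 + x) ^ (-(β / 2))) ^ 2 := by
        rw [← Real.rpow_natCast, ← Real.rpow_mul h1x.le]
        congr 1
        push_cast
        ring
      rw [← norm_cutLp_sq, e2, ← mul_pow]
      exact pow_le_pow_left₀ (norm_nonneg _) h1 2
    have hsplit := sq_mul_mass_sub_le hρ.le R (hatPath θ x)
    set b := (1 + x) ^ (-β)
    have hb : 0 < b := by positivity
    have e3 : (1 + x) ^ (-β - 1) = b * (1 + x)⁻¹ := by
      rw [Real.rpow_sub h1x, Real.rpow_one, div_eq_mul_inv]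
    have h2 : κ * (2 * Real.pi) ^ 2 * (ρ ^ 2 * (C * b - S ^ 2 * b)) ≤ κ * (2 * Real.pi) ^ 2
        * l2Norm (fun ξ => (‖ξ‖ : ℂ) * cut R (hatPath θ x) ξ) ^ 2 := by
      refine mul_le_mul_of_nonneg_left (le_trans ?_ hsplit) (by positivity)
      gcongr
    have e4 : κ * (2 * Real.pi) ^ 2 * (ρ ^ 2 * (C * b - S ^ 2 * b))
        = 2 * β * (1 + x)⁻¹ * b * (C - S ^ 2) := by
      rw [hρ2, ← hgκ]
      ring
    have h3 : 0 < β * (1 + x)⁻¹ * b * (C - 2 * S ^ 2) := by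
      have : 0 < C - 2 * S ^ 2 := by
        rw [hC]
        have := sq_nonneg ‖hatPath θ 0‖
        linarith
      positivity
    rw [e3]
    linarith

/-- Splitting with g = G/κ produces several negative powers of κ. The drift term has the worst one,
κ^(-(d/4 + 1/2)); the others are brought to this form at the cost of powers of κ₁. -/
lemma l2Norm_le_rpow (h : IsFlow κ U K ((1 + r) / 2) u θ₀ θ) (hr1 : r < 1) {M β κ₁ : ℝ}
    (hβ : β = r + (d : ℝ) / 2) (hβ0 : 0 < β) (hM : 0 ≤ M)
    (hup : ∀ ρ, 0 < ρ → ‖cutLp ρ (hatPath θ 0)‖ ≤ M * ρ ^ β) (hκ₁ : κ ≤ κ₁) {G : ℝ} (hG : 0 < G)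
    (hGβ : (2 * Real.pi) ^ 2 * G = 2 * β) {T : ℝ} (hT : 0 ≤ T) :
    l2Norm (θ T) ≤ √(2 * (M * G ^ (β / 2) * κ₁ ^ ((1 - r) / 2) + driftConst d r ‖hatPath θ 0‖ K
      * G ^ (((d : ℝ) / 2 + 1) / 2)) ^ 2 + (‖hatPath θ 0‖ ^ 2 + 1) * κ₁ ^ ((d : ℝ) / 2 + 1))
      * (κ ^ (-((d : ℝ) / 4 + 1 / 2)) * (1 + T) ^ (-(β / 2))) := by
  have hκ := h.κ_pos
  have h1T : 0 < 1 + T := by linarith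
  have hD : 0 ≤ driftConst d r ‖hatPath θ 0‖ K :=
    driftConst_nonneg hr1 (norm_nonneg _) h.K_nonneg
  have h1 := h.sq_l2Norm_le hr1 hβ hβ0 hup (g := G / κ) (by positivity)
    (by rw [← hGβ]; field_simp) hT
  set D := driftConst d r ‖hatPath θ 0‖ K
  set w := κ ^ (-((d : ℝ) / 4 + 1 / 2)) with hw
  have hw0 : 0 < w := by positivity
  have hw2 : w ^ 2 * κ ^ ((d : ℝ) / 2 + 1) = 1 := by
    rw [hw, ← Real.rpow_natCast, ← Real.rpow_mul hκ.le, ← Real.rpow_add hκ,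
      show -((d : ℝ) / 4 + 1 / 2) * (2 : ℕ) + ((d : ℝ) / 2 + 1) = 0 by push_cast; ring,
      Real.rpow_zero]
  have e1 : (G / κ) ^ (β / 2) = G ^ (β / 2) * κ ^ ((1 - r) / 2) * w := by
    rw [Real.div_rpow hG.le hκ.le, hw, mul_assoc, ← Real.rpow_add hκ, div_eq_mul_inv,
      ← Real.rpow_neg hκ.le]
    congr 2
    rw [hβ]
    ring
  have e2 : (G / κ) ^ (((d : ℝ) / 2 + 1) / 2) = G ^ (((d : ℝ) / 2 + 1) / 2) * w := by
    rw [Real.div_rpow hG.le hκ.le, hw, div_eq_mul_inv, ← Real.rpow_neg hκ.le]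
    congr 2
    ring
  have e3 : (1 + T) ^ (-β) = ((1 + T) ^ (-(β / 2))) ^ 2 := by
    rw [← Real.rpow_natCast, ← Real.rpow_mul h1T.le]
    congr 1
    push_cast
    ring
  have h2 : κ ^ ((1 - r) / 2) ≤ κ₁ ^ ((1 - r) / 2) :=
    Real.rpow_le_rpow hκ.le hκ₁ (by linarith)
  have h3 : κ ^ ((d : ℝ) / 2 + 1) ≤ κ₁ ^ ((d : ℝ) / 2 + 1) :=
    Real.rpow_le_rpow hκ.le hκ₁ (by positivity)
  have hκ₁' : 0 < κ₁ := hκ.trans_le hκ₁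
  refine le_of_sq_le_sq ?_ (by positivity)
  rw [mul_pow, Real.sq_sqrt (by positivity), mul_pow, ← mul_assoc, ← e3]
  refine h1.trans (mul_le_mul_of_nonneg_right ?_ (by positivity))
  have h4 : M * (G / κ) ^ (β / 2) + D * (G / κ) ^ (((d : ℝ) / 2 + 1) / 2)
      ≤ (M * G ^ (β / 2) * κ₁ ^ ((1 - r) / 2) + D * G ^ (((d : ℝ) / 2 + 1) / 2)) * w := by
    rw [e1, e2, add_mul]
    calc _ = M * G ^ (β / 2) * κ ^ ((1 - r) / 2) * w + D * G ^ (((d : ℝ) / 2 + 1) / 2) * w := by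
          ring
      _ ≤ _ := by gcongr
  have h5 := pow_le_pow_left₀ (by positivity) h4 2
  rw [mul_pow] at h5
  have h6 : ‖hatPath θ 0‖ ^ 2 + 1
      ≤ (‖hatPath θ 0‖ ^ 2 + 1) * κ₁ ^ ((d : ℝ) / 2 + 1) * w ^ 2 := by
    have : 1 ≤ κ₁ ^ ((d : ℝ) / 2 + 1) * w ^ 2 := by
      have := mul_le_mul_of_nonneg_right h3 (sq_nonneg w)
      linarith
    rw [mul_assoc]
    exact le_mul_of_one_le_right (by positivity) this
  linarith

/-- The low frequencies of the initial value persist. -/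
lemma le_norm_cutLp (h : IsFlow κ U K ((1 + r) / 2) u θ₀ θ) (hr1 : r < 1) {M m₀ β κ₁ ε : ℝ}
    (hβ : β = r + (d : ℝ) / 2) (hε : 0 < ε) (hκ₁ : κ ≤ κ₁)
    (hup : ∀ ρ, 0 < ρ → ‖cutLp ρ (hatPath θ 0)‖ ≤ M * ρ ^ β)
    (hlow : ∀ ρ, 0 < ρ → ρ ≤ ε → m₀ * ρ ^ β ≤ ‖cutLp ρ (hatPath θ 0)‖)
    (hsmall : driftConst d r ‖hatPath θ 0‖ K * ε ^ (1 - r) + κ₁ * (2 * Real.pi) ^ 2 * ε ^ 2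
      * (M + driftConst d r ‖hatPath θ 0‖ K * ε ^ (1 - r)) ≤ m₀ / 2) {T : ℝ} (hT : 0 ≤ T) :
    m₀ / 2 * (ε ^ β * (1 + T) ^ (-(β / 2)))
      ≤ ‖cutLp (ε * (1 + T) ^ (-(1 / 2) : ℝ)) (hatPath θ T)‖ := by
  have hκ := h.κ_pos
  have h1T : 0 < 1 + T := by linarith
  have hD : 0 ≤ driftConst d r ‖hatPath θ 0‖ K :=
    driftConst_nonneg hr1 (norm_nonneg _) h.K_nonneg
  set D := driftConst d r ‖hatPath θ 0‖ K with hDd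
  set ρ := ε * (1 + T) ^ (-(1 / 2) : ℝ) with hρd
  have hρ : 0 < ρ := by positivity
  have hρε : ρ ≤ ε := mul_le_of_le_one_right hε.le
    (Real.rpow_le_one_of_one_le_of_nonpos (by linarith) (by norm_num))
  have hpow : ∀ p : ℝ, ρ ^ p = ε ^ p * (1 + T) ^ (-(p / 2)) := by
    intro p
    rw [hρd, Real.mul_rpow hε.le (by positivity), ← Real.rpow_mul h1T.le]
    congr 2
    ring
  have hρ2 : ρ ^ 2 * T ≤ ε ^ 2 := by
    have : ρ ^ 2 = ε ^ 2 * (1 + T)⁻¹ := by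
      rw [hρd, mul_pow, ← Real.rpow_natCast (_ ^ _), ← Real.rpow_mul h1T.le]
      norm_num [Real.rpow_neg_one]
    rw [this, mul_assoc]
    refine mul_le_of_le_one_right (by positivity) ?_
    rw [mul_comm, ← div_eq_mul_inv, div_le_one h1T]
    linarith
  set b := ε ^ β * (1 + T) ^ (-(β / 2)) with hb
  have hb0 : 0 < b := by positivity
  have e1 : ρ ^ β = b := hpow β
  -- The powers of 1 + T match those of the initial low frequencies exactly, so the drift error is
  -- smaller only by ε^(1 - r). The viscous error similarly gains ε² from ρ²T ≤ ε².
  have e2 : ρ ^ ((d : ℝ) / 2 + 1) * (1 + T) ^ ((1 - r) / 2) = ε ^ (1 - r) * b := by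
    rw [hpow, hb, mul_assoc, ← Real.rpow_add h1T, ← mul_assoc, ← Real.rpow_add hε]
    congr 2 <;> rw [hβ] <;> ring
  have h1 := h.norm_cutLp_sub_init_le (by linarith) hρ.le hT
  rw [lowFreqRate_mul_eq _ _ hρ, ← hDd, e2] at h1
  have h2 := hlow ρ hρ hρε
  have h3 := hup ρ hρ
  rw [e1] at h2 h3
  have h4 : κ * (2 * Real.pi) ^ 2 * ρ ^ 2 * T * (‖cutLp ρ (hatPath θ 0)‖ + D * (ε ^ (1 - r) * b))
      ≤ κ₁ * (2 * Real.pi) ^ 2 * ε ^ 2 * (M * b + D * (ε ^ (1 - r) * b)) := by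
    have hκ₁' : 0 < κ₁ := hκ.trans_le hκ₁
    rw [mul_assoc _ (ρ ^ 2)]
    gcongr
  have h5 := mul_le_mul_of_nonneg_right hsmall hb0.le
  have h6 := norm_sub_norm_le (cutLp ρ (hatPath θ 0)) (cutLp ρ (hatPath θ T))
  rw [norm_sub_rev] at h6
  linarith

end IsFlow
end AdvDiff
end

/-! ### From the hypotheses to the flow estimates, and the final bound. -/

noncomputable section
namespace AdvDiff

variable {d : ℕ}

namespace LowFreqBounds
variable {f : E d → ℝ} {r c₁ c₂ δ₀ : ℝ}

lemma mass_bounds (h : LowFreqBounds f r c₁ c₂ δ₀) {ρ : ℝ} (hρ : 0 < ρ)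
    (hρδ : 2 * Real.pi * ρ ≤ δ₀) :
    c₁ * (2 * Real.pi) ^ (2 * r) * (ρ ^ (r + (d : ℝ) / 2)) ^ 2 ≤ mass ρ (hat f) ∧
    mass ρ (hat f) ≤ c₂ * (2 * Real.pi) ^ (2 * r) * (ρ ^ (r + (d : ℝ) / 2)) ^ 2 := by
  have hpi : 0 < 2 * Real.pi := by positivity
  have h1 := h (2 * Real.pi * ρ) (by positivity) hρδ
  rw [setIntegral_fhat f (by positivity), inv_mul_cancel_left₀ hpi.ne'] at h1
  have e : (2 * Real.pi * ρ) ^ (2 * r + d)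
      = (2 * Real.pi) ^ d * ((2 * Real.pi) ^ (2 * r) * (ρ ^ (r + (d : ℝ) / 2)) ^ 2) := by
    rw [Real.mul_rpow hpi.le hρ.le, Real.rpow_add hpi, Real.rpow_natCast,
      ← Real.rpow_natCast (_ ^ _) 2, ← Real.rpow_mul hρ.le,
      show (r + (d : ℝ) / 2) * (2 : ℕ) = 2 * r + d by push_cast; ring]
    ring
  have hpd : 0 < (2 * Real.pi) ^ d := by positivity
  rw [e, mul_left_comm, mul_left_comm c₂, mul_le_mul_iff_right₀ hpd, mul_le_mul_iff_right₀ hpd,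
    ← mul_assoc, ← mul_assoc] at h1
  exact h1

lemma le_norm_cutLp (h : LowFreqBounds f r c₁ c₂ δ₀) (hc₁ : 0 ≤ c₁) {ρ : ℝ} (hρ : 0 < ρ)
    (hρδ : 2 * Real.pi * ρ ≤ δ₀) :
    √(c₁ * (2 * Real.pi) ^ (2 * r)) * ρ ^ (r + (d : ℝ) / 2) ≤ ‖cutLp ρ (hat f)‖ := by
  refine le_of_sq_le_sq ?_ (norm_nonneg _)
  rw [mul_pow, Real.sq_sqrt (by positivity), norm_cutLp_sq]
  exact (h.mass_bounds hρ hρδ).1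

/-- Above the range of the hypothesis the full norm suffices, since (2πρ/δ₀)^β ≥ 1 there. The bound
must hold for all ρ because the splitting radius is large when κ is small. -/
lemma norm_cutLp_le (h : LowFreqBounds f r c₁ c₂ δ₀) (hc₂ : 0 ≤ c₂) (hδ₀ : 0 < δ₀)
    (hβ : 0 ≤ r + (d : ℝ) / 2) {ρ : ℝ} (hρ : 0 < ρ) :
    ‖cutLp ρ (hat f)‖ ≤ max √(c₂ * (2 * Real.pi) ^ (2 * r))
      (‖hat f‖ * (2 * Real.pi / δ₀) ^ (r + (d : ℝ) / 2)) * ρ ^ (r + (d : ℝ) / 2) := by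
  rcases le_or_gt (2 * Real.pi * ρ) δ₀ with hρδ | hρδ
  · refine le_trans ?_ (mul_le_mul_of_nonneg_right (le_max_left _ _) (by positivity))
    refine le_of_sq_le_sq ?_ (by positivity)
    rw [mul_pow, Real.sq_sqrt (by positivity), norm_cutLp_sq]
    exact (h.mass_bounds hρ hρδ).2
  · refine le_trans ?_ (mul_le_mul_of_nonneg_right (le_max_right _ _) (by positivity))
    have h1 : 1 ≤ (2 * Real.pi / δ₀) ^ (r + (d : ℝ) / 2) * ρ ^ (r + (d : ℝ) / 2) := by
      rw [← Real.mul_rpow (by positivity) hρ.le]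
      refine Real.one_le_rpow ?_ hβ
      rw [div_mul_eq_mul_div, one_le_div hδ₀]
      exact hρδ.le
    have h2 : ‖cutLp ρ (hat f)‖ ≤ ‖hat f‖ :=
      le_of_sq_le_sq ((norm_cutLp_sq ρ _).trans_le (mass_le ρ _)) (norm_nonneg _)
    rw [mul_assoc]
    exact h2.trans (le_mul_of_one_le_right (norm_nonneg _) h1)

end LowFreqBounds

/-- A velocity field of the class considered in the theorem is bounded and advects as a flow. -/
lemma IsVelocityField.isFlow {r α K κ ν : ℝ} {u : ℝ → E d → E d}
    {Du : ℝ → E d → (E d →L[ℝ] E d)} {θ₀ : E d → ℝ} {θ : ℝ → E d → ℝ} (hu : IsVelocityField u Du)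
    (hr : -1 < r) (hα : r / 2 + 1 / 2 ≤ α) (hν : 0 ≤ ν) (hK : 0 ≤ K) (hκ : 0 < κ)
    (h2 : SimPow K (fun t => l2Norm (u t)) α) (hi : SimPow K (fun t => lInfNorm (Du t)) ν)
    (hθ₀ : MemLp θ₀ 2) (hθ : IsSolution κ u θ₀ θ) :
    IsFlow κ √(2 * K ^ 2 / volume.real (Metric.ball (0 : E d) 1) + 2 * K ^ 2) K ((1 + r) / 2)
      u θ₀ θ := by
  have hle : ∀ {p t : ℝ}, 0 ≤ p → 0 < t → K * (1 + t) ^ (-p) ≤ K := fun hp ht =>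
    mul_le_of_le_one_right hK (Real.rpow_le_one_of_one_le_of_nonpos (by linarith) (by linarith))
  exact
    { κ_pos := hκ
      U_nonneg := Real.sqrt_nonneg _
      K_nonneg := hK
      a_pos := by linarith
      solution := hθ
      memLp_init := hθ₀
      aestronglyMeasurable := hu.aestronglyMeasurable
      memLp := hu.memLp
      divFree := hu.divFree
      bounded := fun t ht => (hu.hasWeakDeriv t ht).ae_norm_le (hu.memLp t ht)
        (hu.memLp_deriv t ht) ((h2 t ht).2.trans (hle (by linarith) ht))
        ((hi t ht).2.trans (hle hν ht))
      decay := fun t ht => (h2 t ht).2.trans (mul_le_mul_of_nonneg_left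
        (Real.rpow_le_rpow_of_exponent_le (by linarith) (by linarith)) hK) }

/-- The constant in the energy decay estimate. -/
def decayConst (d : ℕ) (r A K M κ₁ : ℝ) : ℝ :=
  √(2 * (M * (2 * (r + (d : ℝ) / 2) / (2 * Real.pi) ^ 2) ^ ((r + (d : ℝ) / 2) / 2)
      * κ₁ ^ ((1 - r) / 2) + IsFlow.driftConst d r A K
      * (2 * (r + (d : ℝ) / 2) / (2 * Real.pi) ^ 2) ^ (((d : ℝ) / 2 + 1) / 2)) ^ 2
    + (A ^ 2 + 1) * κ₁ ^ ((d : ℝ) / 2 + 1))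

lemma decayConst_pos (d : ℕ) (r A K M : ℝ) {κ₁ : ℝ} (hκ₁ : 0 < κ₁) :
    0 < decayConst d r A K M κ₁ := by
  unfold decayConst
  positivity

/-- The lower bound at radius ρ = ε(1 + T)^(-1/2) and the energy bound share the rate (1 +
T)^(-β/2). It cancels in the quotient, and 1/ρ leaves (1 + T)^(1/2). The low frequency bound also
makes θ(T) nonzero. -/
lemma IsFlow.le_filamentationLength {κ U K r : ℝ} {u : ℝ → E d → E d} {θ₀ : E d → ℝ}
    {θ : ℝ → E d → ℝ} (h : IsFlow κ U K ((1 + r) / 2) u θ₀ θ) (hd : 2 ≤ d) (hr1 : r < 1)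
    {M m₀ κ₁ ε : ℝ} (hr : 1 < r + (d : ℝ) / 2) (hM : 0 ≤ M) (hm₀ : 0 < m₀) (hε : 0 < ε)
    (hκ₁ : κ ≤ κ₁)
    (hup : ∀ ρ, 0 < ρ → ‖cutLp ρ (hatPath θ 0)‖ ≤ M * ρ ^ (r + (d : ℝ) / 2))
    (hlow : ∀ ρ, 0 < ρ → ρ ≤ ε → m₀ * ρ ^ (r + (d : ℝ) / 2) ≤ ‖cutLp ρ (hatPath θ 0)‖)
    (hsmall : driftConst d r ‖hatPath θ 0‖ K * ε ^ (1 - r) + κ₁ * (2 * Real.pi) ^ 2 * ε ^ 2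
      * (M + driftConst d r ‖hatPath θ 0‖ K * ε ^ (1 - r)) ≤ m₀ / 2) {T : ℝ} (hT : 0 ≤ T) :
    m₀ / 2 * ε ^ (r + (d : ℝ) / 2 - 1) / decayConst d r ‖hatPath θ 0‖ K M κ₁
      * (κ ^ ((d : ℝ) / 4 + 1 / 2) * (1 + T) ^ (1 / 2 : ℝ)) ≤ filamentationLength (θ T) := by
  have hκ := h.κ_pos
  have h1T : 0 < 1 + T := by linarith
  have hL := decayConst_pos d r ‖hatPath θ 0‖ K M (hκ.trans_le hκ₁)
  have hup1 := h.l2Norm_le_rpow hr1 rfl (by linarith) hM hup hκ₁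
    (G := 2 * (r + (d : ℝ) / 2) / (2 * Real.pi) ^ 2) (by positivity) (by field_simp) hT
  have hlow1 := h.le_norm_cutLp hr1 rfl hε hκ₁ hup hlow hsmall hT
  set β := r + (d : ℝ) / 2 with hβ
  change _ ≤ decayConst d r ‖hatPath θ 0‖ K M κ₁ * _ at hup1
  set L := decayConst d r ‖hatPath θ 0‖ K M κ₁
  set ρ := ε * (1 + T) ^ (-(1 / 2) : ℝ) with hρd
  have hρ : 0 < ρ := by positivity
  have hcut : ‖cutLp ρ (hatPath θ T)‖ ≤ ρ * invGradNorm (θ T) := by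
    have hmass := fun (σ : ℝ) (hσ : 0 < σ) (hσ1 : σ ≤ 1) => h.mass_le_rpow hr1 hup hT hσ hσ1
    rw [hatPath_of_nonneg hT] at hmass ⊢
    exact norm_cutLp_le_mul_invGradNorm hd (θ T) (by linarith) one_pos hmass hρ
  have hpos : 0 < ‖cutLp ρ (hatPath θ T)‖ := lt_of_lt_of_le (by positivity) hlow1
  have hl2 : 0 < l2Norm (θ T) := by
    rw [← h.norm_hatPath hT]
    refine hpos.trans_le (le_of_sq_le_sq ((norm_cutLp_sq ρ _).trans_le (mass_le ρ _))
      (norm_nonneg _))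
  have e1 : (1 + T) ^ (1 / 2 : ℝ) * (1 + T) ^ (-(1 / 2) : ℝ) = 1 := by
    rw [← Real.rpow_add h1T]
    norm_num
  have e2 : κ ^ ((d : ℝ) / 4 + 1 / 2) * κ ^ (-((d : ℝ) / 4 + 1 / 2)) = 1 := by
    rw [← Real.rpow_add hκ]
    norm_num
  have e3 : ε ^ (β - 1) * ε = ε ^ β := by
    rw [Real.rpow_sub_one hε.ne']
    field_simp
  rw [filamentationLength, le_div_iff₀ hl2]
  refine le_of_mul_le_mul_left ?_ hρ
  refine le_trans ?_ (hlow1.trans hcut)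
  calc _ ≤ ρ * (m₀ / 2 * ε ^ (β - 1) / L * (κ ^ ((d : ℝ) / 4 + 1 / 2) * (1 + T) ^ (1 / 2 : ℝ))
        * (L * (κ ^ (-((d : ℝ) / 4 + 1 / 2)) * (1 + T) ^ (-(β / 2))))) := by gcongr
    _ = (ε ^ (β - 1) * ε) * ((1 + T) ^ (1 / 2 : ℝ) * (1 + T) ^ (-(1 / 2) : ℝ))
        * (κ ^ ((d : ℝ) / 4 + 1 / 2) * κ ^ (-((d : ℝ) / 4 + 1 / 2)))
        * (m₀ / 2 * (1 + T) ^ (-(β / 2))) := by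
        rw [hρd]
        field_simp
    _ = _ := by
        rw [e1, e2, e3]
        ring

lemma exists_small_radius {D κ₁ M m₀ p σ : ℝ} (hp : 0 < p) (hm₀ : 0 < m₀) (hσ : 0 < σ) :
    ∃ ε, 0 < ε ∧ ε ≤ σ ∧ D * ε ^ p + κ₁ * (2 * Real.pi) ^ 2 * ε ^ 2 * (M + D * ε ^ p) ≤ m₀ / 2 := by
  have hc : Tendsto (fun ε : ℝ => D * ε ^ p + κ₁ * (2 * Real.pi) ^ 2 * ε ^ 2 * (M + D * ε ^ p))
      (𝓝[>] 0) (𝓝 0) := by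
    have : ContinuousAt (fun ε : ℝ =>
        D * ε ^ p + κ₁ * (2 * Real.pi) ^ 2 * ε ^ 2 * (M + D * ε ^ p)) 0 := by
      have h1 : ContinuousAt (fun ε : ℝ => ε ^ p) 0 :=
        Real.continuousAt_rpow_const 0 p (Or.inr hp.le)
      fun_prop
    have h2 := this.tendsto
    simp only [Real.zero_rpow hp.ne', mul_zero, zero_pow two_ne_zero, zero_mul, add_zero] at h2
    exact h2.mono_left nhdsWithin_le_nhds
  obtain ⟨ε, h1, h2⟩ := ((hc.eventually (ge_mem_nhds (half_pos hm₀))).and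
    (Ioc_mem_nhdsGT hσ)).exists
  exact ⟨ε, h2.1, h2.2, h1⟩

/-- Comparison of `factor` with the power of the diffusivity in the flow estimate. -/
lemma inv_factor_le {r m κ κ₁ ν t : ℝ} (hm : (d : ℝ) / 2 + r / 2 ≤ m) (hκ : 0 < κ)
    (hκ₁ : κ ≤ κ₁) (ht : 0 < t) :
    (factor d r m κ ν t)⁻¹ ≤ κ₁ ^ (m - d / 2 - r / 2) * κ ^ ((d : ℝ) / 4 + 1 / 2) := by
  have h1 := one_le_timeFactor ν ht
  rw [factor_eq, mul_inv, ← Real.rpow_neg hκ.le,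
    show -((d : ℝ) / 4 + r / 2 - m - 1 / 2) = (m - d / 2 - r / 2) + (d / 4 + 1 / 2) by ring,
    Real.rpow_add hκ]
  have h2 : (timeFactor ν t)⁻¹ ≤ 1 := inv_le_one_of_one_le₀ h1
  have h3 : κ ^ (m - d / 2 - r / 2) ≤ κ₁ ^ (m - d / 2 - r / 2) :=
    Real.rpow_le_rpow hκ.le hκ₁ (by linarith)
  refine (mul_le_of_le_one_right (by positivity) h2).trans ?_
  gcongr

end AdvDiff
end

theorem mainTheorem3 (d : ℕ) (hd : d = 2 ∨ d = 3)
    (r : ℝ) (hr : 1 - (d : ℝ) / 2 < r) (hr1 : r < 1)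
    (α : ℝ) (hα : r / 2 + 1 / 2 < α)
    (m : ℚ) (hm : (d : ℚ) + 2 ≤ m) :
    -- lower bound; `C` depends only on the quantities that are quantified before it
    (∀ A B c₁ c₂ δ₀ K κ₁ : ℝ, 0 < c₁ → 0 < c₂ → 0 < δ₀ → 0 < K → 0 < κ₁ →
      ∃ C : ℝ, 0 < C ∧
        ∀ (θ₀ : AdvDiff.E d → ℝ) (Dθ₀ : AdvDiff.E d → (AdvDiff.E d →L[ℝ] ℝ)),
          MemLp θ₀ 2 volume → AdvDiff.l2Norm θ₀ = A →
          AdvDiff.HasWeakDeriv θ₀ Dθ₀ → MemLp Dθ₀ 2 volume → AdvDiff.l2Norm Dθ₀ = B →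
          AdvDiff.HasDecayCharacter θ₀ r → AdvDiff.LowFreqBounds θ₀ r c₁ c₂ δ₀ →
        ∀ (ν : ℝ) (u : ℝ → AdvDiff.E d → AdvDiff.E d)
          (Du : ℝ → AdvDiff.E d → (AdvDiff.E d →L[ℝ] AdvDiff.E d)),
          0 ≤ ν → AdvDiff.IsVelocityField u Du →
          AdvDiff.SimPow K (fun t => AdvDiff.l2Norm (u t)) α →
          AdvDiff.SimPow K (fun t => AdvDiff.lInfNorm (Du t)) ν →
        ∀ (κ : ℝ) (θ : ℝ → AdvDiff.E d → ℝ), 0 < κ → κ ≤ κ₁ →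
          AdvDiff.IsSolution κ u θ₀ θ →
        ∀ t : ℝ, 0 < t → AdvDiff.LargeTime d r α m κ t →
          C * (1 + t) ^ (1 / 2 : ℝ) * (AdvDiff.factor d r m κ ν t)⁻¹
            ≤ AdvDiff.filamentationLength (θ t)) ∧
    -- asymptotics of the bound
    (∀ κ ν : ℝ, 0 < κ → 1 ≤ ν →
      Tendsto (fun t : ℝ => (1 + t) ^ (1 / 2 : ℝ) * (AdvDiff.factor d r m κ ν t)⁻¹)
        atTop atTop) ∧
    (∀ κ ν : ℝ, 0 < κ → 0 ≤ ν → ν < 1 →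
      Tendsto (fun t : ℝ => (1 + t) ^ (1 / 2 : ℝ) * (AdvDiff.factor d r m κ ν t)⁻¹)
        atTop (𝓝 0)) := by
  have hd2 : 2 ≤ d := by omega
  have hdR : (d : ℝ) ≤ 3 := by exact_mod_cast (by omega : d ≤ 3)
  have hβ : 1 < r + (d : ℝ) / 2 := by linarith
  have hmR : (d : ℝ) + 2 ≤ (m : ℝ) := by exact_mod_cast hm
  refine ⟨?_, fun κ ν hκ hν => AdvDiff.tendsto_bound_atTop d r m κ ν hκ hν,
    fun κ ν _ _ hν => AdvDiff.tendsto_bound_zero d r m κ ν hν⟩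
  intro A B c₁ c₂ δ₀ K κ₁ hc₁ hc₂ hδ₀ hK hκ₁
  set M := max √(c₂ * (2 * Real.pi) ^ (2 * r)) (A * (2 * Real.pi / δ₀) ^ (r + (d : ℝ) / 2))
    with hM
  set m₀ := √(c₁ * (2 * Real.pi) ^ (2 * r)) with hm₀d
  have hm₀ : 0 < m₀ := by positivity
  have hM0 : 0 ≤ M := (Real.sqrt_nonneg _).trans (le_max_left _ _)
  obtain ⟨ε, hε, hεδ, hsmall⟩ := AdvDiff.exists_small_radius
    (D := AdvDiff.IsFlow.driftConst d r A K) (κ₁ := κ₁) (M := M) (p := 1 - r)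
    (σ := δ₀ / (2 * Real.pi)) (by linarith) hm₀ (by positivity)
  set c := m₀ / 2 * ε ^ (r + (d : ℝ) / 2 - 1) / AdvDiff.decayConst d r A K M κ₁ with hc
  have hL := AdvDiff.decayConst_pos d r A K M hκ₁
  have hc0 : 0 < c := by positivity
  set q := κ₁ ^ ((m : ℝ) - d / 2 - r / 2) with hq
  have hq0 : 0 < q := by positivity
  -- c is the constant of the flow estimate; q pays for trading the κ power in `factor` for κ^(d/4 +
  -- 1/2). Both are fixed by the data quantified so far.
  refine ⟨c / q, by positivity, ?_⟩
  intro θ₀ Dθ₀ hθ₀ hA _ _ _ _ hlow ν u Du hν hu h2 hi κ θ hκ hκκ₁ hθ t ht _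
  have hflow := hu.isFlow (r := r) (by linarith) (by linarith) hν hK.le hκ h2 hi hθ₀ hθ
  have h0 := hflow.hatPath_zero
  have hnorm : ‖AdvDiff.hat θ₀‖ = A := (AdvDiff.norm_hat hθ₀).trans hA
  have key := hflow.le_filamentationLength hd2 hr1 (M := M) (m₀ := m₀) (κ₁ := κ₁) (ε := ε) hβ hM0
    hm₀ hε hκκ₁
    (fun ρ hρ => by
      have := hlow.norm_cutLp_le hc₂.le hδ₀ (by linarith) hρ
      rwa [hnorm, ← h0] at this)
    (fun ρ hρ hρε => by
      rw [h0]
      refine hlow.le_norm_cutLp hc₁.le hρ ?_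
      rw [le_div_iff₀ (by positivity)] at hεδ
      nlinarith [Real.pi_pos])
    (by rwa [h0, hnorm]) ht.le
  rw [h0, hnorm, ← hc] at key
  refine le_trans ?_ key
  have hf := AdvDiff.inv_factor_le (d := d) (r := r) (m := m) (ν := ν) (by linarith) hκ hκκ₁ ht
  have h1t : 0 < 1 + t := by linarith
  calc _ ≤ c / q * (1 + t) ^ (1 / 2 : ℝ) * (q * κ ^ ((d : ℝ) / 4 + 1 / 2)) := by gcongr
    _ = _ := by field_simp
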